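/- **Setting.** Let $f$ be holomorphic on an open neighbourhood of the unit circle $\partial\mathcal D_1$, and non-vanishing there with a holomorphic logarithm $\ln f$ on that neighbourhood. Write $c_n[g]=\oint_{\partial\mathcal D_1}\frac{g(z)}{z^{n+1}}\frac{dz}{2i\pi}$, and let $$\alpha(z)=\exp\Big\{-\sum_{n\ge 0}c_n[\ln f]\,z^n\Big\}\ (|z|<1),\qquad \alpha(z)=\exp\Big\{\sum_{n\ge 1}c_{-n}[\ln f]\,z^{-n}\Big\}\ (|z|>1),$$ with boundary values $\alpha_+$ (from $|z|<1$) and $\alpha_-$ (from $|z|>1$) on $\partial\mathcal D_1$. Let $n_\pm,r_\pm\ge 0$ be integers, $n=n_++n_-$, $r=r_++r_-$, and let $p^\pm_a,h^\pm_a$ ($1\le a\le n_\pm$) and $k^\pm_a,t^\pm_a$ ($1\le a\le r_\pm$) be integers $\ge 1$ that do not depend on $N$, each of the eight families consisting of pairwise distinct integers. Put $$p_a=1-p_a^-,\quad h_a=h_a^-\quad(1\le a\le n_-),\qquad p_{a+n_-}=p_a^++N,\quad h_{a+n_-}=N+1-h_a^+\quad(1\le a\le n_+),$$ $$k_a=1-k_a^-,\quad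 t_a=t_a^-\quad(1\le a\le r_-),\qquad k_{a+r_-}=k_a^++N,\quad t_{a+r_-}=N+1-t_a^+\quad(1\le a\le r_+),$$ and let $\ell_{h_a}=p_a$, $\ell_a=a$ for $a\notin\{h_1,\dots,h_n\}$, $m_{t_a}=k_a$, $m_a=a$ for $a\notin\{t_1,\dots,t_r\}$. Families $\{h_a\}_1^{n'}$ and $\{t_b\}_1^{r'}$ are *well-ordered with overlap* $c\in\{0,\dots,\min(n',r')\}$ if $h_a=t_a$ for $a\le c$ and $\{h_{c+1},\dots,h_{n'}\}\cap\{t_{c+1},\dots,t_{r'}\}=\emptyset$. For $\epsilon=\pm1$, integer data $\mathcal J=\{\{p_a\}_1^{n'};\{h_a\}_1^{n'};\{k_a\}_1^{r'};\{t_a\}_1^{r'}\}$ and $0\le c\le\min(n',r')$, let $\mathcal N^{(\epsilon)}(\mathcal J;c)$ be the $(n'+r')\times(n'+r')$ matrix with blocks $\begin{pmatrix}\mathcal N_{I;I}&\mathcal N_{I;II}\\ \mathcal N_{II;I}&\mathcal N_{II;II}\end{pmatrix}$ given as follows. Write $A_{\sigma\tau}=(\alpha_\sigma(z)/\alpha_\tau(s))^{\epsilon}$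 and $$\langle F\rangle_{\pm}=\lim_{\eta\to0^+}\oint_{\partial\mathcal D_1}\frac{dz}{2i\pi}\oint_{\partial\mathcal D_1}\frac{ds}{2i\pi}\,\frac{F(z,s)}{z(1\pm\epsilon\eta)-s}.$$ Then $$(\mathcal N_{I;I})_{ab}=-\epsilon\Big\langle\delta_{b\le c}\delta_{a\le c}A_{-\epsilon,-\epsilon}s^{\epsilon h_a-1}z^{\epsilon k_b-1}+\delta_{b>c}A_{\epsilon,\epsilon}s^{-\epsilon p_a}z^{-\epsilon h_b}-\delta_{b>c}\delta_{a\le c}A_{\epsilon,-\epsilon}s^{\epsilon h_a-1}z^{-\epsilon h_b}\Big\rangle_-+\epsilon\,\delta_{b\le c}\Big\langle A_{-\epsilon,\epsilon}s^{-\epsilon p_a}z^{\epsilon k_b-1}\Big\rangle_+,$$ $$(\mathcal N_{I;II})_{ab}=-\epsilon\Big\langle\delta_{b\le c}\delta_{a\le c}A_{\epsilon,-\epsilon}s^{\epsilon h_a-1}z^{-\epsilon t_b}+\delta_{b>c}\delta_{a\le c}A_{-\epsilon,-\epsilon}s^{\epsilon h_a-1}z^{\epsilon k_b-1}-\delta_{b\le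 c}A_{\epsilon,\epsilon}s^{-\epsilon p_a}z^{-\epsilon t_b}\Big\rangle_-+\epsilon\,\delta_{b>c}\Big\langle A_{-\epsilon,\epsilon}s^{-\epsilon p_a}z^{\epsilon k_b-1}\Big\rangle_+,$$ $$(\mathcal N_{II;I})_{ab}=-\epsilon\Big\langle s^{\epsilon t_a-1}\big\{\delta_{b\le c}A_{-\epsilon,-\epsilon}z^{\epsilon k_b-1}-\delta_{b>c}A_{\epsilon,-\epsilon}z^{-\epsilon h_b}\big\}\Big\rangle_-,$$ $$(\mathcal N_{II;II})_{ab}=-\epsilon\Big\langle s^{\epsilon t_a-1}\big\{\delta_{b\le c}A_{\epsilon,-\epsilon}z^{-\epsilon t_b}+\delta_{b>c}A_{-\epsilon,-\epsilon}z^{\epsilon k_b-1}\big\}\Big\rangle_-.$$ **Theorem.** Suppose that $\{h_a^+\}_1^{n_+}$ and $\{t_a^+\}_1^{r_+}$ (resp. $\{h_a^-\}_1^{n_-}$ and $\{t_a^-\}_1^{r_-}$) are well-ordered with overlap $c_+$ (resp. $c_-$). Let $$\mathcal J^{(+)}=\{\{p_a^+\};\{h_a^+\};\{k_a^+\};\{t_a^+\}\},\qquad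 \mathcal J^{(-)}=\{\{p_a^--1\};\{h_a^--1\};\{k_a^--1\};\{t_a^--1\}\},$$ and suppose that $\mathcal N^{(\pm)}(\mathcal J^{(\pm)};c_\pm)$ have maximal rank, that is, rank $n_\pm+r_\pm$. Then the boundary values $\alpha_\pm$ and the limits $\eta\to0^+$ which define these two matrices exist, $\det_N[c_{a-b}[f]]\ne0$ for all large $N$, and, as $N\to\infty$, $$\frac{\det_N[c_{\ell_a-m_b}[f]]}{\det_N[c_{a-b}[f]]}=\det_{n_++r_+}\big[\mathcal N^{(+)}(\mathcal J^{(+)};c_+)\big]\cdot\det_{n_-+r_-}\big[\mathcal N^{(-)}(\mathcal J^{(-)};c_-)\big]\cdot\big(1+O(N^{-\infty})\big),$$ where $O(N^{-\infty})$ denotes a quantity that is $O(N^{-K})$ for every $K\ge0$. -/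

import Mathlib

open Filter Topology

noncomputable section

namespace LacunaryToeplitz

/-! ### Lacunary Toeplitz matrices -/

/-- The Laurent coefficient `c_n[g] = (2πi)⁻¹ ∮ g(z) z^{-(n+1)} dz` over the positively oriented
unit circle. -/
def laurentCoeff (g : ℂ → ℂ) (n : ℤ) : ℂ :=
  (2 * (Real.pi : ℂ) * Complex.I)⁻¹ * ∮ z in C(0, 1), g z / z ^ (n + 1)

/-- The lacunary sequence which takes the value `y i` at the index `x i` and the value `a` at every
other index `a` (the `x i` being pairwise distinct). -/
def lacSeq {ι : Type} (x y : ι → ℤ) : ℤ → ℤ :=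
  Function.extend x y id

/-- The `N × N` matrix `(c_{ℓ_a - m_b}[f])`, with `a, b` running through `1, …, N`. -/
def toeplitzMatrix (f : ℂ → ℂ) (N : ℕ) (l m : ℤ → ℤ) : Matrix (Fin N) (Fin N) ℂ :=
  Matrix.of fun a b => laurentCoeff f (l ((a : ℤ) + 1) - m ((b : ℤ) + 1))

/-- The families `h_1, …, h_n` and `t_1, …, t_r` are well-ordered with overlap `c`: they agree on
their first `c` entries, and their remaining entries have nothing in common. -/
def WellOrdered {n r : ℕ} (h : Fin n → ℤ) (t : Fin r → ℤ) (c : ℕ) : Prop :=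
  c ≤ min r n ∧
  (∀ (a : Fin n) (b : Fin r), (a : ℕ) = (b : ℕ) → (a : ℕ) < c → h a = t b) ∧
  (∀ (a : Fin n) (b : Fin r), c ≤ (a : ℕ) → c ≤ (b : ℕ) → h a ≠ t b)

/-- `u = O(N^{-∞})`: `u` decays faster than every power of `1/N`. -/
def IsBigONegInfty (u : ℕ → ℂ) : Prop :=
  ∀ K : ℕ, u =O[atTop] fun N : ℕ => ((N : ℝ) ^ K)⁻¹

/-! ### The piecewise analytic function `α` and its boundary values -/

/-- `α(z) = exp(-∑_{n ≥ 0} c_n[ln f] z^n)` for `|z| < 1` and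
`α(z) = exp(∑_{n ≥ 1} c_{-n}[ln f] z^{-n})` for `|z| > 1`. (Values on the unit circle itself are
never used.) -/
def alpha (lnf : ℂ → ℂ) (z : ℂ) : ℂ :=
  if ‖z‖ < 1 then Complex.exp (-∑' n : ℕ, laurentCoeff lnf (n : ℤ) * z ^ n)
  else Complex.exp (∑' n : ℕ, laurentCoeff lnf (-((n : ℤ) + 1)) * z ^ (-((n : ℤ) + 1)))

/-- Boundary value of `α` on the unit circle from the inside. -/
def alphaPlus (lnf : ℂ → ℂ) (z : ℂ) : ℂ :=
  limUnder (𝓝[Metric.ball 0 1] z) (alpha lnf)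

/-- Boundary value of `α` on the unit circle from the outside. -/
def alphaMinus (lnf : ℂ → ℂ) (z : ℂ) : ℂ :=
  limUnder (𝓝[(Metric.closedBall 0 1)ᶜ] z) (alpha lnf)

/-- `α_ε`, for a sign `ε = ±1`. -/
def alphaSign (lnf : ℂ → ℂ) (ε : ℤ) : ℂ → ℂ :=
  if 0 < ε then alphaPlus lnf else alphaMinus lnf

/-! ### The matrices `N^{(ε)}(J; c)` -/

/-- The integer data `J = { {p_a} ; {h_a} ; {k_a} ; {t_a} }`. -/
structure LacData (n r : ℕ) where
  p : Fin n → ℤ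
  h : Fin n → ℤ
  k : Fin r → ℤ
  t : Fin r → ℤ

/-- The Kronecker-type symbol `δ_P`. -/
def ind (P : Prop) [Decidable P] : ℂ := if P then 1 else 0

/-- `∮∮ F(z, s) / (z x - s) ds dz / (2πi)²`, both integrals over the unit circle, with the pole
moved off the circle by a factor `x ≠ 1`. -/
def shiftedInt (x : ℝ) (F : ℂ → ℂ → ℂ) : ℂ :=
  ((2 * (Real.pi : ℂ) * Complex.I) ^ 2)⁻¹ *
    ∮ z in C(0, 1), ∮ s in C(0, 1), F z s / (z * (x : ℂ) - s)

section Blocks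

variable (lnf : ℂ → ℂ) (ε : ℤ) {n r : ℕ} (J : LacData n r) (c : ℕ) (η : ℝ)

/-- `(α_σ(z) / α_τ(s))^ε`. -/
def alphaRatio (σ τ : ℤ) (z s : ℂ) : ℂ :=
  (alphaSign lnf σ z / alphaSign lnf τ s) ^ ε

/-- Block `I;I` of `N^{(ε)}(J; c)`, with `0⁺` replaced by `η > 0`. Indices start at `0`, so that
`a < c` here means that the index is one of the first `c` ones. As `c ≤ r`, the test `b < r` only
makes `k_b` meaningful in the terms that carry `δ_{b < c}`. -/
def blockI_I : Matrix (Fin n) (Fin n) ℂ := Matrix.of fun a b =>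
  -(ε : ℂ) * shiftedInt (1 - ε * η) (fun z s =>
      ind ((b : ℕ) < c) * ind ((a : ℕ) < c) * alphaRatio lnf ε (-ε) (-ε) z s
          * s ^ (ε * J.h a - 1)
          * (if hb : (b : ℕ) < r then z ^ (ε * J.k ⟨b, hb⟩ - 1) else 0)
      + ind (c ≤ (b : ℕ)) * alphaRatio lnf ε ε ε z s * s ^ (-ε * J.p a) * z ^ (-ε * J.h b)
      - ind (c ≤ (b : ℕ)) * ind ((a : ℕ) < c) * alphaRatio lnf ε ε (-ε) z s
          * s ^ (ε * J.h a - 1) * z ^ (-ε * J.h b))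
  + (ε : ℂ) * ind ((b : ℕ) < c) * shiftedInt (1 + ε * η) (fun z s =>
      s ^ (-ε * J.p a) * (if hb : (b : ℕ) < r then z ^ (ε * J.k ⟨b, hb⟩ - 1) else 0)
        * alphaRatio lnf ε (-ε) ε z s)

/-- Block `I;II` of `N^{(ε)}(J; c)`, with `0⁺` replaced by `η > 0`. -/
def blockI_II : Matrix (Fin n) (Fin r) ℂ := Matrix.of fun a b =>
  -(ε : ℂ) * shiftedInt (1 - ε * η) (fun z s =>
      ind ((b : ℕ) < c) * ind ((a : ℕ) < c) * alphaRatio lnf ε ε (-ε) z s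
          * s ^ (ε * J.h a - 1) * z ^ (-ε * J.t b)
      + ind (c ≤ (b : ℕ)) * ind ((a : ℕ) < c) * alphaRatio lnf ε (-ε) (-ε) z s
          * s ^ (ε * J.h a - 1) * z ^ (ε * J.k b - 1)
      - ind ((b : ℕ) < c) * alphaRatio lnf ε ε ε z s * s ^ (-ε * J.p a) * z ^ (-ε * J.t b))
  + (ε : ℂ) * ind (c ≤ (b : ℕ)) * shiftedInt (1 + ε * η) (fun z s =>
      s ^ (-ε * J.p a) * z ^ (ε * J.k b - 1) * alphaRatio lnf ε (-ε) ε z s)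

/-- Block `II;I` of `N^{(ε)}(J; c)`, with `0⁺` replaced by `η > 0`. -/
def blockII_I : Matrix (Fin r) (Fin n) ℂ := Matrix.of fun a b =>
  -(ε : ℂ) * shiftedInt (1 - ε * η) (fun z s =>
      s ^ (ε * J.t a - 1) *
        (ind ((b : ℕ) < c) * alphaRatio lnf ε (-ε) (-ε) z s
            * (if hb : (b : ℕ) < r then z ^ (ε * J.k ⟨b, hb⟩ - 1) else 0)
          - ind (c ≤ (b : ℕ)) * alphaRatio lnf ε ε (-ε) z s * z ^ (-ε * J.h b)))

/-- Block `II;II` of `N^{(ε)}(J; c)`, with `0⁺` replaced by `η > 0`. -/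
def blockII_II : Matrix (Fin r) (Fin r) ℂ := Matrix.of fun a b =>
  -(ε : ℂ) * shiftedInt (1 - ε * η) (fun z s =>
      s ^ (ε * J.t a - 1) *
        (ind ((b : ℕ) < c) * alphaRatio lnf ε ε (-ε) z s * z ^ (-ε * J.t b)
          + ind (c ≤ (b : ℕ)) * alphaRatio lnf ε (-ε) (-ε) z s * z ^ (ε * J.k b - 1)))

/-- The `(n+r) × (n+r)` block matrix with `0⁺` replaced by `η > 0`. -/
def matNReg : Matrix (Fin n ⊕ Fin r) (Fin n ⊕ Fin r) ℂ :=
  Matrix.fromBlocks (blockI_I lnf ε J c η) (blockI_II lnf ε J c η)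
    (blockII_I lnf ε J c η) (blockII_II lnf ε J c η)

/-- The matrix `N^{(ε)}(J; c)`: the (entrywise) limit `η → 0⁺`. -/
def matN : Matrix (Fin n ⊕ Fin r) (Fin n ⊕ Fin r) ℂ :=
  limUnder (𝓝[>] (0 : ℝ)) (fun η : ℝ => matNReg lnf ε J c η)

end Blocks

end LacunaryToeplitz

end

/-! Changing a bounded number of rows and columns of the Toeplitz matrix `T_N` of `f` is a
finite-rank perturbation. The ratio of determinants is therefore exactly a determinant of fixed
size, whose entries are bilinear forms of the inverse of `T_N` (`det_replace_rows_cols`). Only the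
asymptotics of these entries are needed.

On the unit circle `f = facA * facB`, where `facA` extends holomorphically to a disc larger than the
unit disc and `facB` to the exterior of a smaller disc. The Laurent coefficients of the two factors
and of their inverses are one-sided and decay exponentially (`HolCircle.exists_wienerHopf`).
One-sidedness makes the truncated factors `A`, `B` triangular, with the truncations of the inverse
symbols as exact inverses, while `T_N - A B` is concentrated in the corner at index `(0, 0)`. Hence
`B⁻¹ A⁻¹` solves the Toeplitz system up to exponentially small errors when the data live near the
right end. The reflection `z ↦ 1/z` gives the same at the left end. Gluing the two halves yields an
approximate inverse, so `T_N` is eventually invertible with a polynomially bounded inverse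
(`WienerHopf.eventually_isUnit_det_toep`), and approximate solutions are close to exact ones.

Consequently entries that couple opposite ends are negligible, while entries at one end tend to the
explicit sums `edgePH`, `edgePK`, `edgeTH`, `edgeTK`. The small determinant splits into one factor
per end (`WienerHopf.det_ratio_asymptotics`).

These factors are then identified with the determinants of the matrices `matN`. Expanding the kernel
`1/(z x - s)` in a geometric series turns the regularised double integrals into the same sums
(`shiftLim_sub`, `shiftLim_add`), and an overlap `c` amounts to row and column operations of
determinant one (`overlapMatrix`). Maximal rank makes both limits nonzero, so the additive error
becomes a relative one. -/

noncomputable section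

namespace LacunaryToeplitz

/-! ### Determinants under replacement of rows and columns, and signed exchanges of columns -/

section LinearAlgebra

set_option linter.unusedSectionVars false

open Matrix

/-- The selection matrix of `h`: column `a` is the basis vector with index `h a`. -/
def selMatrix {κ ι : Type*} [DecidableEq κ] (h : ι → κ) : Matrix κ ι ℂ :=
  Matrix.of fun i a => if i = h a then 1 else 0

section

variable {ν ι κ : Type*} [Fintype ν] [DecidableEq ν] [Fintype ι] [DecidableEq ι]
  [Fintype κ] [DecidableEq κ]

lemma mul_selMatrix {o : Type*} (h : ι → ν) (A : Matrix o ν ℂ) (i : o) (a : ι) :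
    (A * selMatrix h) i a = A i (h a) := by
  simp [Matrix.mul_apply, selMatrix]

lemma selMatrix_transpose_mul {o : Type*} (h : ι → ν) (A : Matrix ν o ℂ) (a : ι) (j : o) :
    ((selMatrix h)ᵀ * A) a j = A (h a) j := by
  simp [Matrix.mul_apply, selMatrix]

lemma selMatrix_transpose_mul_self {h : ι → ν} (hh : Function.Injective h) :
    (selMatrix h)ᵀ * selMatrix h = 1 := by
  ext a b
  rw [selMatrix_transpose_mul]
  simp [selMatrix, Matrix.one_apply, hh.eq_iff]

lemma selMatrix_mul_apply {o : Type*} {h : ι → ν} (hh : Function.Injective h)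
    (A : Matrix ι o ℂ) (a : ι) (j : o) : (selMatrix h * A) (h a) j = A a j := by
  simp [Matrix.mul_apply, selMatrix, hh.eq_iff]

lemma selMatrix_mul_apply_of_notMem {o : Type*} {h : ι → ν}
    (A : Matrix ι o ℂ) {i : ν} (hi : i ∉ Set.range h) (j : o) : (selMatrix h * A) i j = 0 := by
  rw [Matrix.mul_apply]
  refine Finset.sum_eq_zero fun a _ => ?_
  have : i ≠ h a := fun e => hi ⟨a, e.symm⟩
  simp [selMatrix, this]

lemma mul_selMatrix_transpose_apply {o : Type*} {h : ι → ν} (hh : Function.Injective h)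
    (A : Matrix o ι ℂ) (i : o) (b : ι) : (A * (selMatrix h)ᵀ) i (h b) = A i b := by
  simp [Matrix.mul_apply, selMatrix, hh.eq_iff]

lemma mul_selMatrix_transpose_apply_of_notMem {o : Type*} {h : ι → ν}
    (A : Matrix o ι ℂ) (i : o) {j : ν} (hj : j ∉ Set.range h) : (A * (selMatrix h)ᵀ) i j = 0 := by
  rw [Matrix.mul_apply]
  refine Finset.sum_eq_zero fun a _ => ?_
  have : j ≠ h a := fun e => hj ⟨a, e.symm⟩
  simp [selMatrix, this]

/-- The matrix of size `|ι| + |κ|` whose determinant is the ratio of the determinant of `T` with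
the rows `h` and columns `t` replaced to that of `T`. -/
def borderMatrix (T : Matrix ν ν ℂ) (h : ι → ν) (t : κ → ν) (C : Matrix ι ν ℂ) (B : Matrix ν κ ℂ)
    (D : Matrix ι κ ℂ) : Matrix (ι ⊕ κ) (ι ⊕ κ) ℂ :=
  Matrix.fromBlocks (C * T⁻¹ * selMatrix h) (D - C * T⁻¹ * B)
    (-((selMatrix t)ᵀ * T⁻¹ * selMatrix h)) ((selMatrix t)ᵀ * T⁻¹ * B)

lemma det_fromBlocks_neg_off (A : Matrix ι ι ℂ) (B : Matrix ι κ ℂ) (C : Matrix κ ι ℂ)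
    (D : Matrix κ κ ℂ) :
    (Matrix.fromBlocks A (-B) (-C) D).det = (Matrix.fromBlocks A B C D).det := by
  have h : Matrix.fromBlocks A (-B) (-C) D = Matrix.fromBlocks 1 0 0 (-1) *
      Matrix.fromBlocks A B C D * Matrix.fromBlocks 1 0 0 (-1) := by
    simp [Matrix.fromBlocks_multiply]
  rw [h, Matrix.det_mul, Matrix.det_mul, mul_right_comm, ← Matrix.det_mul,
    Matrix.fromBlocks_multiply]
  simp

/-- `M - T` factors through a space of dimension `|ι| + |κ|`, so the matrix determinant lemma
reduces `det M / det T` to a determinant of that size. Up to a unipotent factor and signs of the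
off-diagonal blocks, this is the bordered matrix. The entries of `C` in the columns `t` and of `B`
in the rows `h` are unconstrained: the determinant does not depend on them. -/
theorem det_replace_rows_cols (T M : Matrix ν ν ℂ) (hT : IsUnit T.det) {h : ι → ν} {t : κ → ν}
    (hh : Function.Injective h) (ht : Function.Injective t)
    (C : Matrix ι ν ℂ) (B : Matrix ν κ ℂ) (D : Matrix ι κ ℂ)
    (h1 : ∀ a b, M (h a) (t b) = D a b)
    (h2 : ∀ a, ∀ j ∉ Set.range t, M (h a) j = C a j)
    (h3 : ∀ i ∉ Set.range h, ∀ b, M i (t b) = B i b)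
    (h4 : ∀ i ∉ Set.range h, ∀ j ∉ Set.range t, M i j = T i j) :
    M.det = T.det * (borderMatrix T h t C B D).det := by
  set E := selMatrix h with hE
  set F := selMatrix t with hF
  have hEE : Eᵀ * E = 1 := selMatrix_transpose_mul_self hh
  have hFF : Fᵀ * F = 1 := selMatrix_transpose_mul_self ht
  -- `A1` is `T` with the columns `t` replaced by those of `B`; `A2` holds the new rows, with the
  -- entries of `D` in the columns `t`.
  set A1 : Matrix ν ν ℂ := T + (B - T * F) * Fᵀ with hA1
  set A2 : Matrix ι ν ℂ := C + (D - C * F) * Fᵀ with hA2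
  have hA1t : ∀ i b, A1 i (t b) = B i b := fun i b => by
    rw [hA1, Matrix.add_apply, mul_selMatrix_transpose_apply ht, Matrix.sub_apply,
      mul_selMatrix]; ring
  have hA1n : ∀ i, ∀ j ∉ Set.range t, A1 i j = T i j := fun i j hj => by
    rw [hA1, Matrix.add_apply, mul_selMatrix_transpose_apply_of_notMem _ _ hj, add_zero]
  have hA2t : ∀ i b, A2 i (t b) = D i b := fun i b => by
    rw [hA2, Matrix.add_apply, mul_selMatrix_transpose_apply ht, Matrix.sub_apply,
      mul_selMatrix]; ring
  have hA2n : ∀ i, ∀ j ∉ Set.range t, A2 i j = C i j := fun i j hj => by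
    rw [hA2, Matrix.add_apply, mul_selMatrix_transpose_apply_of_notMem _ _ hj, add_zero]
  have hM : M = A1 + E * (A2 - Eᵀ * A1) := by
    ext i j
    rw [Matrix.add_apply]
    by_cases hi : i ∈ Set.range h
    · obtain ⟨a, rfl⟩ := hi
      rw [selMatrix_mul_apply hh, Matrix.sub_apply, selMatrix_transpose_mul]
      by_cases hj : j ∈ Set.range t
      · obtain ⟨b, rfl⟩ := hj
        rw [h1, hA2t]; ring
      · rw [h2 _ _ hj, hA2n _ _ hj]; ring
    · rw [selMatrix_mul_apply_of_notMem _ hi, add_zero]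
      by_cases hj : j ∈ Set.range t
      · obtain ⟨b, rfl⟩ := hj
        rw [h3 _ hi, hA1t]
      · rw [h4 _ hi _ hj, hA1n _ _ hj]
  have hM2 : M = T + Matrix.fromCols E (B - T * F) * Matrix.fromRows (A2 - Eᵀ * A1) Fᵀ := by
    rw [Matrix.fromCols_mul_fromRows, hM, hA1]; abel
  have hTi : T * T⁻¹ = 1 := Matrix.mul_nonsing_inv T hT
  have hTi' : T⁻¹ * T = 1 := Matrix.nonsing_inv_mul T hT
  rw [hM2, Matrix.det_add_mul _ _ hT]
  congr 1
  set G := Eᵀ * (B - T * F) with hG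
  set R := (D - C * F) - G with hR
  have hZ : A1 * T⁻¹ = 1 + (B - T * F) * (Fᵀ * T⁻¹) := by
    rw [hA1, Matrix.add_mul, hTi, Matrix.mul_assoc]
  have hZ2 : A2 * T⁻¹ = C * T⁻¹ + (D - C * F) * (Fᵀ * T⁻¹) := by
    rw [hA2, Matrix.add_mul, Matrix.mul_assoc]
  have hV : (A2 - Eᵀ * A1) * T⁻¹ = C * T⁻¹ - Eᵀ + R * (Fᵀ * T⁻¹) := by
    rw [Matrix.sub_mul, hZ2, Matrix.mul_assoc, hZ, hR, Matrix.sub_mul (D - C * F) G, Matrix.mul_add,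
      Matrix.mul_one, hG, ← Matrix.mul_assoc Eᵀ]
    abel
  have hW : Fᵀ * T⁻¹ * (B - T * F) = Fᵀ * T⁻¹ * B - 1 := by
    rw [Matrix.mul_sub, ← Matrix.mul_assoc, Matrix.mul_assoc Fᵀ T⁻¹ T, hTi', Matrix.mul_one, hFF]
  have hX : C * T⁻¹ * (B - T * F) = C * T⁻¹ * B - C * F := by
    rw [Matrix.mul_sub, ← Matrix.mul_assoc, Matrix.mul_assoc C T⁻¹ T, hTi', Matrix.mul_one]
  -- The unipotent left factor absorbs the correction `R`, which collects all dependence on the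
  -- overlap of replaced rows and columns.
  have key : 1 + Matrix.fromRows (A2 - Eᵀ * A1) Fᵀ * T⁻¹ * Matrix.fromCols E (B - T * F) =
      Matrix.fromBlocks 1 R 0 1 * Matrix.fromBlocks (C * T⁻¹ * E) (-(D - C * T⁻¹ * B))
        (Fᵀ * T⁻¹ * E) (Fᵀ * T⁻¹ * B) := by
    rw [Matrix.fromRows_mul, Matrix.fromRows_mul_fromCols, Matrix.fromBlocks_multiply,
      ← Matrix.fromBlocks_one, Matrix.fromBlocks_add, hV]
    congr 1
    · rw [Matrix.add_mul, Matrix.sub_mul, hEE, Matrix.one_mul, Matrix.mul_assoc R]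
      abel
    · rw [Matrix.add_mul, Matrix.sub_mul, hX, Matrix.mul_assoc R, hW, ← hG, Matrix.mul_sub,
        Matrix.mul_one, Matrix.one_mul, hR]
      abel
    · simp
    · rw [hW]; simp
  rw [key, Matrix.det_mul, Matrix.det_fromBlocks_zero₂₁, Matrix.det_one, Matrix.det_one, one_mul,
    one_mul, borderMatrix, ← det_fromBlocks_neg_off, neg_neg]

end

/-- The partial identity of rank `c`. -/
def partialId (n r c : ℕ) : Matrix (Fin n) (Fin r) ℂ :=
  Matrix.of fun a b => if (a : ℕ) = b ∧ (a : ℕ) < c then 1 else 0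

lemma partialId_transpose (n r c : ℕ) : (partialId n r c)ᵀ = partialId r n c := by
  ext a b
  simp only [partialId, Matrix.transpose_apply, Matrix.of_apply]
  congr 1
  grind

lemma partialId_mul_apply {n r c : ℕ} (hr : c ≤ r) {o : Type*}
    (A : Matrix (Fin r) o ℂ) (a : Fin n) (j : o) :
    (partialId n r c * A) a j = if h : (a : ℕ) < c then A ⟨a, h.trans_le hr⟩ j else 0 := by
  rw [Matrix.mul_apply]
  split_ifs with h
  · rw [Finset.sum_eq_single (⟨a, h.trans_le hr⟩ : Fin r)]
    · simp [partialId, h]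
    · intro b _ hb
      have : (a : ℕ) ≠ b := fun e => hb (Fin.ext e.symm)
      simp [partialId, this]
    · simp
  · simp [partialId, h]

lemma mul_partialId_apply {n r c : ℕ} (hn : c ≤ n) {o : Type*}
    (A : Matrix o (Fin n) ℂ) (i : o) (b : Fin r) :
    (A * partialId n r c) i b = if h : (b : ℕ) < c then A i ⟨b, h.trans_le hn⟩ else 0 := by
  rw [← Matrix.transpose_apply (A * _), Matrix.transpose_mul, partialId_transpose,
    partialId_mul_apply hn]
  rfl

/-- The signed exchange of the first `c` indices of the two blocks. -/
def signedSwap (n r c : ℕ) : Matrix (Fin n ⊕ Fin r) (Fin n ⊕ Fin r) ℂ :=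
  Matrix.fromBlocks (1 - partialId n r c * partialId r n c) (-partialId n r c)
    (partialId r n c) (1 - partialId r n c * partialId n r c)

/-- As for a plane rotation by a right angle, the signed exchange is a product of three shears.
Writing `P` for the partial identity, the factorisation rests on `P * Pᵀ * P = P`. -/
lemma det_signedSwap {n r c : ℕ} (hn : c ≤ n) (hr : c ≤ r) : (signedSwap n r c).det = 1 := by
  have h0 : partialId n r c * partialId r n c * partialId n r c = partialId n r c := by
    ext a b
    rw [Matrix.mul_assoc, partialId_mul_apply hr]
    split_ifs with h
    · rw [partialId_mul_apply hn]
      simp [h]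
    · simp [partialId, h]
  have h : signedSwap n r c = Matrix.fromBlocks 1 (-partialId n r c) 0 1 *
      Matrix.fromBlocks 1 0 (partialId r n c) 1 * Matrix.fromBlocks 1 (-partialId n r c) 0 1 := by
    simp only [Matrix.fromBlocks_multiply, signedSwap]
    congr 1
    · simp [sub_eq_add_neg]
    · simp only [Matrix.mul_neg, Matrix.neg_mul, Matrix.add_mul, h0]
      simp
    · simp
    · simp [sub_eq_neg_add]
  rw [h, Matrix.det_mul, Matrix.det_mul, Matrix.det_fromBlocks_zero₂₁,
    Matrix.det_fromBlocks_zero₁₂]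
  simp

end LinearAlgebra

/-! ### Exponentially small sequences -/

/-- `u` is bounded above by a polynomial times `ρ ^ N`. -/
def ExpSmall (ρ : ℝ) (u : ℕ → ℝ) : Prop :=
  ∃ (K : ℝ) (m : ℕ), 0 ≤ K ∧ ∀ᶠ N : ℕ in atTop, u N ≤ K * (N : ℝ) ^ m * ρ ^ N

lemma ExpSmall.mono {ρ : ℝ} {u v : ℕ → ℝ} (hv : ExpSmall ρ v) (h : ∀ᶠ N in atTop, u N ≤ v N) :
    ExpSmall ρ u := by
  obtain ⟨K, m, hK, hv⟩ := hv
  refine ⟨K, m, hK, ?_⟩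
  filter_upwards [hv, h] with N h1 h2 using h2.trans h1

lemma ExpSmall.add {ρ : ℝ} (hρ : 0 < ρ) {u v : ℕ → ℝ} (hu : ExpSmall ρ u) (hv : ExpSmall ρ v) :
    ExpSmall ρ (fun N => u N + v N) := by
  obtain ⟨K, m, hK, hu⟩ := hu
  obtain ⟨L, n, hL, hv⟩ := hv
  refine ⟨K + L, m + n, by positivity, ?_⟩
  filter_upwards [hu, hv, eventually_ge_atTop 1] with N h1 h2 h3
  have hN : (1 : ℝ) ≤ N := by exact_mod_cast h3
  have e1 : (N : ℝ) ^ m ≤ (N : ℝ) ^ (m + n) := pow_le_pow_right₀ hN (by omega)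
  have e2 : (N : ℝ) ^ n ≤ (N : ℝ) ^ (m + n) := pow_le_pow_right₀ hN (by omega)
  calc u N + v N ≤ K * (N : ℝ) ^ m * ρ ^ N + L * (N : ℝ) ^ n * ρ ^ N := add_le_add h1 h2
    _ ≤ K * (N : ℝ) ^ (m + n) * ρ ^ N + L * (N : ℝ) ^ (m + n) * ρ ^ N := by gcongr
    _ = _ := by ring

lemma ExpSmall.mul_pow {ρ : ℝ} {u : ℕ → ℝ} (hu : ExpSmall ρ u) {c : ℝ} (hc : 0 ≤ c) (n : ℕ) :
    ExpSmall ρ (fun N => c * (N : ℝ) ^ n * u N) := by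
  obtain ⟨K, m, hK, hu⟩ := hu
  refine ⟨c * K, n + m, by positivity, ?_⟩
  filter_upwards [hu] with N h1
  calc c * (N : ℝ) ^ n * u N ≤ c * (N : ℝ) ^ n * (K * (N : ℝ) ^ m * ρ ^ N) := by gcongr
    _ = _ := by ring

lemma expSmall_pow {ρ : ℝ} (hρ : 0 < ρ) (hρ1 : ρ < 1) (s : ℕ) {κ : ℕ → ℕ}
    (hκ : ∀ᶠ N in atTop, N ≤ κ N + s) : ExpSmall ρ (fun N => ρ ^ κ N) := by
  refine ⟨(ρ ^ s)⁻¹, 0, by positivity, ?_⟩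
  filter_upwards [hκ] with N h
  have : ρ ^ (κ N + s) ≤ ρ ^ N := pow_le_pow_of_le_one hρ.le hρ1.le h
  rw [pow_add] at this
  rw [pow_zero, mul_one, inv_mul_eq_div, le_div_iff₀ (by positivity)]
  exact this

lemma IsBigONegInfty.of_expSmall {ρ : ℝ} (hρ : 0 < ρ) (hρ1 : ρ < 1) {u : ℕ → ℂ} {δ : ℕ → ℝ}
    (hδ : ExpSmall ρ δ) (h : ∀ᶠ N in atTop, ‖u N‖ ≤ δ N) : IsBigONegInfty u := by
  obtain ⟨K, m, hK, hδ⟩ := hδ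
  intro k
  -- The exponent `m + k` absorbs both the polynomial prefactor and the required rate `N ^ (-k)`.
  have ht := tendsto_pow_const_mul_const_pow_of_abs_lt_one (m + k) (r := ρ)
    (by rwa [abs_of_pos hρ])
  refine Asymptotics.IsBigO.of_bound K ?_
  filter_upwards [hδ, h, ht.eventually_le_const one_pos, eventually_ge_atTop 1] with N h1 h2 h3 h4
  have hN : (0 : ℝ) < N := by exact_mod_cast h4
  rw [Real.norm_of_nonneg (by positivity), ← div_eq_mul_inv, le_div_iff₀ (by positivity)]
  calc ‖u N‖ * (N : ℝ) ^ k ≤ (K * (N : ℝ) ^ m * ρ ^ N) * (N : ℝ) ^ k := by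
        gcongr; exact h2.trans h1
    _ = K * ((N : ℝ) ^ (m + k) * ρ ^ N) := by ring
    _ ≤ K * 1 := by gcongr
    _ = K := mul_one K

/-! ### Inverting a matrix from an approximate right inverse -/

section ApproxInverse

open Matrix

variable {N : ℕ} (T S E : Matrix (Fin N) (Fin N) ℂ)

lemma norm_mulVec_le {s : ℝ} (hs : 0 ≤ s) (hS : ∀ i j, ‖S i j‖ ≤ s) (w : Fin N → ℂ) :
    ‖S *ᵥ w‖ ≤ N * s * ‖w‖ := by
  rw [pi_norm_le_iff_of_nonneg (by positivity)]
  intro i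
  calc ‖(S *ᵥ w) i‖ ≤ ∑ j, ‖S i j * w j‖ := by
        simpa only [Matrix.mulVec, dotProduct] using norm_sum_le Finset.univ fun j => S i j * w j
    _ ≤ ∑ _j : Fin N, s * ‖w‖ := by
        gcongr with j
        rw [norm_mul]
        exact mul_le_mul (hS i j) (norm_le_pi_norm w j) (norm_nonneg _) hs
    _ = N * s * ‖w‖ := by simp [mul_assoc]

lemma norm_le_two_mul_norm_one_add_mulVec {ε : ℝ} (hε : 0 ≤ ε) (hE : ∀ i j, ‖E i j‖ ≤ ε)
    (hN : N * ε ≤ 1 / 2) (w : Fin N → ℂ) : ‖w‖ ≤ 2 * ‖(1 + E) *ᵥ w‖ := by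
  have h1 : w = (1 + E) *ᵥ w - E *ᵥ w := by simp [Matrix.add_mulVec]
  have h2 := norm_sub_le ((1 + E) *ᵥ w) (E *ᵥ w)
  rw [← h1] at h2
  have h3 := norm_mulVec_le E hε hE w
  have h4 : N * ε * ‖w‖ ≤ 1 / 2 * ‖w‖ := by gcongr
  linarith

/-- In the sup norm `E` has operator norm at most `N * ε ≤ 1/2`, so `1 + E` is invertible with
inverse of norm at most `2`. Hence `T` is invertible, and `T⁻¹ = S (1 + E)⁻¹` inherits the bound on
`S`. -/
lemma approx_inverse {ε s : ℝ} (hε : 0 ≤ ε) (hs : 0 ≤ s) (hE : ∀ i j, ‖E i j‖ ≤ ε)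
    (hN : N * ε ≤ 1 / 2) (hS : ∀ i j, ‖S i j‖ ≤ s) (hTS : T * S = 1 + E) :
    IsUnit T.det ∧ ∀ e : Fin N → ℂ, ‖T⁻¹ *ᵥ e‖ ≤ 2 * N * s * ‖e‖ := by
  have hinj : Function.Injective (1 + E).mulVec := by
    intro x y hxy
    have h := norm_le_two_mul_norm_one_add_mulVec E hε hE hN (x - y)
    have h0 : (1 + E) *ᵥ (x - y) = 0 := by
      rw [Matrix.mulVec_sub, sub_eq_zero]; exact hxy
    rw [h0, norm_zero, mul_zero] at h
    exact sub_eq_zero.1 (norm_le_zero_iff.1 h)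
  have hu : IsUnit (1 + E).det :=
    (Matrix.isUnit_iff_isUnit_det _).1 (Matrix.mulVec_injective_iff_isUnit.1 hinj)
  have hT : IsUnit T.det := by
    rw [← hTS, Matrix.det_mul] at hu
    exact isUnit_of_mul_isUnit_left hu
  refine ⟨hT, fun e => ?_⟩
  set w := (1 + E)⁻¹ *ᵥ e with hw
  have h1 : (1 + E) *ᵥ w = e := by
    rw [hw, Matrix.mulVec_mulVec, Matrix.mul_nonsing_inv _ hu, Matrix.one_mulVec]
  have h2 : T⁻¹ *ᵥ e = S *ᵥ w := by
    rw [← h1, ← hTS, Matrix.mulVec_mulVec, ← Matrix.mul_assoc, Matrix.nonsing_inv_mul _ hT,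
      Matrix.one_mul]
  rw [h2]
  calc ‖S *ᵥ w‖ ≤ N * s * ‖w‖ := norm_mulVec_le S hs hS w
    _ ≤ N * s * (2 * ‖(1 + E) *ᵥ w‖) := by
        gcongr; exact norm_le_two_mul_norm_one_add_mulVec E hε hE hN w
    _ = _ := by rw [h1]; ring

end ApproxInverse

/-! ### Wiener-Hopf factorisations of sequences -/

lemma sum_fin_eq_sum_Ico (N : ℕ) (g : ℤ → ℂ) :
    ∑ i : Fin N, g (i : ℕ) = ∑ k ∈ Finset.Ico (0 : ℤ) N, g k := by
  rw [Fin.sum_univ_eq_sum_range (fun i => g (i : ℤ))]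
  refine Finset.sum_bij (fun i _ => (i : ℤ)) ?_ ?_ ?_ ?_
  · intro i hi; simp only [Finset.mem_range] at hi; simp; omega
  · intro i _ j _ h; exact_mod_cast h
  · intro k hk
    simp only [Finset.mem_Ico] at hk
    exact ⟨k.toNat, by simp only [Finset.mem_range]; omega, by simp; omega⟩
  · intro i _; rfl

lemma sum_Ico_reflect (N : ℕ) (g : ℤ → ℂ) :
    ∑ k ∈ Finset.Ico (0 : ℤ) N, g (N - 1 - k) = ∑ k ∈ Finset.Ico (0 : ℤ) N, g k := by
  refine Finset.sum_bij (fun k _ => (N : ℤ) - 1 - k) ?_ ?_ ?_ ?_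
  · intro k hk; simp only [Finset.mem_Ico] at hk ⊢; omega
  · intro i _ j _ h; linarith
  · intro k hk
    simp only [Finset.mem_Ico] at hk
    exact ⟨N - 1 - k, by simp only [Finset.mem_Ico]; omega, by ring⟩
  · intro i _; rfl

/-- The sequence `f` is the convolution of the one-sided sequences `a` and `b`, whose convolution
inverses are `a'` and `b'`; all of them decay exponentially. -/
structure WienerHopf (ρ C : ℝ) (a a' b b' f : ℤ → ℂ) : Prop where
  pos : 0 < ρ
  lt_one : ρ < 1
  one_le : 1 ≤ C
  a_neg : ∀ n < 0, a n = 0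
  a'_neg : ∀ n < 0, a' n = 0
  b_pos : ∀ n > 0, b n = 0
  b'_pos : ∀ n > 0, b' n = 0
  a_le : ∀ n : ℤ, ‖a n‖ ≤ C * ρ ^ n.natAbs
  a'_le : ∀ n : ℤ, ‖a' n‖ ≤ C * ρ ^ n.natAbs
  b_le : ∀ n : ℤ, ‖b n‖ ≤ C * ρ ^ n.natAbs
  b'_le : ∀ n : ℤ, ‖b' n‖ ≤ C * ρ ^ n.natAbs
  f_le : ∀ n : ℤ, ‖f n‖ ≤ C * ρ ^ n.natAbs
  conv_a : ∀ i j : ℤ, HasSum (fun k : ℤ => a (i - k) * a' (k - j)) (if i = j then 1 else 0)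
  conv_b : ∀ i j : ℤ, HasSum (fun k : ℤ => b (i - k) * b' (k - j)) (if i = j then 1 else 0)
  conv_f : ∀ i j : ℤ, HasSum (fun k : ℤ => a (i - k) * b (k - j)) (f (i - j))

namespace WienerHopf

variable {ρ C : ℝ} {a a' b b' f : ℤ → ℂ}

/-- The substitution `z ↦ 1/z` exchanges the two factors. Every statement about the right end of the
Toeplitz matrix thereby yields one about the left end. -/
lemma reflect (W : WienerHopf ρ C a a' b b' f) :
    WienerHopf ρ C (fun n => b (-n)) (fun n => b' (-n)) (fun n => a (-n)) (fun n => a' (-n))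
      (fun n => f (-n)) where
  pos := W.pos
  lt_one := W.lt_one
  one_le := W.one_le
  a_neg n hn := W.b_pos _ (by omega)
  a'_neg n hn := W.b'_pos _ (by omega)
  b_pos n hn := W.a_neg _ (by omega)
  b'_pos n hn := W.a'_neg _ (by omega)
  a_le n := by simpa using W.b_le (-n)
  a'_le n := by simpa using W.b'_le (-n)
  b_le n := by simpa using W.a_le (-n)
  b'_le n := by simpa using W.a'_le (-n)
  f_le n := by simpa using W.f_le (-n)
  conv_a i j := by
    have h := (Equiv.subLeft (i + j)).hasSum_iff.2 (W.conv_b j i)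
    convert! h using 1
    · funext k; simp only [Function.comp, Equiv.subLeft_apply]; congr 2 <;> ring
    · simp only [eq_comm]
  conv_b i j := by
    have h := (Equiv.subLeft (i + j)).hasSum_iff.2 (W.conv_a j i)
    convert! h using 1
    · funext k; simp only [Function.comp, Equiv.subLeft_apply]; congr 2 <;> ring
    · simp only [eq_comm]
  conv_f i j := by
    have h := W.conv_f j i
    convert! h using 1
    · funext k; rw [mul_comm]; congr 2 <;> ring
    · congr 1; ring

variable (W : WienerHopf ρ C a a' b b' f)
include W

/-- A nonzero term needs `i ≤ k ≤ j`, so truncation to `[0, N)` loses nothing: inverses of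
triangular Toeplitz matrices truncate exactly. -/
lemma sum_conv_b {i j : ℤ} {N : ℕ} (hi : 0 ≤ i) (hj : j < N) :
    ∑ k ∈ Finset.Ico (0 : ℤ) N, b (i - k) * b' (k - j) = if i = j then 1 else 0 := by
  refine (hasSum_sum_of_ne_finset_zero fun k hk => ?_).unique (W.conv_b i j)
  simp only [Finset.mem_Ico, not_and_or, not_le, not_lt] at hk
  rcases hk with hk | hk
  · rw [W.b_pos _ (by omega), zero_mul]
  · rw [W.b'_pos _ (by omega), mul_zero]

lemma sum_conv_a {i j : ℤ} {N : ℕ} (hi : i < N) (hj : 0 ≤ j) :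
    ∑ k ∈ Finset.Ico (0 : ℤ) N, a (i - k) * a' (k - j) = if i = j then 1 else 0 := by
  refine (hasSum_sum_of_ne_finset_zero fun k hk => ?_).unique (W.conv_a i j)
  simp only [Finset.mem_Ico, not_and_or, not_le, not_lt] at hk
  rcases hk with hk | hk
  · rw [W.a'_neg _ (by omega), mul_zero]
  · rw [W.a_neg _ (by omega), zero_mul]

/-- Terms with `k ≥ M` vanish by one-sidedness of `a` or `b`. Only `k < 0` is lost, where the two
factors together decay like `ρ ^ (i + j - 2k)`; the error is thus concentrated in the corner at `(0,
0)`. -/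
lemma norm_conv_f_sub_le {i j : ℤ} {M : ℕ} (hi : 0 ≤ i) (hj : 0 ≤ j) (hM : i < M ∨ j < M) :
    ‖f (i - j) - ∑ k ∈ Finset.Ico (0 : ℤ) M, a (i - k) * b (k - j)‖ ≤
      C ^ 2 / (1 - ρ) * ρ ^ (i + j).toNat := by
  have hρ := W.pos
  have hC : 0 ≤ C := zero_le_one.trans W.one_le
  set g : ℤ → ℂ := fun k => a (i - k) * b (k - j) with hg
  set φ : ℕ → ℤ := fun m => -1 - m with hφ
  have hφi : Function.Injective φ := fun x y h => by simp only [hφ] at h; omega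
  have h1 : HasSum (fun k => g k - if k ∈ Finset.Ico (0 : ℤ) M then g k else 0)
      (f (i - j) - ∑ k ∈ Finset.Ico (0 : ℤ) M, g k) := by
    refine (W.conv_f i j).sub ?_
    have := hasSum_sum_of_ne_finset_zero (L := SummationFilter.unconditional ℤ)
      (f := fun k => if k ∈ Finset.Ico (0 : ℤ) M then g k else 0)
      (s := Finset.Ico (0 : ℤ) M) (fun k hk => if_neg hk)
    rwa [Finset.sum_congr rfl fun k hk => if_pos hk] at this
  rw [← hφi.hasSum_iff] at h1
  swap
  · intro k hk
    by_cases hk0 : k < 0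
    · exact absurd ⟨(-1 - k).toNat, by simp only [hφ]; omega⟩ hk
    · split_ifs with hm
      · ring
      · simp only [Finset.mem_Ico, not_and_or, not_le, not_lt] at hm
        have hkM : (M : ℤ) ≤ k := by omega
        simp only [hg, sub_zero]
        rcases hM with hM | hM
        · rw [W.a_neg _ (by omega), zero_mul]
        · rw [W.b_pos _ (by omega), mul_zero]
  have h2 : HasSum (fun m : ℕ => C ^ 2 * ρ ^ (i + j).toNat * ρ ^ m)
      (C ^ 2 * ρ ^ (i + j).toNat * (1 - ρ)⁻¹) :=
    (hasSum_geometric_of_lt_one hρ.le W.lt_one).mul_left _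
  refine (h1.norm_le_of_bounded h2 fun m => ?_).trans_eq (by ring)
  have hm : φ m ∉ Finset.Ico (0 : ℤ) M := by simp [hφ]; omega
  simp only [Function.comp, if_neg hm, sub_zero, hg, norm_mul]
  calc ‖a (i - φ m)‖ * ‖b (φ m - j)‖
      ≤ (C * ρ ^ (i - φ m).natAbs) * (C * ρ ^ (φ m - j).natAbs) :=
        mul_le_mul (W.a_le _) (W.b_le _) (norm_nonneg _) (by positivity)
    _ = C ^ 2 * ρ ^ ((i - φ m).natAbs + (φ m - j).natAbs) := by rw [pow_add]; ring
    _ ≤ C ^ 2 * ρ ^ ((i + j).toNat + m) := by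
        gcongr ?_ * ?_
        exact pow_le_pow_of_le_one hρ.le W.lt_one.le (by simp only [hφ]; omega)
    _ = _ := by rw [pow_add]; ring

/-- The bound for the entries of an approximate solution. -/
lemma norm_sum_b'_le {N : ℕ} {w : ℤ → ℂ} {D : ℝ} (hD : 0 ≤ D) {κ : ℤ}
    (hw : ∀ k, ‖w k‖ ≤ D * ρ ^ (k - κ).natAbs) (j : ℤ) :
    ‖∑ k ∈ Finset.Ico (0 : ℤ) N, b' (j - k) * w k‖ ≤ N * (C * D) * ρ ^ (j - κ).natAbs := by
  have hρ := W.pos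
  have hC : 0 ≤ C := zero_le_one.trans W.one_le
  refine (norm_sum_le_of_le (n := fun _ => C * D * ρ ^ (j - κ).natAbs) _ fun k _ => ?_).trans_eq ?_
  · rw [norm_mul]
    calc ‖b' (j - k)‖ * ‖w k‖ ≤ (C * ρ ^ (j - k).natAbs) * (D * ρ ^ (k - κ).natAbs) :=
          mul_le_mul (W.b'_le _) (hw k) (norm_nonneg _) (by positivity)
      _ = C * D * ρ ^ ((j - k).natAbs + (k - κ).natAbs) := by rw [pow_add]; ring
      _ ≤ _ := by
          gcongr ?_ * ?_
          exact pow_le_pow_of_le_one hρ.le W.lt_one.le (by omega)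
  · simp; ring

/-- With `y = b' * w` truncated, the triangular system `b * y = w` holds exactly. Replacing `f` by
the truncated product of `a` and `b` costs only the corner error near index `0`, where `y`, centred
at `κ`, is of order `ρ ^ κ`. There is no upper bound on `i`, so new rows beyond the right end are
covered too. -/
lemma norm_sum_f_mul_sub_le {N : ℕ} {w : ℤ → ℂ} {D : ℝ} (hD : 0 ≤ D) {κ : ℕ}
    (hw : ∀ k, ‖w k‖ ≤ D * ρ ^ (k - κ).natAbs) {i : ℤ} (hi : 0 ≤ i) :
    ‖∑ j ∈ Finset.Ico (0 : ℤ) N, f (i - j) * (∑ k ∈ Finset.Ico (0 : ℤ) N, b' (j - k) * w k) -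
      ∑ k ∈ Finset.Ico (0 : ℤ) N, a (i - k) * w k‖ ≤
      C ^ 2 / (1 - ρ) * (C * D) * (N : ℝ) ^ 2 * ρ ^ κ := by
  have hρ := W.pos
  have hρ1 := W.lt_one
  have hC : 0 ≤ C := zero_le_one.trans W.one_le
  set I := Finset.Ico (0 : ℤ) N with hI
  set y : ℤ → ℂ := fun j => ∑ k ∈ I, b' (j - k) * w k with hy
  have e1 : ∀ k ∈ I, ∑ j ∈ I, b (k - j) * y j = w k := by
    intro k hk
    simp only [hy, Finset.mul_sum]
    rw [Finset.sum_comm]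
    calc ∑ l ∈ I, ∑ j ∈ I, b (k - j) * (b' (j - l) * w l)
        = ∑ l ∈ I, (if k = l then 1 else 0) * w l := by
          refine Finset.sum_congr rfl fun l hl => ?_
          rw [hI, Finset.mem_Ico] at hk hl
          rw [← W.sum_conv_b hk.1 hl.2, Finset.sum_mul]
          simp only [mul_assoc, hI]
      _ = w k := by simp [hk]
  have e2 : ∑ k ∈ I, a (i - k) * w k = ∑ j ∈ I, (∑ k ∈ I, a (i - k) * b (k - j)) * y j := by
    simp only [Finset.sum_mul]
    rw [Finset.sum_comm]
    refine Finset.sum_congr rfl fun k hk => ?_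
    rw [← e1 k hk, Finset.mul_sum]
    simp only [mul_assoc]
  rw [e2, ← Finset.sum_sub_distrib]
  refine (norm_sum_le_of_le (n := fun _ => C ^ 2 / (1 - ρ) * (C * D) * N * ρ ^ κ) _
    fun j hj => ?_).trans_eq ?_
  · rw [hI, Finset.mem_Ico] at hj
    rw [← sub_mul, norm_mul]
    have h1ρ : 0 < 1 - ρ := by linarith
    calc _ ≤ (C ^ 2 / (1 - ρ) * ρ ^ (i + j).toNat) * (N * (C * D) * ρ ^ (j - κ).natAbs) :=
          mul_le_mul (W.norm_conv_f_sub_le hi hj.1 (Or.inr hj.2)) (W.norm_sum_b'_le hD hw j)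
            (norm_nonneg _) (by positivity)
      _ = C ^ 2 / (1 - ρ) * (C * D) * N * ρ ^ ((i + j).toNat + (j - κ).natAbs) := by
          rw [pow_add]; ring
      _ ≤ _ := by
          gcongr ?_ * ?_
          -- For `i, j ≥ 0` the triangle inequality gives `κ ≤ (i + j) + |j - κ|`.
          exact pow_le_pow_of_le_one hρ.le hρ1.le (by omega)
  · simp [hI]; ring

/-- A row with `i ≤ 0` sees a vector centred at `κ` only through `|i - j| + |j - κ| ≥ κ`. -/
lemma norm_sum_f_mul_le {N : ℕ} {y : ℤ → ℂ} {D : ℝ} (hD : 0 ≤ D) {κ : ℕ}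
    (hy : ∀ k, ‖y k‖ ≤ D * ρ ^ (k - κ).natAbs) {i : ℤ} (hi : i ≤ 0) :
    ‖∑ j ∈ Finset.Ico (0 : ℤ) N, f (i - j) * y j‖ ≤ C * D * N * ρ ^ κ := by
  have hρ := W.pos
  have hC : 0 ≤ C := zero_le_one.trans W.one_le
  refine (norm_sum_le_of_le (n := fun _ => C * D * ρ ^ κ) _ fun j hj => ?_).trans_eq ?_
  · rw [Finset.mem_Ico] at hj
    rw [norm_mul]
    calc ‖f (i - j)‖ * ‖y j‖ ≤ (C * ρ ^ (i - j).natAbs) * (D * ρ ^ (j - κ).natAbs) :=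
          mul_le_mul (W.f_le _) (hy j) (norm_nonneg _) (by positivity)
      _ = C * D * ρ ^ ((i - j).natAbs + (j - κ).natAbs) := by rw [pow_add]; ring
      _ ≤ _ := by
          gcongr ?_ * ?_
          exact pow_le_pow_of_le_one hρ.le W.lt_one.le (by omega)
  · simp; ring

end WienerHopf

/-! ### Inverses of large Toeplitz matrices -/

/-- The `N × N` Toeplitz matrix of the sequence `f`. -/
def toep (f : ℤ → ℂ) (N : ℕ) : Matrix (Fin N) (Fin N) ℂ :=
  Matrix.of fun i j => f ((i : ℕ) - (j : ℕ) : ℤ)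

/-- The value of the bilinear form of the inverse Toeplitz matrix at two vectors, which are given
as functions on `ℤ`. -/
def invForm (f : ℤ → ℂ) (N : ℕ) (r v : ℤ → ℂ) : ℂ :=
  ∑ i : Fin N, r (i : ℕ) * ((toep f N)⁻¹.mulVec (fun j : Fin N => v (j : ℕ))) i

lemma toep_reflect (f : ℤ → ℂ) (N : ℕ) :
    toep (fun n => f (-n)) N = (toep f N).submatrix Fin.revPerm Fin.revPerm := by
  ext i j
  simp only [toep, Matrix.of_apply, Matrix.submatrix_apply, Fin.revPerm_apply, Fin.val_rev]
  congr 1; omega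

/-- Reversing the order of the indices conjugates the Toeplitz matrix of `f` into that of `n ↦ f
(-n)`; this transfers results from the right end to the left one. -/
lemma invForm_reflect (f : ℤ → ℂ) (N : ℕ) (r v : ℤ → ℂ) :
    invForm (fun n => f (-n)) N (fun i => r (N - 1 - i)) (fun i => v (N - 1 - i)) =
      invForm f N r v := by
  have hr : ∀ i : Fin N, ((N : ℤ) - 1 - ((i : ℕ) : ℤ)) = ((Fin.revPerm i : Fin N) : ℕ) := fun i => by
    rw [Fin.revPerm_apply, Fin.val_rev]; omega
  simp only [invForm, toep_reflect, Matrix.inv_submatrix_equiv, Matrix.mulVec, dotProduct,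
    Matrix.submatrix_apply, hr]
  rw [← Equiv.sum_comp (Fin.revPerm (n := N))
    (fun i : Fin N => r (i : ℕ) * ∑ j, (toep f N)⁻¹ i j * v (j : ℕ))]
  refine Finset.sum_congr rfl fun i _ => ?_
  rw [← Equiv.sum_comp (Fin.revPerm (n := N)) (fun j : Fin N => (toep f N)⁻¹ _ j * v (j : ℕ))]

namespace WienerHopf

variable {ρ C : ℝ} {a a' b b' f : ℤ → ℂ}

/-- The entries of the product of the truncated inverse factors. -/
def rightSol (a' b' : ℤ → ℂ) (N : ℕ) (j h : ℤ) : ℂ :=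
  ∑ k ∈ Finset.Ico (0 : ℤ) N, b' (j - k) * a' (k - h)

/-- An approximate inverse of the `N × N` Toeplitz matrix. -/
def approxInv (a' b' : ℤ → ℂ) (N : ℕ) : Matrix (Fin N) (Fin N) ℂ := Matrix.of fun j h =>
  if N ≤ 2 * (h : ℕ) + 1 then rightSol a' b' N (j : ℕ) (h : ℕ)
  else rightSol (fun n => b' (-n)) (fun n => a' (-n)) N (N - 1 - (j : ℕ)) (N - 1 - (h : ℕ))

section

variable (W : WienerHopf ρ C a a' b b' f)
include W

lemma norm_rightSol_le (N : ℕ) (j h : ℤ) : ‖rightSol a' b' N j h‖ ≤ N * C ^ 2 := by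
  have hρ := W.pos
  have hC := zero_le_one.trans W.one_le
  refine (W.norm_sum_b'_le (w := fun k => a' (k - h)) (κ := h) hC (fun k => W.a'_le _) j).trans ?_
  have h1 : ρ ^ (j - h).natAbs ≤ 1 := pow_le_one₀ hρ.le W.lt_one.le
  calc N * (C * C) * ρ ^ (j - h).natAbs ≤ N * (C * C) * 1 := by gcongr
    _ = _ := by ring

lemma norm_toep_rightSol_sub_le {N : ℕ} {i : ℤ} {h : ℕ} (hi : 0 ≤ i) (hi' : i < N)
    (hh : N ≤ 2 * h + 1) :
    ‖∑ j ∈ Finset.Ico (0 : ℤ) N, f (i - j) * rightSol a' b' N j h - if i = h then 1 else 0‖ ≤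
      C ^ 2 / (1 - ρ) * (C * C) * (N : ℝ) ^ 2 * ρ ^ ((N - 1) / 2) := by
  have hρ := W.pos
  have hρ1 : 0 < 1 - ρ := by linarith [W.lt_one]
  have hC := zero_le_one.trans W.one_le
  rw [← W.sum_conv_a (N := N) hi' (by omega : (0 : ℤ) ≤ h)]
  refine (W.norm_sum_f_mul_sub_le (κ := h) hC (fun k => W.a'_le _) hi).trans ?_
  gcongr ?_ * ?_
  exact pow_le_pow_of_le_one hρ.le W.lt_one.le (by omega)

lemma norm_approxInv_le (N : ℕ) (j h : Fin N) : ‖approxInv a' b' N j h‖ ≤ N * C ^ 2 := by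
  simp only [approxInv, Matrix.of_apply]
  split_ifs
  · exact W.norm_rightSol_le _ _ _
  · exact W.reflect.norm_rightSol_le _ _ _

/-- The product of inverse factors is accurate for columns `h` away from `0`, with error of order `ρ
^ h`. It is used for columns in the right half, and its reflection for the others, so that the
exponent is always at least `(N - 1) / 2`. -/
lemma norm_toep_mul_approxInv_sub_one_le (N : ℕ) (i h : Fin N) :
    ‖(toep f N * approxInv a' b' N - 1) i h‖ ≤
      C ^ 2 / (1 - ρ) * (C * C) * (N : ℝ) ^ 2 * ρ ^ ((N - 1) / 2) := by
  rw [Matrix.sub_apply, Matrix.mul_apply, Matrix.one_apply]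
  simp only [toep, approxInv, Matrix.of_apply]
  split_ifs with h1 h2 h2
  · have := W.norm_toep_rightSol_sub_le (N := N) (i := (i : ℕ)) (h := h) (by omega)
      (by exact_mod_cast i.2) h1
    rw [← sum_fin_eq_sum_Ico N (fun j => f ((i : ℕ) - j) * rightSol a' b' N j (h : ℕ))] at this
    simpa [h2] using this
  · have := W.norm_toep_rightSol_sub_le (N := N) (i := (i : ℕ)) (h := h) (by omega)
      (by exact_mod_cast i.2) h1
    rw [← sum_fin_eq_sum_Ico N (fun j => f ((i : ℕ) - j) * rightSol a' b' N j (h : ℕ))] at this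
    have h3 : ((i : ℕ) : ℤ) ≠ (h : ℕ) := fun e => h2 (Fin.ext (by exact_mod_cast e))
    simpa [h3] using this
  all_goals
    have hh := h.2
    have hi := i.2
    have := W.reflect.norm_toep_rightSol_sub_le (N := N) (i := N - 1 - (i : ℕ))
      (h := N - 1 - h) (by omega) (by omega) (by omega)
    rw [← sum_Ico_reflect] at this
    rw [← sum_fin_eq_sum_Ico N (fun j => f (-((N : ℤ) - 1 - (i : ℕ) - (N - 1 - j))) *
      rightSol (fun n => b' (-n)) (fun n => a' (-n)) N (N - 1 - j) (N - 1 - h : ℕ))] at this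
    convert! this using 3
    · refine Finset.sum_congr rfl fun j _ => ?_
      congr 2 <;> omega
    · split_ifs with h3
      · first
        | rfl
        | exact absurd (Fin.ext (by omega)) h2
      · first
        | rfl
        | exact absurd (by rw [h2]; omega) h3

/-- The exponentially small residual of `approxInv` beats the factor `N` required by
`approx_inverse`. The polynomial bound on the inverse comes from the bound `N * C ^ 2` on the
entries of `approxInv`. -/
lemma eventually_isUnit_det_toep :
    ∀ᶠ N in atTop, IsUnit (toep f N).det ∧
      ∀ e : Fin N → ℂ, ‖(toep f N)⁻¹.mulVec e‖ ≤ 2 * C ^ 2 * (N : ℝ) ^ 2 * ‖e‖ := by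
  have hρ := W.pos
  have hρ1 : 0 < 1 - ρ := by linarith [W.lt_one]
  have hC := zero_le_one.trans W.one_le
  set c := C ^ 2 / (1 - ρ) * (C * C) with hc
  have hc0 : 0 ≤ c := by positivity
  -- The square root compensates the halved exponent: `ρ ^ ((N - 1) / 2) ≤ σ ^ (N - 2)` for `N ≥ 2`.
  set σ := Real.sqrt ρ with hσ
  have hσ0 : 0 < σ := Real.sqrt_pos.2 hρ
  have hσ1 : σ < 1 := by rw [hσ, Real.sqrt_lt' one_pos, one_pow]; exact W.lt_one
  have hσ2 : σ ^ 2 = ρ := Real.sq_sqrt hρ.le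
  have ht := (tendsto_pow_const_mul_const_pow_of_abs_lt_one 3 (r := σ)
    (by rwa [abs_of_pos hσ0])).const_mul (c / σ ^ 2)
  rw [mul_zero] at ht
  filter_upwards [ht.eventually_le_const (by norm_num : (0 : ℝ) < 1 / 2)] with N hN
  have h2 : ρ ^ ((N - 1) / 2) ≤ σ ^ N / σ ^ 2 := by
    rw [le_div_iff₀ (by positivity), ← hσ2, ← pow_mul, ← pow_add]
    exact pow_le_pow_of_le_one hσ0.le hσ1.le (by omega)
  have h := approx_inverse (toep f N) (approxInv a' b' N) (toep f N * approxInv a' b' N - 1)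
    (ε := c * (N : ℝ) ^ 2 * ρ ^ ((N - 1) / 2)) (s := N * C ^ 2) (by positivity) (by positivity)
    (W.norm_toep_mul_approxInv_sub_one_le N) ?_ (W.norm_approxInv_le N) (by abel)
  · refine ⟨h.1, fun e => (h.2 e).trans_eq (by ring)⟩
  · calc N * (c * (N : ℝ) ^ 2 * ρ ^ ((N - 1) / 2)) ≤ N * (c * (N : ℝ) ^ 2 * (σ ^ N / σ ^ 2)) := by
          gcongr
      _ = c / σ ^ 2 * ((N : ℝ) ^ 3 * σ ^ N) := by ring
      _ ≤ _ := hN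

end

/-! ### Asymptotics of the inverse form -/

/-- The coordinate function of `t`. -/
def unitVec (t : ℤ) : ℤ → ℂ := fun i => if i = t then 1 else 0

/-- Right-hand sides `v` for which the Toeplitz system is solved up to exponentially small errors
by `b' * w`, where `w` is concentrated near the right end. -/
structure RightData (ρ : ℝ) (a : ℤ → ℂ) (v w : ℕ → ℤ → ℂ) (D : ℝ) (κ : ℕ → ℕ) (s : ℕ) :
    Prop where
  nonneg : 0 ≤ D
  le_add : ∀ᶠ N in atTop, N ≤ κ N + s
  norm_le : ∀ᶠ N in atTop, ∀ k, ‖w N k‖ ≤ D * ρ ^ (k - κ N).natAbs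
  exists_le : ∃ η, ExpSmall ρ η ∧ ∀ᶠ N : ℕ in atTop, ∀ i ∈ Finset.Ico (0 : ℤ) N,
    ‖∑ k ∈ Finset.Ico (0 : ℤ) N, a (i - k) * w N k - v N i‖ ≤ η N

section

variable {v w : ℕ → ℤ → ℂ} {D : ℝ} {κ : ℕ → ℕ} {s : ℕ}

/-- For the approximate solution `y` with residual `e = T y - v`, one has `T⁻¹ v = y - T⁻¹ e`. The
inverse is only polynomially large, so the exponential smallness of `e` survives. -/
lemma exists_norm_invForm_sub_le (W : WienerHopf ρ C a a' b b' f)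
    (R : RightData ρ a v w D κ s) {r : ℕ → ℤ → ℂ} {c : ℝ} (hc : 0 ≤ c)
    (hr : ∀ N i, ‖r N i‖ ≤ c) :
    ∃ δ, ExpSmall ρ δ ∧ ∀ᶠ N in atTop, ‖invForm f N (r N) (v N) - ∑ j ∈ Finset.Ico (0 : ℤ) N,
      r N j * ∑ k ∈ Finset.Ico (0 : ℤ) N, b' (j - k) * w N k‖ ≤ δ N := by
  have hρ := W.pos
  have hρ1 : 0 < 1 - ρ := by linarith [W.lt_one]
  have hC := zero_le_one.trans W.one_le
  have hD := R.nonneg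
  obtain ⟨η, hη, hηb⟩ := R.exists_le
  set K := C ^ 2 / (1 - ρ) * (C * D) with hK
  have hK0 : 0 ≤ K := by positivity
  set η' : ℕ → ℝ := fun N => K * (N : ℝ) ^ 2 * ρ ^ κ N + η N with hη'
  have hs : ExpSmall ρ η' :=
    ((expSmall_pow hρ W.lt_one s R.le_add).mul_pow hK0 2).add hρ hη
  refine ⟨_, hs.mul_pow (c := c * (2 * C ^ 2)) (by positivity) 3, ?_⟩
  filter_upwards [W.eventually_isUnit_det_toep, R.norm_le, hηb] with N hT hw hηN
  set y : ℤ → ℂ := fun j => ∑ k ∈ Finset.Ico (0 : ℤ) N, b' (j - k) * w N k with hy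
  set T := toep f N with hTdef
  set e : Fin N → ℂ := T.mulVec (fun j : Fin N => y (j : ℕ)) - fun i : Fin N => v N (i : ℕ) with he
  have hη0 : ∀ i : Fin N, ‖e i‖ ≤ η' N := by
    intro i
    have hi : ((i : ℕ) : ℤ) ∈ Finset.Ico (0 : ℤ) N := by
      rw [Finset.mem_Ico]; exact ⟨by omega, by exact_mod_cast i.2⟩
    have h1 := W.norm_sum_f_mul_sub_le (N := N) hD hw (i := (i : ℕ)) (by omega)
    have h2 := hηN _ hi
    have h3 : e i = ∑ j ∈ Finset.Ico (0 : ℤ) N, f ((i : ℕ) - j) * y j - v N (i : ℕ) := by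
      rw [← sum_fin_eq_sum_Ico N (fun j => f ((i : ℕ) - j) * y j)]
      rfl
    rw [h3]
    refine (le_of_eq ?_).trans ((norm_add_le _ _).trans (add_le_add h1 h2))
    congr 1; ring
  have hz : T⁻¹.mulVec (fun i : Fin N => v N (i : ℕ)) =
      (fun j : Fin N => y (j : ℕ)) - T⁻¹.mulVec e := by
    rw [he, Matrix.mulVec_sub, Matrix.mulVec_mulVec, Matrix.nonsing_inv_mul _ hT.1,
      Matrix.one_mulVec]
    abel
  have hsum : invForm f N (r N) (v N) - ∑ j ∈ Finset.Ico (0 : ℤ) N, r N j * y j =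
      - ∑ i : Fin N, r N (i : ℕ) * (T⁻¹.mulVec e) i := by
    rw [← sum_fin_eq_sum_Ico N (fun j => r N j * y j), invForm, ← hTdef, hz,
      ← Finset.sum_sub_distrib, ← Finset.sum_neg_distrib]
    refine Finset.sum_congr rfl fun i _ => ?_
    rw [Pi.sub_apply]; ring
  rw [hsum, norm_neg]
  rcases Nat.eq_zero_or_pos N with h0 | h0
  · subst h0; simp
  have hη'0 : 0 ≤ η' N := (norm_nonneg _).trans (hη0 ⟨0, h0⟩)
  have he' : ‖e‖ ≤ η' N := (pi_norm_le_iff_of_nonneg hη'0).2 hη0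
  refine (norm_sum_le_of_le (n := fun _ => c * (2 * C ^ 2 * (N : ℝ) ^ 2 * η' N)) _
    fun i _ => ?_).trans_eq ?_
  · rw [norm_mul]
    refine mul_le_mul (hr _ _) ?_ (norm_nonneg _) hc
    exact (norm_le_pi_norm _ i).trans ((hT.2 e).trans (by gcongr))
  · simp; ring

lemma norm_unitVec_le (t i : ℤ) : ‖unitVec t i‖ ≤ 1 := by
  simp only [unitVec]; split_ifs <;> simp

lemma sum_unitVec_mul {N : ℕ} {t : ℤ} (h0 : 0 ≤ t) (h1 : t < N) (y : ℤ → ℂ) :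
    ∑ j ∈ Finset.Ico (0 : ℤ) N, unitVec t j * y j = y t := by
  simp only [unitVec, ite_mul, one_mul, zero_mul]
  rw [Finset.sum_ite_eq', if_pos (by simp [h0, h1])]

lemma norm_f_le (W : WienerHopf ρ C a a' b b' f) (n : ℤ) : ‖f n‖ ≤ C := by
  have hC := zero_le_one.trans W.one_le
  refine (W.f_le n).trans (mul_le_of_le_one_right hC (pow_le_one₀ W.pos.le W.lt_one.le))

variable (W : WienerHopf ρ C a a' b b' f) (R : RightData ρ a v w D κ s)
include W R

/-- The solution is concentrated near the right end and decays exponentially away from it; at a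
fixed distance from the left end it is negligible. -/
lemma expSmall_unitVec_left {t : ℤ} (ht : 1 ≤ t) :
    ∃ δ, ExpSmall ρ δ ∧ ∀ᶠ N in atTop, ‖invForm f N (unitVec (t - 1)) (v N)‖ ≤ δ N := by
  have hρ := W.pos
  have hC := zero_le_one.trans W.one_le
  have hD := R.nonneg
  obtain ⟨δ, hδ, h⟩ := exists_norm_invForm_sub_le W R (r := fun _ => unitVec (t - 1)) zero_le_one
    (fun _ _ => norm_unitVec_le _ _)
  have hs : ∀ᶠ N in atTop, N ≤ (t - 1 - κ N).natAbs + (s + t.toNat) := by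
    filter_upwards [R.le_add] with N h1
    omega
  refine ⟨_, hδ.add hρ ((expSmall_pow hρ W.lt_one _ hs).mul_pow
    (c := C * D) (by positivity) 1), ?_⟩
  filter_upwards [h, R.norm_le, eventually_ge_atTop t.toNat] with N h1 h2 h3
  rw [sum_unitVec_mul (by omega) (by omega)] at h1
  have h4 := W.norm_sum_b'_le (N := N) hD h2 (t - 1)
  have h5 := norm_sub_norm_le (invForm f N (unitVec (t - 1)) (v N))
    (∑ k ∈ Finset.Ico (0 : ℤ) N, b' (t - 1 - k) * w N k)
  have h6 : (N : ℝ) * (C * D) * ρ ^ (t - 1 - κ N).natAbs =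
    C * D * (N : ℝ) ^ 1 * ρ ^ (t - 1 - κ N).natAbs := by ring
  linarith

lemma expSmall_f_left {p : ℤ} (hp : 1 ≤ p) :
    ∃ δ, ExpSmall ρ δ ∧ ∀ᶠ N in atTop, ‖invForm f N (fun j => f (-p - j)) (v N)‖ ≤ δ N := by
  have hρ := W.pos
  have hC := zero_le_one.trans W.one_le
  have hD := R.nonneg
  obtain ⟨δ, hδ, h⟩ := exists_norm_invForm_sub_le W R (r := fun _ j => f (-p - j)) hC
    (fun _ _ => W.norm_f_le _)
  refine ⟨_, hδ.add hρ ((expSmall_pow hρ W.lt_one _ R.le_add).mul_pow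
    (c := C * (C * D)) (by positivity) 2), ?_⟩
  filter_upwards [h, R.norm_le] with N h1 h2
  have h4 := W.norm_sum_f_mul_le (N := N) (D := N * (C * D)) (κ := κ N) (by positivity)
    (W.norm_sum_b'_le (N := N) hD h2) (i := -p) (by omega)
  have h5 := norm_sub_norm_le (invForm f N (fun j => f (-p - j)) (v N))
    (∑ j ∈ Finset.Ico (0 : ℤ) N, f (-p - j) * ∑ k ∈ Finset.Ico (0 : ℤ) N, b' (j - k) * w N k)
  have h6 : C * (N * (C * D)) * N * ρ ^ κ N = C * (C * D) * (N : ℝ) ^ 2 * ρ ^ κ N := by ring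
  linarith

lemma expSmall_unitVec_right {t : ℤ} (ht : 1 ≤ t) :
    ∃ δ, ExpSmall ρ δ ∧ ∀ᶠ N in atTop, ‖invForm f N (unitVec (N - t)) (v N) -
      ∑ k ∈ Finset.Ico (0 : ℤ) N, b' (N - t - k) * w N k‖ ≤ δ N := by
  obtain ⟨δ, hδ, h⟩ := exists_norm_invForm_sub_le W R (r := fun N => unitVec (N - t)) zero_le_one
    (fun _ _ => norm_unitVec_le _ _)
  refine ⟨_, hδ, ?_⟩
  filter_upwards [h, eventually_ge_atTop t.toNat] with N h1 h3
  rwa [sum_unitVec_mul (by omega) (by omega)] at h1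

/-- Applying the Toeplitz row at `N + p - 1` to `b' * w` cancels the factor `b`, leaving a single
convolution with `a`. -/
lemma expSmall_f_right {p : ℤ} (hp : 1 ≤ p) :
    ∃ δ, ExpSmall ρ δ ∧ ∀ᶠ N in atTop, ‖invForm f N (fun j => f (N + p - 1 - j)) (v N) -
      ∑ k ∈ Finset.Ico (0 : ℤ) N, a (N + p - 1 - k) * w N k‖ ≤ δ N := by
  have hρ := W.pos
  have hρ1 : 0 < 1 - ρ := by linarith [W.lt_one]
  have hC := zero_le_one.trans W.one_le
  have hD := R.nonneg
  obtain ⟨δ, hδ, h⟩ := exists_norm_invForm_sub_le W R (r := fun N j => f (N + p - 1 - j)) hC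
    (fun _ _ => W.norm_f_le _)
  refine ⟨_, hδ.add hρ ((expSmall_pow hρ W.lt_one _ R.le_add).mul_pow
    (c := C ^ 2 / (1 - ρ) * (C * D)) (by positivity) 2), ?_⟩
  filter_upwards [h, R.norm_le] with N h1 h2
  have h4 := W.norm_sum_f_mul_sub_le (N := N) hD h2 (i := N + p - 1) (by omega)
  exact (norm_sub_le_norm_sub_add_norm_sub _ _ _).trans (add_le_add h1 h4)

end

end WienerHopf

/-! ### The limiting entries -/

/-- Limiting entry for a new row and a removed row. -/
def edgePH (a a' : ℤ → ℂ) (p h : ℤ) : ℂ := ∑' m : ℕ, a (p + m) * a' (h - 1 - m)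

/-- Limiting entry for a new row and a new column. -/
def edgePK (a b : ℤ → ℂ) (p k : ℤ) : ℂ := ∑' m : ℕ, a (p - 1 - m) * b (m + 1 - k)

/-- Limiting entry for a removed column and a removed row. -/
def edgeTH (a' b' : ℤ → ℂ) (t h : ℤ) : ℂ := -∑' m : ℕ, b' (m + 1 - t) * a' (h - 1 - m)

/-- Limiting entry for a removed column and a new column. -/
def edgeTK (b b' : ℤ → ℂ) (t k : ℤ) : ℂ := ∑' m : ℕ, b' (m + 1 - t) * b (-k - m)

lemma sum_Ico_eq_sum_range (N : ℕ) (g : ℤ → ℂ) :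
    ∑ k ∈ Finset.Ico (0 : ℤ) N, g k = ∑ m ∈ Finset.range N, g m := by
  rw [← sum_fin_eq_sum_Ico, Fin.sum_univ_eq_sum_range (fun i => g (i : ℤ))]

/-- Counting from the right end removes `N` from the summand. In the applications one-sidedness
kills all but a fixed number of terms, so for large `N` the sum equals its limit exactly. -/
lemma sum_Ico_eq_tsum_reflect {N : ℕ} (g : ℤ → ℂ) (u : ℕ → ℂ)
    (hgu : ∀ m < N, g (N - 1 - m) = u m) (hu : ∀ m, N ≤ m → u m = 0) :
    ∑ k ∈ Finset.Ico (0 : ℤ) N, g k = ∑' m, u m := by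
  rw [← sum_Ico_reflect, sum_Ico_eq_sum_range, tsum_eq_sum (s := Finset.range N)]
  · exact Finset.sum_congr rfl fun m hm => hgu m (Finset.mem_range.1 hm)
  · intro m hm
    exact hu m (by simpa using hm)

namespace WienerHopf

variable {ρ C : ℝ} {a a' b b' f : ℤ → ℂ} (W : WienerHopf ρ C a a' b b' f)
include W

/-- A column of the inverse of the triangular factor `a` solves the system exactly, so the residual
is zero. -/
lemma rightData_unitVec {h : ℤ} (hh : 1 ≤ h) :
    RightData ρ a (fun N => unitVec (N - h)) (fun N k => a' (k - (N - h))) C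
      (fun N => N - h.toNat) h.toNat where
  nonneg := zero_le_one.trans W.one_le
  le_add := Eventually.of_forall fun N => by omega
  norm_le := by
    filter_upwards [eventually_ge_atTop h.toNat] with N hN k
    have : k - (N - h) = k - ((N - h.toNat : ℕ) : ℤ) := by omega
    rw [this]
    exact W.a'_le _
  exists_le := by
    refine ⟨fun _ => 0, ⟨0, 0, le_rfl, by simp⟩, ?_⟩
    filter_upwards [eventually_ge_atTop h.toNat] with N hN i hi
    rw [Finset.mem_Ico] at hi
    rw [W.sum_conv_a hi.2 (by omega), unitVec, sub_self, norm_zero]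

/-- A new column beyond the right end is `a` applied to the corresponding column of `b`, up to the
corner error, which is of order `ρ ^ N` at this distance. -/
lemma rightData_f {k : ℤ} (hk : 1 ≤ k) :
    RightData ρ a (fun N i => f (i - (N + k - 1))) (fun N i => b (i - (N + k - 1))) C
      (fun N => N + k.toNat - 1) 0 where
  nonneg := zero_le_one.trans W.one_le
  le_add := Eventually.of_forall fun N => by omega
  norm_le := by
    refine Eventually.of_forall fun N i => ?_
    have : i - (N + k - 1) = i - ((N + k.toNat - 1 : ℕ) : ℤ) := by omega
    rw [this]
    exact W.b_le _
  exists_le := by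
    have hρ := W.pos
    have hρ1 : 0 < 1 - ρ := by linarith [W.lt_one]
    refine ⟨_, (expSmall_pow hρ W.lt_one 0 (κ := fun N => N)
      (Eventually.of_forall fun N => le_rfl)).mul_pow (c := C ^ 2 / (1 - ρ)) (by positivity) 0, ?_⟩
    refine Eventually.of_forall fun N i hi => ?_
    rw [Finset.mem_Ico] at hi
    rw [norm_sub_rev]
    refine (W.norm_conv_f_sub_le hi.1 (by omega) (Or.inl hi.2)).trans ?_
    rw [pow_zero, mul_one]
    gcongr ?_ * ?_
    exact pow_le_pow_of_le_one hρ.le W.lt_one.le (by omega)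

lemma isBigONegInfty_of_exists {u : ℕ → ℂ}
    (h : ∃ δ, ExpSmall ρ δ ∧ ∀ᶠ N in atTop, ‖u N‖ ≤ δ N) : IsBigONegInfty u := by
  obtain ⟨δ, hδ, h⟩ := h
  exact IsBigONegInfty.of_expSmall W.pos W.lt_one hδ h

lemma invForm_th_right {t h : ℤ} (ht : 1 ≤ t) (hh : 1 ≤ h) :
    IsBigONegInfty fun N => -invForm f N (unitVec (N - t)) (unitVec (N - h)) -
      edgeTH a' b' t h := by
  obtain ⟨δ, hδ, hb⟩ := expSmall_unitVec_right W (W.rightData_unitVec hh) ht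
  refine W.isBigONegInfty_of_exists ⟨δ, hδ, ?_⟩
  filter_upwards [hb, eventually_ge_atTop h.toNat] with N h1 h2
  rw [sum_Ico_eq_tsum_reflect _ (fun m : ℕ => b' (m + 1 - t) * a' (h - 1 - m))] at h1
  · rw [edgeTH]
    rw [← norm_neg]
    refine (le_of_eq ?_).trans h1
    congr 1; ring
  · intro m hm; congr 2 <;> ring
  · intro m hm
    rw [W.a'_neg _ (by omega), mul_zero]

lemma invForm_tk_right {t k : ℤ} (ht : 1 ≤ t) (hk : 1 ≤ k) :
    IsBigONegInfty fun N => invForm f N (unitVec (N - t)) (fun i => f (i - (N + k - 1))) -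
      edgeTK b b' t k := by
  obtain ⟨δ, hδ, hb⟩ := expSmall_unitVec_right W (W.rightData_f hk) ht
  refine W.isBigONegInfty_of_exists ⟨δ, hδ, ?_⟩
  filter_upwards [hb, eventually_ge_atTop t.toNat] with N h1 h2
  rwa [sum_Ico_eq_tsum_reflect _ (fun m : ℕ => b' (m + 1 - t) * b (-k - m))] at h1
  · intro m hm; congr 2 <;> ring
  · intro m hm
    rw [W.b'_pos _ (by omega), zero_mul]

lemma invForm_ph_right {p h : ℤ} (hp : 1 ≤ p) (hh : 1 ≤ h) :
    IsBigONegInfty fun N => invForm f N (fun j => f (N + p - 1 - j)) (unitVec (N - h)) -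
      edgePH a a' p h := by
  obtain ⟨δ, hδ, hb⟩ := expSmall_f_right W (W.rightData_unitVec hh) hp
  refine W.isBigONegInfty_of_exists ⟨δ, hδ, ?_⟩
  filter_upwards [hb, eventually_ge_atTop h.toNat] with N h1 h2
  rwa [sum_Ico_eq_tsum_reflect _ (fun m : ℕ => a (p + m) * a' (h - 1 - m))] at h1
  · intro m hm; congr 2 <;> ring
  · intro m hm
    rw [W.a'_neg _ (by omega), mul_zero]

/-- The corner entry is, up to a small error, the convolution of `a` and `b` over `[0, N + p)`. The
part over `[0, N)` is cancelled by the inverse form; the remaining `p` terms are the limit. -/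
lemma invForm_pk_right {p k : ℤ} (hp : 1 ≤ p) (hk : 1 ≤ k) :
    IsBigONegInfty fun N : ℕ => f ((N + p - 1) - (N + k - 1)) -
      invForm f N (fun j => f (N + p - 1 - j)) (fun i => f (i - (N + k - 1))) -
      edgePK a b p k := by
  have hρ := W.pos
  have hρ1 : 0 < 1 - ρ := by linarith [W.lt_one]
  obtain ⟨δ, hδ, hb⟩ := expSmall_f_right W (W.rightData_f hk) hp
  refine W.isBigONegInfty_of_exists ⟨_, hδ.add hρ ((expSmall_pow hρ W.lt_one 0 (κ := fun N => N)
      (Eventually.of_forall fun N => le_rfl)).mul_pow (c := C ^ 2 / (1 - ρ)) (by positivity) 0), ?_⟩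
  filter_upwards [hb] with N h1
  have h2 := W.norm_conv_f_sub_le (i := N + p - 1) (j := N + k - 1) (M := N + p.toNat)
    (by omega) (by omega) (Or.inl (by omega))
  have h3 : ∑ i ∈ Finset.Ico (0 : ℤ) (N + p.toNat : ℕ), a (N + p - 1 - i) * b (i - (N + k - 1)) =
      ∑ i ∈ Finset.Ico (0 : ℤ) N, a (N + p - 1 - i) * b (i - (N + k - 1)) + edgePK a b p k := by
    rw [sum_Ico_eq_sum_range, sum_Ico_eq_sum_range, Finset.sum_range_add, edgePK,
      tsum_eq_sum (s := Finset.range p.toNat)]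
    · congr 1
      refine Finset.sum_congr rfl fun m _ => ?_
      push_cast
      congr 2 <;> ring
    · intro m hm
      rw [Finset.mem_range, not_lt] at hm
      rw [W.a_neg _ (by omega), zero_mul]
  have h4 : ρ ^ (N + p - 1 + (N + k - 1)).toNat ≤ ρ ^ N :=
    pow_le_pow_of_le_one hρ.le W.lt_one.le (by omega)
  have h5 : C ^ 2 / (1 - ρ) * ρ ^ (N + p - 1 + (N + k - 1)).toNat ≤
      C ^ 2 / (1 - ρ) * (N : ℝ) ^ 0 * ρ ^ N := by
    rw [pow_zero, mul_one]; gcongr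
  rw [h3] at h2
  refine (le_of_eq ?_).trans ((norm_sub_le _ _).trans
    ((add_le_add (h2.trans h5) h1).trans_eq (add_comm _ _)))
  congr 1; ring

lemma invForm_left_right {v w : ℕ → ℤ → ℂ} {D : ℝ} {κ : ℕ → ℕ} {s : ℕ}
    (R : RightData ρ a v w D κ s) {p : ℤ} (hp : 1 ≤ p) :
    IsBigONegInfty (fun N => invForm f N (unitVec (p - 1)) (v N)) ∧
    IsBigONegInfty (fun N => invForm f N (fun j => f (-p - j)) (v N)) :=
  ⟨W.isBigONegInfty_of_exists (expSmall_unitVec_left W R hp),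
    W.isBigONegInfty_of_exists (expSmall_f_left W R hp)⟩

lemma f_left_right {p k : ℤ} (hp : 1 ≤ p) (hk : 1 ≤ k) :
    IsBigONegInfty fun N : ℕ => f (-p - (N + k - 1)) := by
  have hρ := W.pos
  have hC := zero_le_one.trans W.one_le
  refine W.isBigONegInfty_of_exists ⟨_, (expSmall_pow hρ W.lt_one 0 (κ := fun N => N)
      (Eventually.of_forall fun N => le_rfl)).mul_pow (c := C) hC 0, ?_⟩
  refine Eventually.of_forall fun N => (W.f_le _).trans ?_
  rw [pow_zero, mul_one]
  gcongr ?_ * ?_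
  exact pow_le_pow_of_le_one hρ.le W.lt_one.le (by omega)

end WienerHopf

/-! ### Rows and columns at the two edges -/

lemma IsBigONegInfty.add {u v : ℕ → ℂ} (hu : IsBigONegInfty u) (hv : IsBigONegInfty v) :
    IsBigONegInfty (fun N => u N + v N) := fun K => (hu K).add (hv K)

lemma IsBigONegInfty.sub {u v : ℕ → ℂ} (hu : IsBigONegInfty u) (hv : IsBigONegInfty v) :
    IsBigONegInfty (fun N => u N - v N) := fun K => (hu K).sub (hv K)

lemma IsBigONegInfty.neg {u : ℕ → ℂ} (hu : IsBigONegInfty u) :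
    IsBigONegInfty (fun N => -u N) := fun K => (hu K).neg_left

lemma isBigONegInfty_congr {u v : ℕ → ℂ} (hu : IsBigONegInfty u) (h : ∀ N, v N = u N) :
    IsBigONegInfty v := by rwa [funext h]

lemma IsBigONegInfty.congr' {u v : ℕ → ℂ} (hu : IsBigONegInfty u) (h : ∀ᶠ N in atTop, u N = v N) :
    IsBigONegInfty v := fun K => (hu K).congr' h EventuallyEq.rfl

/-- Position, counted from `0`, of an index removed at the left (`inl`) or right (`inr`) edge. -/
def oldPos {ι κ : Type*} (x : ι → ℤ) (y : κ → ℤ) (N : ℕ) : ι ⊕ κ → ℤ :=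
  Sum.elim (fun i => x i - 1) (fun j => N - y j)

/-- Position, counted from `0`, of an index added at the left (`inl`) or right (`inr`) edge. -/
def newPos {ι κ : Type*} (x : ι → ℤ) (y : κ → ℤ) (N : ℕ) : ι ⊕ κ → ℤ :=
  Sum.elim (fun i => -x i) (fun j => N + y j - 1)

/-- The block diagonal matrix on a sum of index types with given entries. -/
def edgeBlocks {ι κ ι' κ' : Type*} (A : Matrix ι ι' ℂ) (B : Matrix κ κ' ℂ) :
    Matrix (ι ⊕ κ) (ι' ⊕ κ') ℂ := Matrix.fromBlocks A 0 0 B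

namespace WienerHopf

variable {ρ C : ℝ} {a a' b b' f : ℤ → ℂ} (W : WienerHopf ρ C a a' b b' f)
include W

variable {ι κ ι' κ' : Type*} {x : ι → ℤ} {y : κ → ℤ} {x' : ι' → ℤ} {y' : κ' → ℤ}

/-- At the right end the limit is computed directly, at the left end by reflection; the two mixed
cases decay because row and column data sit at opposite ends. The next three results follow the same
pattern. -/
theorem asymptotics_ph (hx : ∀ i, 1 ≤ x i) (hy : ∀ i, 1 ≤ y i) (hx' : ∀ i, 1 ≤ x' i)
    (hy' : ∀ i, 1 ≤ y' i) (i : ι ⊕ κ) (j : ι' ⊕ κ') :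
    IsBigONegInfty fun N => invForm f N (fun s => f (newPos x y N i - s))
      (unitVec (oldPos x' y' N j)) -
      edgeBlocks (Matrix.of fun i j => edgePH (fun n => b (-n)) (fun n => b' (-n)) (x i) (x' j))
        (Matrix.of fun i j => edgePH a a' (y i) (y' j)) i j := by
  rcases i with i | i <;> rcases j with j | j <;>
    simp only [newPos, oldPos, Sum.elim_inl, Sum.elim_inr, edgeBlocks, Matrix.fromBlocks_apply₁₁,
      Matrix.fromBlocks_apply₁₂, Matrix.fromBlocks_apply₂₁, Matrix.fromBlocks_apply₂₂,
      Matrix.of_apply, Matrix.zero_apply, sub_zero]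
  · refine isBigONegInfty_congr (W.reflect.invForm_ph_right (hx i) (hx' j)) fun N => ?_
    rw [← invForm_reflect]
    congr 2
    · funext s; congr 1; ring
    · funext s; simp only [unitVec]; congr 1; grind
  · exact (W.invForm_left_right (W.rightData_unitVec (hy' j)) (hx i)).2
  · refine isBigONegInfty_congr
      (W.reflect.invForm_left_right (W.reflect.rightData_unitVec (hx' j)) (hy i)).2 fun N => ?_
    rw [← invForm_reflect]
    congr 1
    · funext s; congr 1; ring
    · funext s; simp only [unitVec]; congr 1; grind
  · exact W.invForm_ph_right (hy i) (hy' j)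

theorem asymptotics_th (hx : ∀ i, 1 ≤ x i) (hy : ∀ i, 1 ≤ y i) (hx' : ∀ i, 1 ≤ x' i)
    (hy' : ∀ i, 1 ≤ y' i) (i : ι ⊕ κ) (j : ι' ⊕ κ') :
    IsBigONegInfty fun N => -invForm f N (unitVec (oldPos x y N i)) (unitVec (oldPos x' y' N j)) -
      edgeBlocks (Matrix.of fun i j => edgeTH (fun n => b' (-n)) (fun n => a' (-n)) (x i) (x' j))
        (Matrix.of fun i j => edgeTH a' b' (y i) (y' j)) i j := by
  rcases i with i | i <;> rcases j with j | j <;>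
    simp only [oldPos, Sum.elim_inl, Sum.elim_inr, edgeBlocks, Matrix.fromBlocks_apply₁₁,
      Matrix.fromBlocks_apply₁₂, Matrix.fromBlocks_apply₂₁, Matrix.fromBlocks_apply₂₂,
      Matrix.of_apply, Matrix.zero_apply, sub_zero]
  · refine isBigONegInfty_congr (W.reflect.invForm_th_right (hx i) (hx' j)) fun N => ?_
    rw [← invForm_reflect]
    congr 3
    · funext s; simp only [unitVec]; congr 1; grind
    · funext s; simp only [unitVec]; congr 1; grind
  · exact (W.invForm_left_right (W.rightData_unitVec (hy' j)) (hx i)).1.neg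
  · refine isBigONegInfty_congr
      (W.reflect.invForm_left_right (W.reflect.rightData_unitVec (hx' j)) (hy i)).1.neg fun N => ?_
    rw [← invForm_reflect]
    congr 2
    · funext s; simp only [unitVec]; congr 1; grind
    · funext s; simp only [unitVec]; congr 1; grind
  · exact W.invForm_th_right (hy i) (hy' j)

theorem asymptotics_tk (hx : ∀ i, 1 ≤ x i) (hy : ∀ i, 1 ≤ y i) (hx' : ∀ i, 1 ≤ x' i)
    (hy' : ∀ i, 1 ≤ y' i) (i : ι ⊕ κ) (j : ι' ⊕ κ') :
    IsBigONegInfty fun N => invForm f N (unitVec (oldPos x y N i))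
      (fun s => f (s - newPos x' y' N j)) -
      edgeBlocks (Matrix.of fun i j => edgeTK (fun n => a (-n)) (fun n => a' (-n)) (x i) (x' j))
        (Matrix.of fun i j => edgeTK b b' (y i) (y' j)) i j := by
  rcases i with i | i <;> rcases j with j | j <;>
    simp only [newPos, oldPos, Sum.elim_inl, Sum.elim_inr, edgeBlocks, Matrix.fromBlocks_apply₁₁,
      Matrix.fromBlocks_apply₁₂, Matrix.fromBlocks_apply₂₁, Matrix.fromBlocks_apply₂₂,
      Matrix.of_apply, Matrix.zero_apply, sub_zero]
  · refine isBigONegInfty_congr (W.reflect.invForm_tk_right (hx i) (hx' j)) fun N => ?_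
    rw [← invForm_reflect]
    congr 2
    · funext s; simp only [unitVec]; congr 1; grind
    · funext s; congr 1; ring
  · exact (W.invForm_left_right (W.rightData_f (hy' j)) (hx i)).1
  · refine isBigONegInfty_congr
      (W.reflect.invForm_left_right (W.reflect.rightData_f (hx' j)) (hy i)).1 fun N => ?_
    rw [← invForm_reflect]
    congr 1
    · funext s; simp only [unitVec]; congr 1; grind
    · funext s; congr 1; ring
  · exact W.invForm_tk_right (hy i) (hy' j)

theorem asymptotics_pk (hx : ∀ i, 1 ≤ x i) (hy : ∀ i, 1 ≤ y i) (hx' : ∀ i, 1 ≤ x' i)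
    (hy' : ∀ i, 1 ≤ y' i) (i : ι ⊕ κ) (j : ι' ⊕ κ') :
    IsBigONegInfty fun N => f (newPos x y N i - newPos x' y' N j) -
      invForm f N (fun s => f (newPos x y N i - s)) (fun s => f (s - newPos x' y' N j)) -
      edgeBlocks (Matrix.of fun i j => edgePK (fun n => b (-n)) (fun n => a (-n)) (x i) (x' j))
        (Matrix.of fun i j => edgePK a b (y i) (y' j)) i j := by
  rcases i with i | i <;> rcases j with j | j <;>
    simp only [newPos, Sum.elim_inl, Sum.elim_inr, edgeBlocks, Matrix.fromBlocks_apply₁₁,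
      Matrix.fromBlocks_apply₁₂, Matrix.fromBlocks_apply₂₁, Matrix.fromBlocks_apply₂₂,
      Matrix.of_apply, Matrix.zero_apply, sub_zero]
  · refine isBigONegInfty_congr (W.reflect.invForm_pk_right (hx i) (hx' j)) fun N => ?_
    rw [← invForm_reflect]
    congr 2
    · congr 1; ring
    · congr 1
      · funext s; congr 1; ring
      · funext s; congr 1; ring
  · exact (W.f_left_right (hx i) (hy' j)).sub
      (W.invForm_left_right (W.rightData_f (hy' j)) (hx i)).2
  · refine isBigONegInfty_congr ((W.reflect.f_left_right (hy i) (hx' j)).sub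
      (W.reflect.invForm_left_right (W.reflect.rightData_f (hx' j)) (hy i)).2) fun N => ?_
    rw [← invForm_reflect]
    congr 1
    · congr 1; ring
    · congr 1
      · funext s; congr 1; ring
      · funext s; congr 1; ring
  · exact W.invForm_pk_right (hy i) (hy' j)

end WienerHopf

/-! ### Determinants up to rapidly decreasing errors -/

lemma IsBigONegInfty.mul {u v : ℕ → ℂ} (hu : IsBigONegInfty u) (hv : IsBigONegInfty v) :
    IsBigONegInfty (fun N => u N * v N) := fun K => by
  simpa using (hu K).mul (hv 0)

lemma IsBigONegInfty.const_mul {u : ℕ → ℂ} (hu : IsBigONegInfty u) (c : ℂ) :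
    IsBigONegInfty (fun N => c * u N) := fun K => (hu K).const_mul_left c

lemma isBigONegInfty_zero : IsBigONegInfty (fun _ => 0) := fun K => by
  simpa using Asymptotics.isBigO_zero _ _

lemma IsBigONegInfty.sum {ι : Type*} {s : Finset ι} {u : ι → ℕ → ℂ}
    (h : ∀ i ∈ s, IsBigONegInfty (u i)) : IsBigONegInfty (fun N => ∑ i ∈ s, u i N) :=
  fun K => by simpa only [Finset.sum_fn] using Asymptotics.IsBigO.sum fun i hi => h i hi K

lemma IsBigONegInfty.prod_sub {ι : Type*} {s : Finset ι} {u : ι → ℕ → ℂ} {c : ι → ℂ}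
    (h : ∀ i ∈ s, IsBigONegInfty (fun N => u i N - c i)) :
    IsBigONegInfty (fun N => ∏ i ∈ s, u i N - ∏ i ∈ s, c i) := by
  classical
  induction s using Finset.induction_on with
  | empty => simpa using isBigONegInfty_zero
  | insert i s hi ih =>
    have h1 := h i (Finset.mem_insert_self i s)
    have h2 := ih fun j hj => h j (Finset.mem_insert_of_mem hj)
    refine isBigONegInfty_congr (((h1.mul h2).add (h1.const_mul (∏ j ∈ s, c j))).add
      (h2.const_mul (c i))) fun N => ?_
    rw [Finset.prod_insert hi, Finset.prod_insert hi]
    ring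

lemma IsBigONegInfty.det_sub {ν : Type*} [Fintype ν] [DecidableEq ν] {X : ℕ → Matrix ν ν ℂ}
    {Y : Matrix ν ν ℂ} (h : ∀ i j, IsBigONegInfty (fun N => X N i j - Y i j)) :
    IsBigONegInfty (fun N => (X N).det - Y.det) := by
  have : IsBigONegInfty (fun N => ∑ σ : Equiv.Perm ν, ((Equiv.Perm.sign σ : ℤ) : ℂ) *
      (∏ i, X N (σ i) i - ∏ i, Y (σ i) i)) :=
    IsBigONegInfty.sum fun σ _ => (IsBigONegInfty.prod_sub fun i _ => h (σ i) i).const_mul _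
  refine isBigONegInfty_congr this fun N => ?_
  rw [Matrix.det_apply', Matrix.det_apply', ← Finset.sum_sub_distrib]
  simp only [mul_sub]

/-! ### The limiting matrix -/

/-- The limiting matrix attached to one edge. -/
def edgeMatrix (a a' b b' : ℤ → ℂ) {ι κ : Type*} (p h : ι → ℤ) (k t : κ → ℤ) :
    Matrix (ι ⊕ κ) (ι ⊕ κ) ℂ :=
  Matrix.fromBlocks (Matrix.of fun i j => edgePH a a' (p i) (h j))
    (Matrix.of fun i j => edgePK a b (p i) (k j))
    (Matrix.of fun i j => edgeTH a' b' (t i) (h j))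
    (Matrix.of fun i j => edgeTK b b' (t i) (k j))

/-- Regrouping the indices by edge instead of by type is the same permutation of rows and columns,
hence costs no sign, and makes the matrix block diagonal. -/
lemma det_fromBlocks_edgeBlocks {ι κ ι' κ' : Type*} [Fintype ι] [DecidableEq ι] [Fintype κ]
    [DecidableEq κ] [Fintype ι'] [DecidableEq ι'] [Fintype κ'] [DecidableEq κ']
    (A : Matrix ι ι ℂ) (A' : Matrix ι' ι' ℂ) (B : Matrix ι κ ℂ) (B' : Matrix ι' κ' ℂ)
    (G : Matrix κ ι ℂ) (G' : Matrix κ' ι' ℂ) (D : Matrix κ κ ℂ) (D' : Matrix κ' κ' ℂ) :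
    (Matrix.fromBlocks (edgeBlocks A A') (edgeBlocks B B') (edgeBlocks G G')
      (edgeBlocks D D')).det =
      (Matrix.fromBlocks A B G D).det * (Matrix.fromBlocks A' B' G' D').det := by
  rw [← Matrix.det_fromBlocks_zero₂₁ _ 0,
    ← Matrix.det_submatrix_equiv_self (Equiv.sumSumSumComm ι ι' κ κ')]
  congr 1
  ext i j
  rcases i with (i | i) | (i | i) <;> rcases j with (j | j) | (j | j) <;> rfl

namespace WienerHopf

variable {ρ C : ℝ} {a a' b b' f : ℤ → ℂ} (W : WienerHopf ρ C a a' b b' f)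
include W

/-- For large `N` the ratio is exactly the bordered determinant, whose entries converge rapidly to a
matrix that decouples the two edges. The error is additive, so no nonvanishing of the limit is
required here. -/
theorem det_ratio_asymptotics {nm np rm rp : ℕ}
    (pm hm : Fin nm → ℤ) (pp hp : Fin np → ℤ)
    (km tm : Fin rm → ℤ) (kp tp : Fin rp → ℤ)
    (pm_pos : ∀ a, 1 ≤ pm a) (hm_pos : ∀ a, 1 ≤ hm a)
    (pp_pos : ∀ a, 1 ≤ pp a) (hp_pos : ∀ a, 1 ≤ hp a)
    (km_pos : ∀ a, 1 ≤ km a) (tm_pos : ∀ a, 1 ≤ tm a)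
    (kp_pos : ∀ a, 1 ≤ kp a) (tp_pos : ∀ a, 1 ≤ tp a)
    (hm_inj : Function.Injective hm) (hp_inj : Function.Injective hp)
    (tm_inj : Function.Injective tm) (tp_inj : Function.Injective tp) :
    IsBigONegInfty fun N : ℕ =>
      (Matrix.of fun i j : Fin N => f (
        lacSeq (Sum.elim hm fun a => (N : ℤ) + 1 - hp a)
          (Sum.elim (fun a => 1 - pm a) fun a => pp a + N) ((i : ℕ) + 1) -
        lacSeq (Sum.elim tm fun a => (N : ℤ) + 1 - tp a)
          (Sum.elim (fun a => 1 - km a) fun a => kp a + N) ((j : ℕ) + 1))).det *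
        (toep f N).det⁻¹ -
      (edgeMatrix (fun n => b (-n)) (fun n => b' (-n)) (fun n => a (-n)) (fun n => a' (-n))
        pm hm km tm).det * (edgeMatrix a a' b b' pp hp kp tp).det := by
  -- For large `N` the removed positions at the two ends are distinct and lie in range. The shift
  -- between `oldPos`, `newPos` and `lacSeq` is the passage from indices starting at `0` to indices
  -- starting at `1`.
  have hlac : ∀ {n n' : ℕ} (x : Fin n → ℤ) (y : Fin n' → ℤ) (q : Fin n → ℤ) (q' : Fin n' → ℤ),
      (∀ i, 1 ≤ x i) → (∀ i, 1 ≤ y i) → Function.Injective x → Function.Injective y →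
      ∀ᶠ N : ℕ in atTop, ∃ h : Fin n ⊕ Fin n' → Fin N, Function.Injective h ∧
        (∀ i, ((h i : ℕ) : ℤ) = oldPos x y N i) ∧
        (∀ i, lacSeq (Sum.elim x fun a => (N : ℤ) + 1 - y a)
          (Sum.elim (fun a => 1 - q a) fun a => q' a + N) ((h i : ℕ) + 1) = newPos q q' N i + 1) ∧
        ∀ i ∉ Set.range h, lacSeq (Sum.elim x fun a => (N : ℤ) + 1 - y a)
          (Sum.elim (fun a => 1 - q a) fun a => q' a + N) ((i : ℕ) + 1) = (i : ℕ) + 1 := by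
    intro n n' x y q q' hx hy hxi hyi
    have e1 : ∀ᶠ N : ℕ in atTop, ∀ i j, x i + y j < N := by
      refine eventually_all.2 fun i => eventually_all.2 fun j => ?_
      filter_upwards [eventually_gt_atTop (x i + y j).toNat] with N hN
      omega
    have e2 : ∀ᶠ N : ℕ in atTop, ∀ i, x i ≤ N := by
      refine eventually_all.2 fun i => ?_
      filter_upwards [eventually_gt_atTop (x i).toNat] with N hN
      omega
    have e3 : ∀ᶠ N : ℕ in atTop, ∀ i, y i ≤ N := by
      refine eventually_all.2 fun i => ?_
      filter_upwards [eventually_gt_atTop (y i).toNat] with N hN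
      omega
    filter_upwards [e1, e2, e3] with N h1 h2 h3
    have hb : ∀ i, 0 ≤ oldPos x y N i ∧ oldPos x y N i < N := by
      rintro (i | i)
      · have := hx i; have := h2 i; simp only [oldPos, Sum.elim_inl]; omega
      · have := hy i; have := h3 i; simp only [oldPos, Sum.elim_inr]; omega
    have hxy : (Sum.elim x fun a => (N : ℤ) + 1 - y a) = fun i => oldPos x y N i + 1 := by
      funext i
      rcases i with i | i <;> simp only [oldPos, Sum.elim_inl, Sum.elim_inr] <;> ring
    have hinj : Function.Injective (oldPos x y N) := by
      rintro (i | i) (j | j) hij <;> simp only [oldPos, Sum.elim_inl, Sum.elim_inr] at hij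
      · rw [hxi (by linarith : x i = x j)]
      · have := h1 i j; omega
      · have := h1 j i; omega
      · rw [hyi (by linarith : y i = y j)]
    have hinj' : Function.Injective fun i => oldPos x y N i + 1 :=
      fun i j hij => hinj (by simpa using hij)
    set h : Fin n ⊕ Fin n' → Fin N := fun i => ⟨(oldPos x y N i).toNat, by
      have := hb i; omega⟩ with hh
    have hv : ∀ i, ((h i : ℕ) : ℤ) = oldPos x y N i := fun i => by
      have := hb i; simp only [hh]; omega
    refine ⟨h, fun i j hij => hinj (by rw [← hv, ← hv, hij]), hv, fun i => ?_, fun i hi => ?_⟩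
    · rw [hv, hxy, lacSeq, hinj'.extend_apply]
      rcases i with i | i <;> simp only [newPos, Sum.elim_inl, Sum.elim_inr] <;> ring
    · rw [hxy, lacSeq, Function.extend_apply' _ _ _, id]
      rintro ⟨j, hj⟩
      refine hi ⟨j, Fin.ext ?_⟩
      have := hv j
      have hj' : oldPos x y N j + 1 = (i : ℕ) + 1 := hj
      omega
  set Y := Matrix.fromBlocks
    (edgeBlocks (Matrix.of fun i j => edgePH (fun n => b (-n)) (fun n => b' (-n)) (pm i) (hm j))
        (Matrix.of fun i j => edgePH a a' (pp i) (hp j)))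
    (edgeBlocks (Matrix.of fun i j => edgePK (fun n => b (-n)) (fun n => a (-n)) (pm i) (km j))
        (Matrix.of fun i j => edgePK a b (pp i) (kp j)))
    (edgeBlocks (Matrix.of fun i j => edgeTH (fun n => b' (-n)) (fun n => a' (-n)) (tm i) (hm j))
        (Matrix.of fun i j => edgeTH a' b' (tp i) (hp j)))
    (edgeBlocks (Matrix.of fun i j => edgeTK (fun n => a (-n)) (fun n => a' (-n)) (tm i) (km j))
        (Matrix.of fun i j => edgeTK b b' (tp i) (kp j))) with hY
  have hYdet : Y.det = (edgeMatrix (fun n => b (-n)) (fun n => b' (-n)) (fun n => a (-n))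
      (fun n => a' (-n)) pm hm km tm).det * (edgeMatrix a a' b b' pp hp kp tp).det :=
    det_fromBlocks_edgeBlocks _ _ _ _ _ _ _ _
  set X : ℕ → Matrix ((Fin nm ⊕ Fin np) ⊕ (Fin rm ⊕ Fin rp))
      ((Fin nm ⊕ Fin np) ⊕ (Fin rm ⊕ Fin rp)) ℂ := fun N => Matrix.fromBlocks
    (Matrix.of fun i j => invForm f N (fun s => f (newPos pm pp N i - s))
      (unitVec (oldPos hm hp N j)))
    (Matrix.of fun i j => f (newPos pm pp N i - newPos km kp N j) -
      invForm f N (fun s => f (newPos pm pp N i - s)) (fun s => f (s - newPos km kp N j)))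
    (Matrix.of fun i j => -invForm f N (unitVec (oldPos tm tp N i)) (unitVec (oldPos hm hp N j)))
    (Matrix.of fun i j => invForm f N (unitVec (oldPos tm tp N i))
      (fun s => f (s - newPos km kp N j))) with hX
  have hXY : ∀ i j, IsBigONegInfty (fun N => X N i j - Y i j) := by
    rintro (i | i) (j | j)
    · exact W.asymptotics_ph pm_pos pp_pos hm_pos hp_pos i j
    · exact W.asymptotics_pk pm_pos pp_pos km_pos kp_pos i j
    · exact W.asymptotics_th tm_pos tp_pos hm_pos hp_pos i j
    · exact W.asymptotics_tk tm_pos tp_pos km_pos kp_pos i j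
  rw [← hYdet]
  refine (IsBigONegInfty.det_sub hXY).congr' ?_
  filter_upwards [W.eventually_isUnit_det_toep, hlac hm hp pm pp hm_pos hp_pos hm_inj hp_inj,
    hlac tm tp km kp tm_pos tp_pos tm_inj tp_inj] with N hT h1 h2
  obtain ⟨h, hi, hv, hl, hn⟩ := h1
  obtain ⟨t, ti, tv, tl, tn⟩ := h2
  congr 1
  -- The new rows and columns are given by the Toeplitz formula at all indices, including replaced
  -- ones; the values there do not affect the bordered determinant.
  rw [det_replace_rows_cols (toep f N) _ hT.1 hi ti
    (Matrix.of fun i j => f (newPos pm pp N i - (j : ℕ)))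
    (Matrix.of fun i j => f ((i : ℕ) - newPos km kp N j))
    (Matrix.of fun i j => f (newPos pm pp N i - newPos km kp N j))]
  · rw [mul_comm, ← mul_assoc, inv_mul_cancel₀ hT.1.ne_zero, one_mul]
    congr 1
    have hsel : ∀ {q q' : ℕ} (x : Fin q → ℤ) (y : Fin q' → ℤ) (g : Fin q ⊕ Fin q' → Fin N),
        (∀ i, ((g i : ℕ) : ℤ) = oldPos x y N i) → ∀ i j,
        selMatrix g i j = unitVec (oldPos x y N j) (i : ℕ) := by
      intro q q' x y g hg i j
      simp only [selMatrix, unitVec, Matrix.of_apply, ← hg, Fin.ext_iff, Nat.cast_inj]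
    have e1 : ∀ j, (fun i => selMatrix h i j) = fun i : Fin N => unitVec (oldPos hm hp N j) (i : ℕ) :=
      fun j => funext fun i => hsel hm hp h hv i j
    have e2 : ∀ j, (fun i => selMatrix t i j) = fun i : Fin N => unitVec (oldPos tm tp N j) (i : ℕ) :=
      fun j => funext fun i => hsel tm tp t tv i j
    have key : ∀ {o o' : Type} (G : Matrix o (Fin N) ℂ) (H : Matrix (Fin N) o' ℂ) (r v : ℤ → ℂ)
        (i : o) (j : o'), (∀ s : Fin N, G i s = r (s : ℕ)) → (∀ s : Fin N, H s j = v (s : ℕ)) →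
        (G * (toep f N)⁻¹ * H) i j = invForm f N r v := by
      intro o o' G H r v i j hG hH
      rw [Matrix.mul_assoc, Matrix.mul_apply, invForm]
      refine Finset.sum_congr rfl fun s _ => ?_
      rw [hG, Matrix.mul_apply, Matrix.mulVec, dotProduct]
      simp only [hH]
    rw [hX, borderMatrix]
    dsimp only
    congr 1
    · ext i j
      exact (key _ _ (fun s => f (newPos pm pp N i - s)) _ i j (fun s => rfl)
        (fun s => hsel hm hp h hv s j)).symm
    · ext i j
      rw [Matrix.sub_apply, key _ _ (fun s => f (newPos pm pp N i - s))
        (fun s => f (s - newPos km kp N j)) i j (fun s => rfl) (fun s => rfl)]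
      rfl
    · ext i j
      rw [Matrix.neg_apply, key _ _ _ _ i j (fun s => hsel tm tp t tv s i)
        (fun s => hsel hm hp h hv s j)]
      rfl
    · ext i j
      exact (key _ _ _ (fun s => f (s - newPos km kp N j)) i j
        (fun s => hsel tm tp t tv s i) (fun s => rfl)).symm
  · intro i j
    rw [Matrix.of_apply, hl, tl, Matrix.of_apply]
    congr 1; ring
  · intro i j hj
    rw [Matrix.of_apply, hl, tn j hj, Matrix.of_apply]
    congr 1; ring
  · intro i hi j
    rw [Matrix.of_apply, hn i hi, tl, Matrix.of_apply]
    congr 1; ring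
  · intro i hi j hj
    rw [Matrix.of_apply, hn i hi, tn j hj, toep, Matrix.of_apply]
    congr 1; ring

end WienerHopf

/-! ### Laurent coefficients of functions which are holomorphic near the unit circle -/

local notation "𝕊" => Metric.sphere (0 : ℂ) 1

/-- `g` is holomorphic on a neighbourhood of the unit circle. -/
def HolCircle (g : ℂ → ℂ) : Prop :=
  ∃ U : Set ℂ, IsOpen U ∧ 𝕊 ⊆ U ∧ DifferentiableOn ℂ g U

lemma HolCircle.continuousOn {g : ℂ → ℂ} (hg : HolCircle g) : ContinuousOn g 𝕊 := by
  obtain ⟨U, _, hU, hd⟩ := hg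
  exact hd.continuousOn.mono hU

lemma HolCircle.mul {g h : ℂ → ℂ} (hg : HolCircle g) (hh : HolCircle h) :
    HolCircle (fun z => g z * h z) := by
  obtain ⟨U, hU, hUs, hd⟩ := hg
  obtain ⟨V, hV, hVs, hd'⟩ := hh
  exact ⟨U ∩ V, hU.inter hV, Set.subset_inter hUs hVs,
    (hd.mono Set.inter_subset_left).mul (hd'.mono Set.inter_subset_right)⟩

lemma ne_zero_of_mem_sphere {z : ℂ} (hz : z ∈ 𝕊) : z ≠ 0 :=
  ne_zero_of_mem_unit_sphere ⟨z, hz⟩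

lemma holCircle_zpow (j : ℤ) : HolCircle (fun z => z ^ j) :=
  ⟨{0}ᶜ, isOpen_compl_singleton, fun _ hz => ne_zero_of_mem_sphere hz,
    fun _ hz => (differentiableAt_zpow.2 (Or.inl hz)).differentiableWithinAt⟩

lemma laurentCoeff_congr {g h : ℂ → ℂ} (H : Set.EqOn g h 𝕊) (n : ℤ) :
    laurentCoeff g n = laurentCoeff h n := by
  rw [laurentCoeff, laurentCoeff]
  congr 1
  exact circleIntegral.integral_congr zero_le_one fun z hz => by simp only [H hz]

lemma laurentCoeff_mul_zpow (g : ℂ → ℂ) (j n : ℤ) :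
    laurentCoeff (fun z => g z * z ^ j) n = laurentCoeff g (n - j) := by
  rw [laurentCoeff, laurentCoeff]
  congr 1
  refine circleIntegral.integral_congr zero_le_one fun z hz => ?_
  have hz0 := ne_zero_of_mem_sphere hz
  rw [show n - j + 1 = (n + 1) - j by ring, zpow_sub₀ hz0 (n + 1) j]
  field_simp

lemma two_pi_I_mul_laurentCoeff (g : ℂ → ℂ) (n : ℤ) :
    2 * (Real.pi : ℂ) * Complex.I * laurentCoeff g n = ∮ z in C(0, 1), g z / z ^ (n + 1) := by
  rw [laurentCoeff, mul_inv_cancel_left₀ Complex.two_pi_I_ne_zero]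

lemma laurentCoeff_one (n : ℤ) : laurentCoeff (fun _ => 1) n = if n = 0 then 1 else 0 := by
  have h : (∮ z in C(0, 1), (1 : ℂ) / z ^ (n + 1)) = ∮ z in C(0, 1), (z - 0) ^ (-(n + 1)) := by
    simp only [sub_zero, zpow_neg, one_div]
  rw [laurentCoeff, h]
  split_ifs with hn
  · subst hn
    have := circleIntegral.integral_sub_center_inv 0 (one_ne_zero : (1 : ℝ) ≠ 0)
    simp only [zero_add, zpow_neg_one]
    rw [this, inv_mul_cancel₀ Complex.two_pi_I_ne_zero]
  · rw [circleIntegral.integral_sub_zpow_of_ne (by omega), mul_zero]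

lemma laurentCoeff_eq_integral (g : ℂ → ℂ) (n : ℤ) :
    laurentCoeff g n = (2 * (Real.pi : ℂ))⁻¹ *
      ∫ θ in (0 : ℝ)..2 * Real.pi, g (circleMap 0 1 θ) * (circleMap 0 1 θ) ^ (-n) := by
  rw [laurentCoeff, circleIntegral, mul_inv, mul_assoc, ← intervalIntegral.integral_const_mul]
  congr 1
  refine intervalIntegral.integral_congr fun θ _ => ?_
  have h0 : circleMap 0 1 θ ≠ 0 := circleMap_ne_center one_ne_zero
  simp only [deriv_circleMap, smul_eq_mul]
  rw [zpow_add₀ h0, zpow_neg, zpow_one]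
  field_simp [Complex.I_ne_zero]

/-- Inversion of the unit circle is the change of variable `θ ↦ 2π - θ`. -/
lemma laurentCoeff_comp_inv (g : ℂ → ℂ) (n : ℤ) :
    laurentCoeff (fun z => g z⁻¹) n = laurentCoeff g (-n) := by
  rw [laurentCoeff_eq_integral, laurentCoeff_eq_integral]
  congr 1
  have h := intervalIntegral.integral_comp_sub_left (a := 0) (b := 2 * Real.pi)
    (fun θ => g (circleMap 0 1 θ) * (circleMap 0 1 θ) ^ (-(-n))) (2 * Real.pi)
  rw [sub_self, sub_zero] at h
  rw [← h]
  refine intervalIntegral.integral_congr fun θ _ => ?_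
  have h1 : circleMap 0 1 (2 * Real.pi - θ) = (circleMap 0 1 θ)⁻¹ := by
    simp only [circleMap, zero_add, Complex.ofReal_one, one_mul, ← Complex.exp_neg]
    rw [show ((2 * Real.pi - θ : ℝ) : ℂ) * Complex.I = -(θ * Complex.I) + 2 * Real.pi * Complex.I by
      push_cast; ring, Complex.exp_periodic]
  rw [h1, inv_zpow', neg_neg]

/-- Exponential decay of the Laurent coefficients. -/
lemma HolCircle.exists_bound {g : ℂ → ℂ} (hg : HolCircle g) :
    ∃ C ρ : ℝ, 1 ≤ C ∧ 0 < ρ ∧ ρ < 1 ∧ ∀ n : ℤ, ‖laurentCoeff g n‖ ≤ C * ρ ^ n.natAbs := by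
  obtain ⟨U, hU, hUs, hd⟩ := hg
  obtain ⟨δ', hδ', hsub'⟩ := (isCompact_sphere (0 : ℂ) 1).exists_cthickening_subset_open hU hUs
  -- The cap `1/2` keeps the annulus away from the pole of `z ^ (-(n + 1))` at `0`.
  set δ := min δ' (1 / 2) with hδdef
  have hδ : 0 < δ := by positivity
  have hδ1 : δ ≤ 1 / 2 := min_le_right _ _
  set A : Set ℂ := Metric.closedBall 0 (1 + δ) \ Metric.ball 0 (1 - δ) with hA
  have hAU : A ⊆ U := by
    intro z hz
    simp only [hA, Set.mem_sdiff, Metric.mem_closedBall, dist_zero_right, Metric.mem_ball,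
      not_lt] at hz
    have hz0 : 0 < ‖z‖ := by linarith [hz.2]
    -- The radial projection of `z` to the circle lies at distance `|‖z‖ - 1| ≤ δ`.
    refine hsub' (Metric.mem_cthickening_of_dist_le z (z / ‖z‖) δ' _ ?_ ?_)
    · simp [hz0.ne']
    · have : z - z / ‖z‖ = z / ‖z‖ * ((‖z‖ - 1 : ℝ) : ℂ) := by
        have : (‖z‖ : ℂ) ≠ 0 := by exact_mod_cast hz0.ne'
        push_cast; field_simp
      rw [dist_eq_norm, this, norm_mul, norm_div, Complex.norm_real, Complex.norm_real, norm_norm,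
        div_self hz0.ne', one_mul, Real.norm_eq_abs, abs_le]
      have := min_le_left δ' (1 / 2)
      constructor <;> linarith [hz.1, hz.2]
  have hAc : IsCompact A := (isCompact_closedBall _ _).diff Metric.isOpen_ball
  obtain ⟨B, hB⟩ := hAc.exists_bound_of_continuousOn (hd.continuousOn.mono hAU)
  have hint : ∀ (n : ℤ) (r R : ℝ), 1 - δ ≤ r → r ≤ R → R ≤ 1 + δ →
      (∮ z in C(0, R), g z / z ^ (n + 1)) = ∮ z in C(0, r), g z / z ^ (n + 1) := by
    intro n r R h1 h2 h3
    have hdz : ∀ z ∈ U, z ≠ 0 → DifferentiableAt ℂ (fun z => g z / z ^ (n + 1)) z := by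
      intro z hz hz0
      exact ((hd z hz).differentiableAt (hU.mem_nhds hz)).div
        (differentiableAt_zpow.2 (Or.inl hz0)) (zpow_ne_zero _ hz0)
    have hsub : Metric.closedBall 0 R \ Metric.ball 0 r ⊆ A :=
      Set.sdiff_subset_sdiff (Metric.closedBall_subset_closedBall h3) (Metric.ball_subset_ball h1)
    have hne : ∀ z ∈ A, z ≠ 0 := by
      rintro z ⟨_, hz⟩ rfl
      exact hz (Metric.mem_ball_self (by linarith))
    refine Complex.circleIntegral_eq_of_differentiable_on_annulus_off_countable (by linarith) h2
      Set.countable_empty ?_ ?_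
    · intro z hz
      exact (hdz z (hAU (hsub hz)) (hne z (hsub hz))).continuousAt.continuousWithinAt
    · rintro z ⟨hz, _⟩
      have : z ∈ A := hsub (Set.sdiff_subset_sdiff Metric.ball_subset_closedBall
        Metric.ball_subset_closedBall hz)
      exact hdz z (hAU this) (hne z this)
  have hbound : ∀ (n : ℤ) (r : ℝ), 1 - δ ≤ r → r ≤ 1 + δ →
      laurentCoeff g n = (2 * (Real.pi : ℂ) * Complex.I)⁻¹ • (∮ z in C(0, r), g z / z ^ (n + 1)) →
      ‖laurentCoeff g n‖ ≤ B * r ^ (-n) := by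
    intro n r h1 h2 h3
    have hr : 0 < r := by linarith
    rw [h3]
    refine (circleIntegral.norm_two_pi_i_inv_smul_integral_le_of_norm_le_const hr.le
      (C := B * r ^ (-(n + 1))) fun z hz => ?_).trans_eq ?_
    · have hzr : ‖z‖ = r := by simpa using hz
      rw [norm_div, norm_zpow, hzr, zpow_neg, div_eq_mul_inv]
      gcongr
      refine hB z ⟨?_, ?_⟩ <;> simp [hzr, h1, h2]
    · rw [neg_add, zpow_add₀ hr.ne', zpow_neg_one]
      field_simp
  have hB0 : 0 ≤ B := by
    refine (norm_nonneg _).trans (hB 1 ?_)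
    simp only [hA, Set.mem_sdiff, Metric.mem_closedBall, dist_zero_right, Metric.mem_ball, norm_one]
    constructor <;> linarith
  refine ⟨max B 1, (1 + δ)⁻¹, le_max_right _ _, by positivity, inv_lt_one_of_one_lt₀ (by linarith),
    fun n => ?_⟩
  -- The contour is pushed outwards for `n ≥ 0` and inwards for `n < 0`; the inner radius fits the
  -- same rate since `1 - δ ≤ (1 + δ)⁻¹`.
  have key : ‖laurentCoeff g n‖ ≤ B * ((1 + δ)⁻¹) ^ n.natAbs := by
    rcases le_or_gt 0 n with hn | hn
    · refine (hbound n (1 + δ) (by linarith) le_rfl ?_).trans_eq ?_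
      · rw [hint n 1 (1 + δ) (by linarith) (by linarith) le_rfl]; rfl
      · rw [← inv_zpow', ← zpow_natCast, Int.natAbs_of_nonneg hn]
    · refine (hbound n (1 - δ) le_rfl (by linarith) ?_).trans ?_
      · rw [← hint n (1 - δ) 1 le_rfl (by linarith) (by linarith)]; rfl
      · rw [show -n = (n.natAbs : ℤ) by omega, zpow_natCast]
        gcongr
        · linarith
        · rw [← one_div, le_div_iff₀ (by linarith)]
          nlinarith
  refine key.trans ?_
  gcongr
  exact le_max_left _ _

lemma summable_pow_natAbs {ρ : ℝ} (h0 : 0 < ρ) (h1 : ρ < 1) :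
    Summable fun n : ℤ => ρ ^ n.natAbs := by
  refine Summable.of_nat_of_neg ?_ ?_
  · simpa using summable_geometric_of_lt_one h0.le h1
  · simpa using summable_geometric_of_lt_one h0.le h1

lemma HolCircle.summable {g : ℂ → ℂ} (hg : HolCircle g) :
    Summable fun n => ‖laurentCoeff g n‖ := by
  obtain ⟨C, ρ, _, h0, h1, hb⟩ := hg.exists_bound
  exact ((summable_pow_natAbs h0 h1).mul_left C).of_nonneg_of_le (fun _ => norm_nonneg _) hb

/-- The Laurent series converges to the function on the unit circle. -/
lemma HolCircle.hasSum {g : ℂ → ℂ} (hg : HolCircle g) {z : ℂ} (hz : z ∈ 𝕊) :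
    HasSum (fun n : ℤ => laurentCoeff g n * z ^ n) (g z) := by
  have : Fact (0 < 2 * Real.pi) := ⟨Real.two_pi_pos⟩
  have hmem : ∀ x : AddCircle (2 * Real.pi), ((AddCircle.toCircle x : Circle) : ℂ) ∈ 𝕊 := fun x => by
    rw [mem_sphere_zero_iff_norm, Circle.norm_coe]
  set F : C(AddCircle (2 * Real.pi), ℂ) :=
    ⟨fun x => g (AddCircle.toCircle x : Circle), by
      refine hg.continuousOn.comp_continuous ?_ hmem
      exact continuous_subtype_val.comp AddCircle.continuous_toCircle⟩ with hF
  have hpi : (Real.pi : ℂ) ≠ 0 := by exact_mod_cast Real.pi_ne_zero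
  have hcm : ∀ θ : ℝ, ∀ n : ℤ, fourier n (θ : AddCircle (2 * Real.pi)) = circleMap 0 1 θ ^ n := by
    intro θ n
    rw [fourier_coe_apply, circleMap, zero_add, Complex.ofReal_one, one_mul, ← Complex.exp_int_mul]
    congr 1
    push_cast
    field_simp
  have hcm1 : ∀ θ : ℝ, ((AddCircle.toCircle (θ : AddCircle (2 * Real.pi)) : Circle) : ℂ) =
      circleMap 0 1 θ := by
    intro θ
    rw [← fourier_one, hcm, zpow_one]
  -- Laurent coefficients on the circle are Fourier coefficients in the angle; their summability
  -- gives pointwise convergence of the Fourier series.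
  have hco : ∀ n, fourierCoeff F n = laurentCoeff g n := by
    intro n
    rw [fourierCoeff_eq_intervalIntegral _ n 0, laurentCoeff_eq_integral, zero_add]
    rw [Complex.real_smul]
    push_cast
    rw [one_div]
    congr 1
    refine intervalIntegral.integral_congr fun θ _ => ?_
    simp only [hF, ContinuousMap.coe_mk, hcm, hcm1, smul_eq_mul]
    ring
  have hs : Summable (fourierCoeff F) := by
    rw [show fourierCoeff F = laurentCoeff g from funext hco]
    exact hg.summable.of_norm
  obtain ⟨θ, rfl⟩ : ∃ θ : ℝ, circleMap 0 1 θ = z := by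
    have := range_circleMap 0 1
    rw [abs_one] at this
    rwa [← this] at hz
  have := has_pointwise_sum_fourier_series_of_summable hs (θ : AddCircle (2 * Real.pi))
  simp only [hco, hcm, smul_eq_mul] at this
  convert! this using 1
  simp only [hF, ContinuousMap.coe_mk, hcm1]

/-- Termwise integration over the unit circle. -/
lemma hasSum_circleIntegral {ι : Type*} [Countable ι] {F : ι → ℂ → ℂ} {S : ℂ → ℂ} {u : ι → ℝ}
    (hu : Summable u) (hF : ∀ i, ContinuousOn (F i) 𝕊) (hb : ∀ i, ∀ z ∈ 𝕊, ‖F i z‖ ≤ u i)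
    (hS : ∀ z ∈ 𝕊, HasSum (fun i => F i z) (S z)) :
    HasSum (fun i => ∮ z in C(0, 1), F i z) (∮ z in C(0, 1), S z) := by
  have h1 := (tendstoUniformlyOn_tsum hu hb).tendsto_circleIntegral_of_continuousOn zero_le_one
    (Eventually.of_forall fun s => continuousOn_finsetSum s fun i _ => hF i)
  have h2 : (∮ z in C(0, 1), ∑' i, F i z) = ∮ z in C(0, 1), S z :=
    circleIntegral.integral_congr zero_le_one fun z hz => (hS z hz).tsum_eq
  rw [h2] at h1
  refine h1.congr fun s => ?_
  exact circleIntegral.integral_fun_sum fun i _ => (hF i).circleIntegrable zero_le_one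

lemma continuousOn_sphere_zpow (j : ℤ) : ContinuousOn (fun z : ℂ => z ^ j) 𝕊 :=
  (holCircle_zpow j).continuousOn

lemma norm_zpow_of_mem_sphere {z : ℂ} (hz : z ∈ 𝕊) (j : ℤ) : ‖z ^ j‖ = 1 := by
  have : ‖z‖ = 1 := by simpa using hz
  rw [norm_zpow, this, one_zpow]

lemma exists_norm_le_sphere {g : ℂ → ℂ} (hg : ContinuousOn g 𝕊) :
    ∃ B, 0 ≤ B ∧ ∀ z ∈ 𝕊, ‖g z‖ ≤ B := by
  obtain ⟨B, hB⟩ := (isCompact_sphere (0 : ℂ) 1).exists_bound_of_continuousOn hg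
  exact ⟨B, (norm_nonneg _).trans (hB 1 (by simp)), hB⟩

/-- Laurent coefficients of products. -/
lemma HolCircle.hasSum_conv {g h : ℂ → ℂ} (hg : HolCircle g) (hh : ContinuousOn h 𝕊) (i j : ℤ) :
    HasSum (fun k : ℤ => laurentCoeff g (i - k) * laurentCoeff h (k - j))
      (laurentCoeff (fun z => g z * h z) (i - j)) := by
  obtain ⟨B, hB0, hB⟩ := exists_norm_le_sphere hh
  set n := i - j with hn
  -- Only `g` is expanded in its Laurent series, so continuity of `h` suffices.
  have h1 := hasSum_circleIntegral
    (F := fun (k : ℤ) z => laurentCoeff g k * (h z / z ^ (n - k + 1)))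
    (S := fun z => g z * h z / z ^ (n + 1)) (u := fun k => ‖laurentCoeff g k‖ * B)
    (hg.summable.mul_right B) ?_ ?_ ?_
  · have h2 := h1.mul_left (2 * (Real.pi : ℂ) * Complex.I)⁻¹
    have h3 := (Equiv.subLeft i).hasSum_iff.2 h2
    convert! h3 using 1
    funext k
    simp only [Function.comp, Equiv.subLeft_apply, circleIntegral.integral_const_mul]
    rw [show n - (i - k) + 1 = k - j + 1 by rw [hn]; ring]
    rw [laurentCoeff, laurentCoeff]
    ring
  · intro k
    refine continuousOn_const.mul (hh.div (continuousOn_sphere_zpow _) fun z hz => ?_)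
    exact zpow_ne_zero _ (ne_zero_of_mem_sphere hz)
  · intro k z hz
    rw [norm_mul, norm_div, norm_zpow_of_mem_sphere hz, div_one]
    gcongr
    exact hB z hz
  · intro z hz
    have hz0 := ne_zero_of_mem_sphere hz
    have := (hg.hasSum hz).mul_right (h z / z ^ (n + 1))
    convert! this using 1
    · funext k
      rw [show n - k + 1 = (n + 1) - k by ring, zpow_sub₀ hz0]
      field_simp
    · ring

/-- Functions holomorphic on a disc of radius larger than one have no coefficients of negative
index. -/
lemma laurentCoeff_eq_zero_of_neg {g : ℂ → ℂ} {R : ℝ} (hR : 1 < R)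
    (hg : DifferentiableOn ℂ g (Metric.ball 0 R)) {n : ℤ} (hn : n < 0) :
    laurentCoeff g n = 0 := by
  rw [laurentCoeff]
  have h : (∮ z in C(0, 1), g z / z ^ (n + 1)) = ∮ z in C(0, 1), g z * z ^ (-n - 1).toNat := by
    refine circleIntegral.integral_congr zero_le_one fun z hz => ?_
    rw [← zpow_natCast, Int.toNat_of_nonneg (by omega), div_eq_mul_inv, ← zpow_neg]
    congr 2; ring
  have hsub : Metric.closedBall (0 : ℂ) 1 ⊆ Metric.ball 0 R := Metric.closedBall_subset_ball hR
  rw [h, Complex.circleIntegral_eq_zero_of_differentiable_on_off_countable zero_le_one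
    Set.countable_empty, mul_zero]
  · exact (hg.continuousOn.mono hsub).mul (continuous_pow _).continuousOn
  · rintro z ⟨hz, _⟩
    exact ((hg z (hsub (Metric.ball_subset_closedBall hz))).differentiableAt
      (Metric.isOpen_ball.mem_nhds (hsub (Metric.ball_subset_closedBall hz)))).mul
      (differentiableAt_pow _)

/-! ### The factors of the symbol -/

/-- The part of the Laurent series of `lnf` with nonnegative exponents. -/
def posPart (lnf : ℂ → ℂ) (z : ℂ) : ℂ := ∑' n : ℕ, laurentCoeff lnf n * z ^ n

/-- The part of the Laurent series of `lnf` with negative exponents, as a function of `z⁻¹`. -/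
def negPart (lnf : ℂ → ℂ) (w : ℂ) : ℂ := ∑' n : ℕ, laurentCoeff lnf (-((n : ℤ) + 1)) * w ^ (n + 1)

/-- The factor `1 / α₊` of the symbol. -/
def facA (lnf : ℂ → ℂ) (z : ℂ) : ℂ := Complex.exp (posPart lnf z)

/-- The inverse `α₊` of the first factor. -/
def facA' (lnf : ℂ → ℂ) (z : ℂ) : ℂ := Complex.exp (-posPart lnf z)

/-- The factor `α₋` of the symbol. -/
def facB (lnf : ℂ → ℂ) (z : ℂ) : ℂ := Complex.exp (negPart lnf z⁻¹)

/-- The inverse `1 / α₋` of the second factor. -/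
def facB' (lnf : ℂ → ℂ) (z : ℂ) : ℂ := Complex.exp (-negPart lnf z⁻¹)

lemma exists_differentiableOn_tsum {c : ℕ → ℂ} {C ρ : ℝ} (h0 : 0 < ρ) (h1 : ρ < 1)
    (hc : ∀ n, ‖c n‖ ≤ C * ρ ^ n) (s : ℕ) :
    ∃ R : ℝ, 1 < R ∧ DifferentiableOn ℂ (fun z => ∑' n, c n * z ^ (n + s)) (Metric.ball 0 R) := by
  -- On the disc of radius `σ⁻¹ > 1` the powers of `z` use up only half of the decay `ρ ^ n = σ ^
  -- (2n)`, leaving a geometric majorant.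
  set σ := Real.sqrt ρ with hσ
  have hσ0 : 0 < σ := Real.sqrt_pos.2 h0
  have hσ1 : σ < 1 := by rw [hσ, Real.sqrt_lt' one_pos, one_pow]; exact h1
  have hσ2 : σ ^ 2 = ρ := Real.sq_sqrt h0.le
  refine ⟨σ⁻¹, (one_lt_inv₀ hσ0).2 hσ1, ?_⟩
  refine Complex.differentiableOn_tsum_of_summable_norm (u := fun n => C * (σ⁻¹) ^ s * σ ^ n)
    ((summable_geometric_of_lt_one hσ0.le hσ1).mul_left _)
    (fun n => ((differentiable_id.pow _).const_mul _).differentiableOn) Metric.isOpen_ball ?_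
  intro n z hz
  have hz' : ‖z‖ ≤ σ⁻¹ := by simpa using (mem_ball_zero_iff.1 hz).le
  have hC : 0 ≤ C * ρ ^ n := (norm_nonneg _).trans (hc n)
  rw [norm_mul, norm_pow]
  calc ‖c n‖ * ‖z‖ ^ (n + s) ≤ (C * ρ ^ n) * (σ⁻¹) ^ (n + s) := by
        gcongr; exact hc n
    _ = C * (σ⁻¹) ^ s * σ ^ n := by
        rw [← hσ2, ← pow_mul, mul_comm 2 n, pow_mul, pow_add, inv_pow, inv_pow]
        field_simp

lemma HolCircle.exists_differentiableOn_parts {lnf : ℂ → ℂ} (h : HolCircle lnf) :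
    ∃ R : ℝ, 1 < R ∧ DifferentiableOn ℂ (posPart lnf) (Metric.ball 0 R) ∧
      DifferentiableOn ℂ (negPart lnf) (Metric.ball 0 R) := by
  obtain ⟨C, ρ, hC, h0, h1, hb⟩ := h.exists_bound
  obtain ⟨R, hR, hd⟩ := exists_differentiableOn_tsum (c := fun n : ℕ => laurentCoeff lnf n) h0 h1
    (fun n => by simpa using hb n) 0
  obtain ⟨R', hR', hd'⟩ := exists_differentiableOn_tsum
    (c := fun n : ℕ => laurentCoeff lnf (-((n : ℤ) + 1))) (C := C) h0 h1
    (fun n => (hb _).trans (by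
      gcongr ?_ * ?_
      exact pow_le_pow_of_le_one h0.le h1.le (by omega))) 1
  exact ⟨min R R', lt_min hR hR',
    hd.mono (Metric.ball_subset_ball (min_le_left _ _)),
    hd'.mono (Metric.ball_subset_ball (min_le_right _ _))⟩

lemma HolCircle.posPart_add_negPart {lnf : ℂ → ℂ} (h : HolCircle lnf) {z : ℂ} (hz : z ∈ 𝕊) :
    lnf z = posPart lnf z + negPart lnf z⁻¹ := by
  have hs := h.hasSum hz
  rw [← hs.tsum_eq, tsum_of_nat_of_neg_add_one]
  · simp only [posPart, negPart, zpow_natCast]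
    congr 1
    refine tsum_congr fun n => ?_
    rw [inv_pow, zpow_neg]
    norm_cast
  · exact hs.summable.comp_injective Nat.cast_injective
  · exact hs.summable.comp_injective (i := fun n : ℕ => -((n : ℤ) + 1)) fun a b hab => by
      simp only at hab; omega

lemma holCircle_of_ball {g : ℂ → ℂ} {R : ℝ} (hR : 1 < R)
    (hg : DifferentiableOn ℂ g (Metric.ball 0 R)) : HolCircle g :=
  ⟨_, Metric.isOpen_ball, Metric.sphere_subset_closedBall.trans (Metric.closedBall_subset_ball hR),
    hg⟩

lemma holCircle_comp_inv_of_ball {g : ℂ → ℂ} {R : ℝ} (hR : 1 < R)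
    (hg : DifferentiableOn ℂ g (Metric.ball 0 R)) : HolCircle (fun z => g z⁻¹) := by
  have hR0 : 0 < R := zero_lt_one.trans hR
  refine ⟨{z | R⁻¹ < ‖z‖}, isOpen_lt continuous_const continuous_norm, ?_, ?_⟩
  · intro z hz
    have : ‖z‖ = 1 := by simpa using hz
    simp only [Set.mem_ofPred_eq, this]
    exact inv_lt_one_of_one_lt₀ hR
  · have h0 : ∀ z ∈ {z : ℂ | R⁻¹ < ‖z‖}, z ≠ 0 := by
      rintro z hz rfl
      have hz' : R⁻¹ < ‖(0 : ℂ)‖ := hz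
      rw [norm_zero] at hz'
      exact absurd hz' (inv_pos.2 hR0).le.not_gt
    refine hg.comp (fun z hz => (differentiableAt_inv (h0 z hz)).differentiableWithinAt) ?_
    intro z hz
    have hz' : R⁻¹ < ‖z‖ := hz
    rw [mem_ball_zero_iff, norm_inv]
    exact inv_lt_of_inv_lt₀ hR0 hz'

section

variable {lnf : ℂ → ℂ} (h : HolCircle lnf)
include h

lemma HolCircle.exists_differentiableOn_facA :
    ∃ R : ℝ, 1 < R ∧ DifferentiableOn ℂ (facA lnf) (Metric.ball 0 R) ∧
      DifferentiableOn ℂ (facA' lnf) (Metric.ball 0 R) ∧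
      DifferentiableOn ℂ (fun w => Complex.exp (negPart lnf w)) (Metric.ball 0 R) ∧
      DifferentiableOn ℂ (fun w => Complex.exp (-negPart lnf w)) (Metric.ball 0 R) := by
  obtain ⟨R, hR, h1, h2⟩ := h.exists_differentiableOn_parts
  exact ⟨R, hR, h1.cexp, h1.neg.cexp, h2.cexp, h2.neg.cexp⟩

lemma HolCircle.facA : HolCircle (facA lnf) := by
  obtain ⟨R, hR, h1, _⟩ := h.exists_differentiableOn_facA
  exact holCircle_of_ball hR h1

lemma HolCircle.facA' : HolCircle (facA' lnf) := by
  obtain ⟨R, hR, _, h1, _⟩ := h.exists_differentiableOn_facA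
  exact holCircle_of_ball hR h1

lemma HolCircle.facB : HolCircle (facB lnf) := by
  obtain ⟨R, hR, _, _, h1, _⟩ := h.exists_differentiableOn_facA
  exact holCircle_comp_inv_of_ball hR h1

lemma HolCircle.facB' : HolCircle (facB' lnf) := by
  obtain ⟨R, hR, _, _, _, h1⟩ := h.exists_differentiableOn_facA
  exact holCircle_comp_inv_of_ball hR h1

omit h in
lemma exists_common_bound {c : Fin 5 → ℤ → ℂ}
    (hc : ∀ i, ∃ C ρ : ℝ, 1 ≤ C ∧ 0 < ρ ∧ ρ < 1 ∧ ∀ n : ℤ, ‖c i n‖ ≤ C * ρ ^ n.natAbs) :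
    ∃ C ρ : ℝ, 1 ≤ C ∧ 0 < ρ ∧ ρ < 1 ∧ ∀ i, ∀ n : ℤ, ‖c i n‖ ≤ C * ρ ^ n.natAbs := by
  choose C ρ hC h0 h1 hb using hc
  obtain ⟨i, _, hi⟩ := Finset.exists_max_image Finset.univ C Finset.univ_nonempty
  obtain ⟨j, _, hj⟩ := Finset.exists_max_image Finset.univ ρ Finset.univ_nonempty
  refine ⟨C i, ρ j, hC i, h0 j, h1 j, fun k n => (hb k n).trans ?_⟩
  have := hi k (Finset.mem_univ _)
  have := hj k (Finset.mem_univ _)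
  have := h0 k
  have hC0 : 0 ≤ C i := zero_le_one.trans (hC i)
  gcongr

/-- The Wiener-Hopf factorisation of the Laurent coefficients of `exp lnf`. -/
theorem HolCircle.exists_wienerHopf {f : ℂ → ℂ} (hf : HolCircle f)
    (hexp : ∀ z ∈ 𝕊, Complex.exp (lnf z) = f z) :
    ∃ ρ C : ℝ, WienerHopf ρ C (laurentCoeff (LacunaryToeplitz.facA lnf))
      (laurentCoeff (LacunaryToeplitz.facA' lnf)) (laurentCoeff (LacunaryToeplitz.facB lnf))
      (laurentCoeff (LacunaryToeplitz.facB' lnf)) (laurentCoeff f) := by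
  obtain ⟨C, ρ, hC, h0, h1, hb⟩ := exists_common_bound
    (c := ![laurentCoeff (LacunaryToeplitz.facA lnf), laurentCoeff (LacunaryToeplitz.facA' lnf),
      laurentCoeff (LacunaryToeplitz.facB lnf), laurentCoeff (LacunaryToeplitz.facB' lnf),
      laurentCoeff f]) (by
      intro i
      fin_cases i
      exacts [h.facA.exists_bound, h.facA'.exists_bound, h.facB.exists_bound,
        h.facB'.exists_bound, hf.exists_bound])
  obtain ⟨R, hR, d1, d2, d3, d4⟩ := h.exists_differentiableOn_facA
  have hone : ∀ {g g' : ℂ → ℂ}, HolCircle g → HolCircle g' → (∀ z ∈ 𝕊, g z * g' z = 1) →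
      ∀ i j : ℤ, HasSum (fun k : ℤ => laurentCoeff g (i - k) * laurentCoeff g' (k - j))
        (if i = j then 1 else 0) := by
    intro g g' hg hg' hgg i j
    have := hg.hasSum_conv hg'.continuousOn i j
    rw [laurentCoeff_congr (h := fun _ => 1) (fun z hz => hgg z hz), laurentCoeff_one] at this
    simpa only [sub_eq_zero] using this
  refine ⟨ρ, C, h0, h1, hC, fun n hn => laurentCoeff_eq_zero_of_neg hR d1 hn,
    fun n hn => laurentCoeff_eq_zero_of_neg hR d2 hn, fun n hn => ?_, fun n hn => ?_,
    hb 0, hb 1, hb 2, hb 3, hb 4, hone h.facA h.facA' fun z _ => ?_,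
    hone h.facB h.facB' fun z _ => ?_, fun i j => ?_⟩
  · exact (laurentCoeff_comp_inv (fun w => Complex.exp (negPart lnf w)) n).trans
      (laurentCoeff_eq_zero_of_neg hR d3 (by omega))
  · exact (laurentCoeff_comp_inv (fun w => Complex.exp (-negPart lnf w)) n).trans
      (laurentCoeff_eq_zero_of_neg hR d4 (by omega))
  · rw [LacunaryToeplitz.facA, LacunaryToeplitz.facA', ← Complex.exp_add, add_neg_cancel,
      Complex.exp_zero]
  · rw [LacunaryToeplitz.facB, LacunaryToeplitz.facB', ← Complex.exp_add, add_neg_cancel,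
      Complex.exp_zero]
  · have := h.facA.hasSum_conv h.facB.continuousOn i j
    rwa [laurentCoeff_congr (h := f) fun z hz => ?_] at this
    simp only [LacunaryToeplitz.facA, LacunaryToeplitz.facB, ← Complex.exp_add]
    rw [← h.posPart_add_negPart hz, hexp z hz]

/-! ### Boundary values -/

/-- Inside the disc `alpha` coincides with `facA'`, which is holomorphic across the circle; its
boundary value is the value of that continuation. Outside, `facB` plays the same role. -/
lemma HolCircle.tendsto_alpha_inside {z : ℂ} (hz : z ∈ 𝕊) :
    Tendsto (alpha lnf) (𝓝[Metric.ball 0 1] z) (𝓝 (LacunaryToeplitz.facA' lnf z)) := by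
  obtain ⟨R, hR, _, d2, _⟩ := h.exists_differentiableOn_facA
  have hzR : z ∈ Metric.ball (0 : ℂ) R :=
    Metric.closedBall_subset_ball hR (Metric.sphere_subset_closedBall hz)
  have hc : ContinuousAt (LacunaryToeplitz.facA' lnf) z :=
    d2.continuousOn.continuousAt (Metric.isOpen_ball.mem_nhds hzR)
  refine (hc.tendsto.mono_left nhdsWithin_le_nhds).congr' ?_
  filter_upwards [self_mem_nhdsWithin] with w hw
  rw [alpha, if_pos (mem_ball_zero_iff.1 hw)]
  rfl

lemma HolCircle.tendsto_alpha_outside {z : ℂ} (hz : z ∈ 𝕊) :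
    Tendsto (alpha lnf) (𝓝[(Metric.closedBall 0 1)ᶜ] z) (𝓝 (LacunaryToeplitz.facB lnf z)) := by
  obtain ⟨U, hU, hUs, hd⟩ := h.facB
  have hc : ContinuousAt (LacunaryToeplitz.facB lnf) z :=
    hd.continuousOn.continuousAt (hU.mem_nhds (hUs hz))
  refine (hc.tendsto.mono_left nhdsWithin_le_nhds).congr' ?_
  filter_upwards [self_mem_nhdsWithin] with w hw
  have hw' : ¬ ‖w‖ < 1 := by
    simp only [Set.mem_compl_iff, mem_closedBall_zero_iff, not_le] at hw
    exact hw.le.not_gt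
  rw [alpha, if_neg hw', LacunaryToeplitz.facB, negPart]
  congr 1
  refine tsum_congr fun n => ?_
  rw [inv_pow, zpow_neg]
  norm_cast

lemma HolCircle.alphaPlus_eq {z : ℂ} (hz : z ∈ 𝕊) :
    alphaPlus lnf z = LacunaryToeplitz.facA' lnf z := by
  have : (𝓝[Metric.ball (0 : ℂ) 1] z).NeBot := by
    rw [← mem_closure_iff_nhdsWithin_neBot, closure_ball _ one_ne_zero]
    exact Metric.sphere_subset_closedBall hz
  exact (h.tendsto_alpha_inside hz).limUnder_eq

lemma HolCircle.alphaMinus_eq {z : ℂ} (hz : z ∈ 𝕊) :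
    alphaMinus lnf z = LacunaryToeplitz.facB lnf z := by
  have : (𝓝[(Metric.closedBall (0 : ℂ) 1)ᶜ] z).NeBot := by
    rw [← mem_closure_iff_nhdsWithin_neBot, closure_compl, interior_closedBall _ one_ne_zero]
    intro hz'
    rw [mem_ball_zero_iff] at hz'
    have : ‖z‖ = 1 := by simpa using hz
    linarith
  exact (h.tendsto_alpha_outside hz).limUnder_eq

end

/-! ### Double integrals with a shifted pole -/

lemma shift_ne_zero {x : ℝ} (hx0 : 0 < x) (hx : x ≠ 1) {z s : ℂ} (hz : z ∈ 𝕊) (hs : s ∈ 𝕊) :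
    z * (x : ℂ) - s ≠ 0 := by
  intro h
  have h1 : ‖z * (x : ℂ)‖ = ‖s‖ := by rw [sub_eq_zero.1 h]
  rw [mem_sphere_zero_iff_norm] at hz hs
  rw [norm_mul, hz, hs, one_mul, Complex.norm_real, Real.norm_of_nonneg hx0.le] at h1
  exact hx h1

lemma shiftedInt_congr {x : ℝ} {F G : ℂ → ℂ → ℂ} (h : ∀ z ∈ 𝕊, ∀ s ∈ 𝕊, F z s = G z s) :
    shiftedInt x F = shiftedInt x G := by
  rw [shiftedInt, shiftedInt]
  congr 1
  refine circleIntegral.integral_congr zero_le_one fun z hz => ?_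
  exact circleIntegral.integral_congr zero_le_one fun s hs => by rw [h z hz s hs]

/-- The regularised double integrals of `F` converge to `L` when `η → 0⁺`; the integrands are
regular enough for sums to be integrated term by term. -/
structure ShiftLim (x : ℝ → ℝ) (F : ℂ → ℂ → ℂ) (L : ℂ) : Prop where
  ne : ∀ᶠ η in 𝓝[>] (0 : ℝ), 0 < x η ∧ x η ≠ 1
  cont : ∀ z ∈ 𝕊, ContinuousOn (F z) 𝕊
  inner : ∀ᶠ η in 𝓝[>] (0 : ℝ),
    ContinuousOn (fun z => ∮ s in C(0, 1), F z s / (z * (x η : ℂ) - s)) 𝕊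
  tend : Tendsto (fun η => shiftedInt (x η) F) (𝓝[>] 0) (𝓝 L)

namespace ShiftLim

variable {x : ℝ → ℝ} {F G : ℂ → ℂ → ℂ} {L M : ℂ}

lemma congr (h : ShiftLim x F L) (hFG : ∀ z ∈ 𝕊, ∀ s ∈ 𝕊, G z s = F z s) : ShiftLim x G L where
  ne := h.ne
  cont z hz := (h.cont z hz).congr (hFG z hz)
  inner := by
    filter_upwards [h.inner] with η hη
    refine hη.congr fun z hz => ?_
    exact circleIntegral.integral_congr zero_le_one fun s hs => by rw [hFG z hz s hs]
  tend := h.tend.congr fun η => (shiftedInt_congr hFG).symm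

lemma circleIntegrable (h : ShiftLim x F L) {y : ℝ} (hy : 0 < y ∧ y ≠ 1) {z : ℂ} (hz : z ∈ 𝕊) :
    CircleIntegrable (fun s => F z s / (z * (y : ℂ) - s)) 0 1 := by
  refine ContinuousOn.circleIntegrable zero_le_one ((h.cont z hz).div (by fun_prop) fun s hs => ?_)
  exact shift_ne_zero hy.1 hy.2 hz hs

lemma add (h : ShiftLim x F L) (h' : ShiftLim x G M) :
    ShiftLim x (fun z s => F z s + G z s) (L + M) := by
  have key : ∀ η, (0 < x η ∧ x η ≠ 1) → ∀ z ∈ 𝕊,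
      (∮ s in C(0, 1), (F z s + G z s) / (z * (x η : ℂ) - s)) =
      (∮ s in C(0, 1), F z s / (z * (x η : ℂ) - s)) +
        ∮ s in C(0, 1), G z s / (z * (x η : ℂ) - s) := by
    intro η hη z hz
    rw [← circleIntegral.integral_add (h.circleIntegrable hη hz) (h'.circleIntegrable hη hz)]
    simp only [add_div]
  refine ⟨h.ne, fun z hz => (h.cont z hz).add (h'.cont z hz), ?_, ?_⟩
  · filter_upwards [h.ne, h.inner, h'.inner] with η h1 h2 h3
    exact (h2.add h3).congr (key η h1)
  · refine (h.tend.add h'.tend).congr' ?_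
    filter_upwards [h.ne, h.inner, h'.inner] with η h1 h2 h3
    rw [shiftedInt, shiftedInt, shiftedInt, ← mul_add]
    congr 1
    rw [← circleIntegral.integral_add (h2.circleIntegrable zero_le_one)
      (h3.circleIntegrable zero_le_one)]
    exact (circleIntegral.integral_congr zero_le_one (key η h1)).symm

lemma const_mul (h : ShiftLim x F L) (c : ℂ) : ShiftLim x (fun z s => c * F z s) (c * L) := by
  have key : ∀ η z, (∮ s in C(0, 1), c * F z s / (z * (x η : ℂ) - s)) =
      c * ∮ s in C(0, 1), F z s / (z * (x η : ℂ) - s) := by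
    intro η z
    rw [← circleIntegral.integral_const_mul]
    simp only [mul_div_assoc]
  refine ⟨h.ne, fun z hz => continuousOn_const.mul (h.cont z hz), ?_, ?_⟩
  · filter_upwards [h.inner] with η h2
    simp only [key]
    exact continuousOn_const.mul h2
  · refine (h.tend.const_mul c).congr fun η => ?_
    simp only [shiftedInt, key, circleIntegral.integral_const_mul]
    ring

end ShiftLim

/-- Since `|z q| < |s|`, the kernel expands as `1/(z q - s) = -∑ (z q)^m / s^(m+1)`. -/
lemma hasSum_inner_lt {q : ℝ} (h0 : 0 < q) (h1 : q < 1) {H : ℂ → ℂ} (hH : ContinuousOn H 𝕊)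
    {z : ℂ} (hz : z ∈ 𝕊) :
    HasSum (fun m : ℕ => -((2 * (Real.pi : ℂ) * Complex.I * laurentCoeff H m) * (z * q) ^ m))
      (∮ s in C(0, 1), H s / (z * (q : ℂ) - s)) := by
  obtain ⟨B, hB0, hB⟩ := exists_norm_le_sphere hH
  have hzn : ‖z‖ = 1 := mem_sphere_zero_iff_norm.1 hz
  have hzq : ‖z * (q : ℂ)‖ = q := by
    rw [norm_mul, hzn, one_mul, Complex.norm_real, Real.norm_of_nonneg h0.le]
  have h := hasSum_circleIntegral (F := fun (m : ℕ) s => -(z * q) ^ m * (H s / s ^ ((m : ℤ) + 1)))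
    (S := fun s => H s / (z * (q : ℂ) - s)) (u := fun m => q ^ m * B)
    ((summable_geometric_of_lt_one h0.le h1).mul_right B) ?_ ?_ ?_
  · convert! h using 1
    funext m
    rw [two_pi_I_mul_laurentCoeff, circleIntegral.integral_const_mul]
    ring
  · intro m
    refine continuousOn_const.mul (hH.div (continuousOn_sphere_zpow _) fun s hs => ?_)
    exact zpow_ne_zero _ (ne_zero_of_mem_sphere hs)
  · intro m s hs
    rw [norm_mul, norm_neg, norm_pow, hzq, norm_div, norm_zpow_of_mem_sphere hs, div_one]
    gcongr
    exact hB s hs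
  · intro s hs
    have hs0 := ne_zero_of_mem_sphere hs
    have hsn : ‖s‖ = 1 := mem_sphere_zero_iff_norm.1 hs
    have hr : ‖z * (q : ℂ) / s‖ < 1 := by rw [norm_div, hzq, hsn, div_one]; exact h1
    have hg := (hasSum_geometric_of_norm_lt_one hr).mul_left (-(H s / s))
    have hne := shift_ne_zero h0 h1.ne hz hs
    convert! hg using 1
    · funext m
      rw [zpow_add₀ hs0, zpow_natCast, zpow_one, div_pow]
      field_simp
    · have : 1 - z * (q : ℂ) / s = -(z * q - s) / s := by field_simp; ring
      rw [this]
      field_simp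

/-- Since `|z q| > |s|`, the kernel expands as `1/(z q - s) = ∑ s^m / (z q)^(m+1)`. -/
lemma hasSum_inner_gt {q : ℝ} (h1 : 1 < q) {H : ℂ → ℂ} (hH : ContinuousOn H 𝕊)
    {z : ℂ} (hz : z ∈ 𝕊) :
    HasSum (fun m : ℕ => (2 * (Real.pi : ℂ) * Complex.I * laurentCoeff H (-((m : ℤ) + 1))) *
      ((z * q)⁻¹) ^ (m + 1)) (∮ s in C(0, 1), H s / (z * (q : ℂ) - s)) := by
  have h0 : 0 < q := zero_lt_one.trans h1
  obtain ⟨B, hB0, hB⟩ := exists_norm_le_sphere hH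
  have hzn : ‖z‖ = 1 := mem_sphere_zero_iff_norm.1 hz
  have hz0 := ne_zero_of_mem_sphere hz
  have hq0 : (q : ℂ) ≠ 0 := by exact_mod_cast h0.ne'
  have hzq : ‖(z * (q : ℂ))⁻¹‖ = q⁻¹ := by
    rw [norm_inv, norm_mul, hzn, one_mul, Complex.norm_real, Real.norm_of_nonneg h0.le]
  have h := hasSum_circleIntegral
    (F := fun (m : ℕ) s => ((z * q)⁻¹) ^ (m + 1) * (H s / s ^ (-((m : ℤ) + 1) + 1)))
    (S := fun s => H s / (z * (q : ℂ) - s)) (u := fun m => (q⁻¹) ^ (m + 1) * B) ?_ ?_ ?_ ?_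
  · convert! h using 1
    funext m
    rw [two_pi_I_mul_laurentCoeff, circleIntegral.integral_const_mul]
    ring
  · refine Summable.mul_right B ?_
    exact (summable_nat_add_iff 1).2 (summable_geometric_of_lt_one (by positivity)
      (inv_lt_one_of_one_lt₀ h1))
  · intro m
    refine continuousOn_const.mul (hH.div (continuousOn_sphere_zpow _) fun s hs => ?_)
    exact zpow_ne_zero _ (ne_zero_of_mem_sphere hs)
  · intro m s hs
    rw [norm_mul, norm_pow, hzq, norm_div, norm_zpow_of_mem_sphere hs, div_one]
    gcongr
    exact hB s hs
  · intro s hs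
    have hs0 := ne_zero_of_mem_sphere hs
    have hsn : ‖s‖ = 1 := mem_sphere_zero_iff_norm.1 hs
    have hr : ‖s * (z * (q : ℂ))⁻¹‖ < 1 := by
      rw [norm_mul, hzq, hsn, one_mul]; exact inv_lt_one_of_one_lt₀ h1
    have hg := (hasSum_geometric_of_norm_lt_one hr).mul_left (H s * (z * q)⁻¹)
    have hne := shift_ne_zero h0 h1.ne' hz hs
    convert! hg using 1
    · funext m
      rw [show -((m : ℤ) + 1) + 1 = -(m : ℤ) by ring, zpow_neg, zpow_natCast, mul_pow, div_inv_eq_mul]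
      ring
    · have : 1 - s * (z * (q : ℂ))⁻¹ = (z * q - s) * (z * q)⁻¹ := by field_simp
      rw [this]
      field_simp

lemma norm_laurentCoeff_le {g : ℂ → ℂ} {B : ℝ} (hB : ∀ z ∈ 𝕊, ‖g z‖ ≤ B) (n : ℤ) :
    ‖laurentCoeff g n‖ ≤ B := by
  rw [laurentCoeff, ← smul_eq_mul]
  refine (circleIntegral.norm_two_pi_i_inv_smul_integral_le_of_norm_le_const zero_le_one
    (C := B) fun z hz => ?_).trans_eq (one_mul B)
  rw [norm_div, norm_zpow_of_mem_sphere hz, div_one]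
  exact hB z hz

/-- Integration of `G` against a series which converges uniformly on the circle. -/
lemma hasSum_outer {G K : ℂ → ℂ} (hG : ContinuousOn G 𝕊) {c : ℕ → ℂ} {u : ℕ → ℝ} (hu : Summable u)
    (hc : ∀ m, ‖c m‖ ≤ u m) {e : ℕ → ℤ} (hK : ∀ z ∈ 𝕊, HasSum (fun m => c m * z ^ e m) (K z)) :
    ContinuousOn K 𝕊 ∧ HasSum (fun m => c m * (2 * (Real.pi : ℂ) * Complex.I *
      laurentCoeff G (-e m - 1))) (∮ z in C(0, 1), G z * K z) := by
  obtain ⟨B, hB0, hB⟩ := exists_norm_le_sphere hG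
  constructor
  · have := continuousOn_tsum (f := fun m z => c m * z ^ e m) (s := 𝕊)
      (fun m => continuousOn_const.mul (continuousOn_sphere_zpow _)) hu fun m z hz => by
        rw [norm_mul, norm_zpow_of_mem_sphere hz, mul_one]; exact hc m
    exact this.congr fun z hz => (hK z hz).tsum_eq.symm
  · have h := hasSum_circleIntegral (F := fun m z => c m * (G z / z ^ (-e m - 1 + 1)))
      (S := fun z => G z * K z) (u := fun m => u m * B) (hu.mul_right B) ?_ ?_ ?_
    · convert! h using 1
      funext m
      rw [two_pi_I_mul_laurentCoeff, circleIntegral.integral_const_mul]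
    · intro m
      refine continuousOn_const.mul (hG.div (continuousOn_sphere_zpow _) fun s hs => ?_)
      exact zpow_ne_zero _ (ne_zero_of_mem_sphere hs)
    · intro m z hz
      rw [norm_mul, norm_div, norm_zpow_of_mem_sphere hz, div_one]
      exact mul_le_mul (hc m) (hB z hz) (norm_nonneg _) ((norm_nonneg _).trans (hc m))
    · intro z hz
      convert! (hK z hz).mul_left (G z) using 1
      funext m
      rw [sub_add_cancel, zpow_neg, div_inv_eq_mul]
      ring

lemma shiftedInt_sep (x : ℝ) (G H : ℂ → ℂ) :
    shiftedInt x (fun z s => G z * H s) = ((2 * (Real.pi : ℂ) * Complex.I) ^ 2)⁻¹ *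
      ∮ z in C(0, 1), G z * ∮ s in C(0, 1), H s / (z * (x : ℂ) - s) := by
  simp only [shiftedInt, mul_div_assoc, circleIntegral.integral_const_mul]

lemma shiftedInt_lt {q : ℝ} (h0 : 0 < q) (h1 : q < 1) {G H : ℂ → ℂ} (hG : ContinuousOn G 𝕊)
    (hH : ContinuousOn H 𝕊) :
    ContinuousOn (fun z => ∮ s in C(0, 1), H s / (z * (q : ℂ) - s)) 𝕊 ∧
    HasSum (fun m : ℕ => -((q : ℂ) ^ m * (laurentCoeff G (-m - 1) * laurentCoeff H m)))
      (shiftedInt q (fun z s => G z * H s)) := by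
  obtain ⟨B, hB0, hB⟩ := exists_norm_le_sphere hH
  have h := hasSum_outer (K := fun z => ∮ s in C(0, 1), H s / (z * (q : ℂ) - s)) hG
    (c := fun m : ℕ => -((2 * (Real.pi : ℂ) * Complex.I * laurentCoeff H m) * (q : ℂ) ^ m))
    (u := fun m => ‖2 * (Real.pi : ℂ) * Complex.I‖ * B * q ^ m) (e := fun m => (m : ℤ))
    ((summable_geometric_of_lt_one h0.le h1).mul_left _) ?_ ?_
  · refine ⟨h.1, ?_⟩
    rw [shiftedInt_sep]
    convert! h.2.mul_left ((2 * (Real.pi : ℂ) * Complex.I) ^ 2)⁻¹ using 1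
    funext m
    have := Complex.two_pi_I_ne_zero
    field_simp
  · intro m
    rw [norm_neg, norm_mul, norm_mul, norm_pow, Complex.norm_real, Real.norm_of_nonneg h0.le]
    gcongr
    exact norm_laurentCoeff_le hB _
  · intro z hz
    convert! hasSum_inner_lt h0 h1 hH hz using 1
    funext m
    rw [zpow_natCast, mul_pow]
    ring

lemma shiftedInt_gt {q : ℝ} (h1 : 1 < q) {G H : ℂ → ℂ} (hG : ContinuousOn G 𝕊)
    (hH : ContinuousOn H 𝕊) :
    ContinuousOn (fun z => ∮ s in C(0, 1), H s / (z * (q : ℂ) - s)) 𝕊 ∧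
    HasSum (fun m : ℕ => ((q : ℂ)⁻¹) ^ (m + 1) * (laurentCoeff G m *
      laurentCoeff H (-m - 1))) (shiftedInt q (fun z s => G z * H s)) := by
  have h0 : 0 < q := zero_lt_one.trans h1
  obtain ⟨B, hB0, hB⟩ := exists_norm_le_sphere hH
  have h := hasSum_outer (K := fun z => ∮ s in C(0, 1), H s / (z * (q : ℂ) - s)) hG
    (c := fun m : ℕ => (2 * (Real.pi : ℂ) * Complex.I * laurentCoeff H (-((m : ℤ) + 1))) *
      ((q : ℂ)⁻¹) ^ (m + 1))
    (u := fun m => ‖2 * (Real.pi : ℂ) * Complex.I‖ * B * (q⁻¹) ^ (m + 1))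
    (e := fun m => -((m : ℤ) + 1)) ?_ ?_ ?_
  · refine ⟨h.1, ?_⟩
    rw [shiftedInt_sep]
    convert! h.2.mul_left ((2 * (Real.pi : ℂ) * Complex.I) ^ 2)⁻¹ using 1
    funext m
    have := Complex.two_pi_I_ne_zero
    rw [show -(-((m : ℤ) + 1)) - 1 = m by ring, show -((m : ℤ) + 1) = -m - 1 by ring]
    field_simp
  · refine Summable.mul_left _ ?_
    exact (summable_nat_add_iff 1).2 (summable_geometric_of_lt_one (by positivity)
      (inv_lt_one_of_one_lt₀ h1))
  · intro m
    rw [norm_mul, norm_mul, norm_pow, norm_inv, Complex.norm_real, Real.norm_of_nonneg h0.le]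
    gcongr
    exact norm_laurentCoeff_le hB _
  · intro z hz
    convert! hasSum_inner_gt h1 hH hz using 1
    funext m
    rw [mul_inv, mul_pow, zpow_neg, inv_pow z]
    norm_cast
    ring

lemma summable_laurentCoeff_mul {G H : ℂ → ℂ} (hG : HolCircle G) (hH : ContinuousOn H 𝕊)
    {e e' : ℕ → ℤ} (he : Function.Injective e) :
    Summable fun m : ℕ => ‖laurentCoeff G (e m) * laurentCoeff H (e' m)‖ := by
  obtain ⟨B, hB0, hB⟩ := exists_norm_le_sphere hH
  refine ((hG.summable.comp_injective he).mul_right B).of_nonneg_of_le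
    (fun _ => norm_nonneg _) fun m => ?_
  rw [norm_mul]
  exact mul_le_mul_of_nonneg_left (norm_laurentCoeff_le hB _) (norm_nonneg _)

/-- The geometric expansion writes the integral as a series weighted by `(1 - η)^m`. The
coefficients of `G` are summable and those of `H` bounded, so dominated convergence allows `η → 0⁺`
termwise. For `1 + η` the other expansion is used. -/
lemma shiftLim_sub {G H : ℂ → ℂ} (hG : HolCircle G) (hH : ContinuousOn H 𝕊) :
    ShiftLim (fun η => 1 - η) (fun z s => G z * H s)
      (-∑' m : ℕ, laurentCoeff G (-m - 1) * laurentCoeff H m) := by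
  have hev : ∀ᶠ η : ℝ in 𝓝[>] 0, 0 < 1 - η ∧ 1 - η < 1 := by
    filter_upwards [Ioo_mem_nhdsGT (zero_lt_one' ℝ)] with η hη
    constructor <;> linarith [hη.1, hη.2]
  refine ⟨hev.mono fun η h => ⟨h.1, h.2.ne⟩, fun z _ => continuousOn_const.mul hH, ?_, ?_⟩
  · filter_upwards [hev] with η h
    simp only [mul_div_assoc, circleIntegral.integral_const_mul]
    exact hG.continuousOn.mul (shiftedInt_lt h.1 h.2 hG.continuousOn hH).1
  · rw [← tsum_neg]
    have ht : Tendsto (fun η : ℝ => ∑' m : ℕ, -(((1 - η : ℝ) : ℂ) ^ m *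
        (laurentCoeff G (-m - 1) * laurentCoeff H m))) (𝓝[>] 0)
        (𝓝 (∑' m : ℕ, -(laurentCoeff G (-m - 1) * laurentCoeff H m))) := by
      refine tendsto_tsum_of_dominated_convergence (summable_laurentCoeff_mul hG hH
        (e := fun m : ℕ => -(m : ℤ) - 1) (e' := fun m => m) fun a b hab => by
          simp only at hab; omega) (fun m => ?_) ?_
      · have hc : Continuous fun η : ℝ => -(((1 - η : ℝ) : ℂ) ^ m *
          (laurentCoeff G (-m - 1) * laurentCoeff H m)) := by fun_prop
        have := (hc.tendsto 0).mono_left (nhdsWithin_le_nhds (s := Set.Ioi 0))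
        simpa using this
      · filter_upwards [hev] with η h m
        rw [norm_neg, norm_mul, norm_pow, Complex.norm_real, Real.norm_of_nonneg h.1.le]
        exact mul_le_of_le_one_left (norm_nonneg _) (pow_le_one₀ h.1.le h.2.le)
    refine ht.congr' ?_
    filter_upwards [hev] with η h
    exact (shiftedInt_lt h.1 h.2 hG.continuousOn hH).2.tsum_eq

lemma shiftLim_add {G H : ℂ → ℂ} (hG : HolCircle G) (hH : ContinuousOn H 𝕊) :
    ShiftLim (fun η => 1 + η) (fun z s => G z * H s)
      (∑' m : ℕ, laurentCoeff G m * laurentCoeff H (-m - 1)) := by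
  have hev : ∀ᶠ η : ℝ in 𝓝[>] 0, 1 < 1 + η := by
    filter_upwards [self_mem_nhdsWithin] with η hη
    have : 0 < η := hη
    linarith
  refine ⟨hev.mono fun η h => ⟨by linarith, h.ne'⟩, fun z _ => continuousOn_const.mul hH, ?_, ?_⟩
  · filter_upwards [hev] with η h
    simp only [mul_div_assoc, circleIntegral.integral_const_mul]
    exact hG.continuousOn.mul (shiftedInt_gt h hG.continuousOn hH).1
  · have ht : Tendsto (fun η : ℝ => ∑' m : ℕ, (((1 + η : ℝ) : ℂ)⁻¹) ^ (m + 1) *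
        (laurentCoeff G m * laurentCoeff H (-m - 1))) (𝓝[>] 0)
        (𝓝 (∑' m : ℕ, laurentCoeff G m * laurentCoeff H (-m - 1))) := by
      refine tendsto_tsum_of_dominated_convergence (summable_laurentCoeff_mul hG hH
        (e := fun m : ℕ => (m : ℤ)) (e' := fun m => -(m : ℤ) - 1) Nat.cast_injective)
        (fun m => ?_) ?_
      · have hc : ContinuousAt (fun η : ℝ => (((1 + η : ℝ) : ℂ)⁻¹) ^ (m + 1) *
          (laurentCoeff G m * laurentCoeff H (-m - 1))) 0 := by
          refine ((ContinuousAt.inv₀ (by fun_prop) (by simp)).pow _).mul continuousAt_const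
        have := hc.tendsto.mono_left (nhdsWithin_le_nhds (s := Set.Ioi 0))
        simpa using this
      · filter_upwards [hev] with η h m
        have h0 : 0 < 1 + η := by linarith
        rw [norm_mul, norm_pow, norm_inv, Complex.norm_real, Real.norm_of_nonneg h0.le]
        exact mul_le_of_le_one_left (norm_nonneg _)
          (pow_le_one₀ (by positivity) (inv_lt_one_of_one_lt₀ h).le)
    refine ht.congr' ?_
    filter_upwards [hev] with η h
    exact (shiftedInt_gt h hG.continuousOn hH).2.tsum_eq

/-! ### The limit of the regularised matrices -/

/-- The limits of the elementary regularised integrals are given by four functions. -/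
structure EdgeLimits (lnf : ℂ → ℂ) (ε : ℤ) (ePH ePK eTH eTK : ℤ → ℤ → ℂ) : Prop where
  sq : ε * ε = 1
  ph : ∀ p h : ℤ, ShiftLim (fun η => 1 - ε * η) (fun z s =>
    alphaRatio lnf ε ε ε z s * s ^ (-ε * p) * z ^ (-ε * h)) (-(ε : ℂ) * ePH p h)
  pk : ∀ p k : ℤ, ShiftLim (fun η => 1 + ε * η) (fun z s =>
    s ^ (-ε * p) * z ^ (ε * k - 1) * alphaRatio lnf ε (-ε) ε z s) ((ε : ℂ) * ePK p k)
  th : ∀ t h : ℤ, ShiftLim (fun η => 1 - ε * η) (fun z s =>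
    alphaRatio lnf ε ε (-ε) z s * s ^ (ε * t - 1) * z ^ (-ε * h)) ((ε : ℂ) * eTH t h)
  tk : ∀ t k : ℤ, ShiftLim (fun η => 1 - ε * η) (fun z s =>
    alphaRatio lnf ε (-ε) (-ε) z s * s ^ (ε * t - 1) * z ^ (ε * k - 1)) (-(ε : ℂ) * eTK t k)

/-- The limiting matrix for overlap `0`. -/
def baseMatrix (ePH ePK eTH eTK : ℤ → ℤ → ℂ) {n r : ℕ} (J : LacData n r) :
    Matrix (Fin n ⊕ Fin r) (Fin n ⊕ Fin r) ℂ :=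
  Matrix.fromBlocks (Matrix.of fun i j => ePH (J.p i) (J.h j))
    (Matrix.of fun i j => ePK (J.p i) (J.k j))
    (Matrix.of fun i j => eTH (J.t i) (J.h j))
    (Matrix.of fun i j => eTK (J.t i) (J.k j))

/-- The limiting matrix for overlap `c`. -/
def overlapMatrix (ePH ePK eTH eTK : ℤ → ℤ → ℂ) {n r : ℕ} (J : LacData n r) (c : ℕ) :
    Matrix (Fin n ⊕ Fin r) (Fin n ⊕ Fin r) ℂ :=
  Matrix.fromBlocks 1 (partialId n r c) 0 1 * (baseMatrix ePH ePK eTH eTK J * signedSwap n r c)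

variable {ePH ePK eTH eTK : ℤ → ℤ → ℂ} {n r : ℕ} {J : LacData n r} {c : ℕ}

/-- The overlap enters only through a unipotent row operation and a signed exchange of columns, both
of determinant one. -/
lemma det_overlapMatrix (hn : c ≤ n) (hr : c ≤ r) :
    (overlapMatrix ePH ePK eTH eTK J c).det = (baseMatrix ePH ePK eTH eTK J).det := by
  rw [overlapMatrix, Matrix.det_mul, Matrix.det_mul, det_signedSwap hn hr,
    Matrix.det_fromBlocks_zero₂₁]
  simp

lemma fromBlocks_mul_signedSwap (hn : c ≤ n) (hr : c ≤ r) {o o' : Type*}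
    (A : Matrix o (Fin n) ℂ) (B : Matrix o (Fin r) ℂ) (C : Matrix o' (Fin n) ℂ)
    (D : Matrix o' (Fin r) ℂ) :
    Matrix.fromBlocks A B C D * signedSwap n r c = Matrix.fromBlocks
      (Matrix.of fun i (j : Fin n) => if h : (j : ℕ) < c then B i ⟨j, h.trans_le hr⟩ else A i j)
      (Matrix.of fun i (j : Fin r) => if h : (j : ℕ) < c then -A i ⟨j, h.trans_le hn⟩ else B i j)
      (Matrix.of fun i (j : Fin n) => if h : (j : ℕ) < c then D i ⟨j, h.trans_le hr⟩ else C i j)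
      (Matrix.of fun i (j : Fin r) =>
        if h : (j : ℕ) < c then -C i ⟨j, h.trans_le hn⟩ else D i j) := by
  rw [signedSwap, Matrix.fromBlocks_multiply]
  congr 1 <;>
  · ext i j
    simp only [Matrix.mul_sub, Matrix.mul_one, Matrix.mul_neg, Matrix.add_apply, Matrix.sub_apply,
      Matrix.neg_apply, ← Matrix.mul_assoc, mul_partialId_apply hn, mul_partialId_apply hr,
      Matrix.of_apply]
    split_ifs <;> simp

namespace EdgeLimits

variable {lnf : ℂ → ℂ} {ε : ℤ} (H : EdgeLimits lnf ε ePH ePK eTH eTK)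
include H

/-- Each entry is a combination of the four elementary integrals. The terms with `a < c` come from
adding row `a` of block `II` to row `a` of block `I`, the tests on `b` from the column exchange; the
identity `h_a = t_a` for `a < c` matches the parameters. The signs cancel through `ε * ε = 1`. -/
theorem tendsto_matNReg (hJ : WellOrdered J.h J.t c) :
    Tendsto (fun η : ℝ => matNReg lnf ε J c η) (𝓝[>] 0)
      (𝓝 (overlapMatrix ePH ePK eTH eTK J c)) := by
  have hn : c ≤ n := hJ.1.trans (min_le_right _ _)
  have hr : c ≤ r := hJ.1.trans (min_le_left _ _)
  have hε : (ε : ℂ) * ε = 1 := by exact_mod_cast H.sq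
  have hmul : overlapMatrix ePH ePK eTH eTK J c = Matrix.fromBlocks 1 (partialId n r c) 0 1 *
      (baseMatrix ePH ePK eTH eTK J * signedSwap n r c) := rfl
  rw [baseMatrix, fromBlocks_mul_signedSwap hn hr, Matrix.fromBlocks_multiply] at hmul
  simp only [Matrix.one_mul, Matrix.zero_mul, zero_add] at hmul
  rw [hmul]
  refine tendsto_pi_nhds.2 fun i => tendsto_pi_nhds.2 fun j => ?_
  rcases i with a | a <;> rcases j with b | b
  -- The default `0` for `b ≥ r` is never seen: such terms carry the indicator of `b < c`, and `c ≤
  -- r`.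
  · set k : ℤ := if hb : (b : ℕ) < r then J.k ⟨b, hb⟩ else 0 with hk
    have h1 := ((((H.tk (J.h a) k).const_mul (ind ((b : ℕ) < c) * ind ((a : ℕ) < c))).add
      ((H.ph (J.p a) (J.h b)).const_mul (ind (c ≤ (b : ℕ))))).add
      ((H.th (J.h a) (J.h b)).const_mul (-(ind (c ≤ (b : ℕ)) * ind ((a : ℕ) < c))))).congr
      (G := fun z s =>
      ind ((b : ℕ) < c) * ind ((a : ℕ) < c) * alphaRatio lnf ε (-ε) (-ε) z s
          * s ^ (ε * J.h a - 1)
          * (if hb : (b : ℕ) < r then z ^ (ε * J.k ⟨b, hb⟩ - 1) else 0)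
      + ind (c ≤ (b : ℕ)) * alphaRatio lnf ε ε ε z s * s ^ (-ε * J.p a) * z ^ (-ε * J.h b)
      - ind (c ≤ (b : ℕ)) * ind ((a : ℕ) < c) * alphaRatio lnf ε ε (-ε) z s
          * s ^ (ε * J.h a - 1) * z ^ (-ε * J.h b)) (by
        intro z _ s _
        by_cases hb : (b : ℕ) < c
        · simp only [hk, dif_pos (hb.trans_le hr)]
          ring
        · simp only [ind, if_neg hb]
          ring)
    have h2 := ((H.pk (J.p a) k).const_mul (ind ((b : ℕ) < c))).congr (G := fun z s =>
      ind ((b : ℕ) < c) * (s ^ (-ε * J.p a) *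
        (if hb : (b : ℕ) < r then z ^ (ε * J.k ⟨b, hb⟩ - 1) else 0)
        * alphaRatio lnf ε (-ε) ε z s)) (by
        intro z _ s _
        by_cases hb : (b : ℕ) < c
        · simp only [hk, dif_pos (hb.trans_le hr)]
        · simp only [ind, if_neg hb]
          ring)
    have h3 := (h1.tend.const_mul (-(ε : ℂ))).add (h2.tend.const_mul (ε : ℂ))
    convert! h3 using 1
    · funext η
      simp only [matNReg, Matrix.fromBlocks_apply₁₁, blockI_I, Matrix.of_apply]
      congr 1
      simp only [shiftedInt, mul_div_assoc, circleIntegral.integral_const_mul]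
      ring
    · congr 1
      simp only [Matrix.fromBlocks_apply₁₁, Matrix.add_apply, partialId_mul_apply hr,
        Matrix.of_apply]
      by_cases hb : (b : ℕ) < c
      · by_cases ha : (a : ℕ) < c
        · rw [hJ.2.1 a ⟨a, ha.trans_le hr⟩ rfl ha]
          simp only [hb, ha, ind, hk, dif_pos (hb.trans_le hr), if_true, dif_pos, not_le.2 hb,
            if_false]
          linear_combination (-ePK (J.p a) (J.k ⟨b, hb.trans_le hr⟩) -
            eTK (J.t ⟨a, ha.trans_le hr⟩) (J.k ⟨b, hb.trans_le hr⟩)) * hε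
        · simp only [hb, ha, ind, hk, dif_pos (hb.trans_le hr), if_true, dif_pos, not_le.2 hb,
            if_false, dif_neg, not_false_eq_true]
          linear_combination (-ePK (J.p a) (J.k ⟨b, hb.trans_le hr⟩)) * hε
      · by_cases ha : (a : ℕ) < c
        · rw [hJ.2.1 a ⟨a, ha.trans_le hr⟩ rfl ha]
          simp only [hb, ha, ind, if_true, dif_pos, not_lt.1 hb, if_false, dif_neg,
            not_false_eq_true]
          linear_combination (-ePH (J.p a) (J.h b) - eTH (J.t ⟨a, ha.trans_le hr⟩) (J.h b)) * hε
        · simp only [hb, ha, ind, if_true, not_lt.1 hb, if_false, dif_neg,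
            not_false_eq_true]
          linear_combination (-ePH (J.p a) (J.h b)) * hε
  · have h1 := ((((H.th (J.h a) (J.t b)).const_mul (ind ((b : ℕ) < c) * ind ((a : ℕ) < c))).add
      ((H.tk (J.h a) (J.k b)).const_mul (ind (c ≤ (b : ℕ)) * ind ((a : ℕ) < c)))).add
      ((H.ph (J.p a) (J.t b)).const_mul (-(ind ((b : ℕ) < c))))).congr
      (G := fun z s =>
      ind ((b : ℕ) < c) * ind ((a : ℕ) < c) * alphaRatio lnf ε ε (-ε) z s
          * s ^ (ε * J.h a - 1) * z ^ (-ε * J.t b)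
      + ind (c ≤ (b : ℕ)) * ind ((a : ℕ) < c) * alphaRatio lnf ε (-ε) (-ε) z s
          * s ^ (ε * J.h a - 1) * z ^ (ε * J.k b - 1)
      - ind ((b : ℕ) < c) * alphaRatio lnf ε ε ε z s * s ^ (-ε * J.p a) * z ^ (-ε * J.t b)) (by
        intro z _ s _
        ring)
    have h2 := H.pk (J.p a) (J.k b)
    have h3 := (h1.tend.const_mul (-(ε : ℂ))).add
      (h2.tend.const_mul ((ε : ℂ) * ind (c ≤ (b : ℕ))))
    convert! h3 using 1
    congr 1
    simp only [Matrix.fromBlocks_apply₁₂, Matrix.add_apply, partialId_mul_apply hr,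
      Matrix.of_apply]
    by_cases hb : (b : ℕ) < c
    · have hbt := hJ.2.1 ⟨b, hb.trans_le hn⟩ b rfl hb
      by_cases ha : (a : ℕ) < c
      · rw [hJ.2.1 a ⟨a, ha.trans_le hr⟩ rfl ha]
        simp only [hb, ha, ind, if_true, dif_pos, not_le.2 hb, if_false, hbt]
        linear_combination (ePH (J.p a) (J.t b) + eTH (J.t ⟨a, ha.trans_le hr⟩) (J.t b)) * hε
      · simp only [hb, ha, ind, if_true, dif_pos, not_le.2 hb, if_false, dif_neg,
          not_false_eq_true, hbt]
        linear_combination (ePH (J.p a) (J.t b)) * hε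
    · by_cases ha : (a : ℕ) < c
      · rw [hJ.2.1 a ⟨a, ha.trans_le hr⟩ rfl ha]
        simp only [hb, ha, ind, if_true, dif_pos, not_lt.1 hb, if_false, dif_neg,
          not_false_eq_true]
        linear_combination (-ePK (J.p a) (J.k b) - eTK (J.t ⟨a, ha.trans_le hr⟩) (J.k b)) * hε
      · simp only [hb, ha, ind, if_true, not_lt.1 hb, if_false, dif_neg,
          not_false_eq_true]
        linear_combination (-ePK (J.p a) (J.k b)) * hε
  · set k : ℤ := if hb : (b : ℕ) < r then J.k ⟨b, hb⟩ else 0 with hk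
    have h1 := (((H.tk (J.t a) k).const_mul (ind ((b : ℕ) < c))).add
      ((H.th (J.t a) (J.h b)).const_mul (-(ind (c ≤ (b : ℕ)))))).congr
      (G := fun z s => s ^ (ε * J.t a - 1) *
        (ind ((b : ℕ) < c) * alphaRatio lnf ε (-ε) (-ε) z s
            * (if hb : (b : ℕ) < r then z ^ (ε * J.k ⟨b, hb⟩ - 1) else 0)
          - ind (c ≤ (b : ℕ)) * alphaRatio lnf ε ε (-ε) z s * z ^ (-ε * J.h b))) (by
        intro z _ s _
        by_cases hb : (b : ℕ) < c
        · simp only [hk, dif_pos (hb.trans_le hr)]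
          ring
        · simp only [ind, if_neg hb]
          ring)
    convert! h1.tend.const_mul (-(ε : ℂ)) using 1
    congr 1
    simp only [Matrix.fromBlocks_apply₂₁, Matrix.of_apply]
    by_cases hb : (b : ℕ) < c
    · simp only [hb, ind, hk, dif_pos (hb.trans_le hr), if_true, dif_pos, not_le.2 hb, if_false]
      linear_combination (-eTK (J.t a) (J.k ⟨b, hb.trans_le hr⟩)) * hε
    · simp only [hb, ind, if_true, not_lt.1 hb, if_false, dif_neg, not_false_eq_true]
      linear_combination (-eTH (J.t a) (J.h b)) * hε
  · have h1 := (((H.th (J.t a) (J.t b)).const_mul (ind ((b : ℕ) < c))).add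
      ((H.tk (J.t a) (J.k b)).const_mul (ind (c ≤ (b : ℕ))))).congr
      (G := fun z s => s ^ (ε * J.t a - 1) *
        (ind ((b : ℕ) < c) * alphaRatio lnf ε ε (-ε) z s * z ^ (-ε * J.t b)
          + ind (c ≤ (b : ℕ)) * alphaRatio lnf ε (-ε) (-ε) z s * z ^ (ε * J.k b - 1))) (by
        intro z _ s _
        ring)
    convert! h1.tend.const_mul (-(ε : ℂ)) using 1
    congr 1
    simp only [Matrix.fromBlocks_apply₂₂, Matrix.of_apply]
    by_cases hb : (b : ℕ) < c
    · have hbt := hJ.2.1 ⟨b, hb.trans_le hn⟩ b rfl hb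
      simp only [hb, ind, if_true, dif_pos, not_le.2 hb, if_false, hbt]
      linear_combination (eTH (J.t a) (J.t b)) * hε
    · simp only [hb, ind, if_true, not_lt.1 hb, if_false, dif_neg, not_false_eq_true]
      linear_combination (-eTK (J.t a) (J.k b)) * hε

theorem matN_eq (hJ : WellOrdered J.h J.t c) :
    matN lnf ε J c = overlapMatrix ePH ePK eTH eTK J c :=
  (H.tendsto_matNReg hJ).limUnder_eq

end EdgeLimits

/-! ### The elementary limits at the two edges -/

section

variable {lnf : ℂ → ℂ} (h : HolCircle lnf)
include h

/-- With `α₊ = facA'` and `α₋ = facB` on the circle, every integrand separates as `G z * H s`;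
multiplication by a power shifts the Laurent index, and the limits become the right-edge sums. -/
lemma HolCircle.edgeLimits_one : EdgeLimits lnf 1
    (edgePH (laurentCoeff (LacunaryToeplitz.facA lnf)) (laurentCoeff (LacunaryToeplitz.facA' lnf)))
    (edgePK (laurentCoeff (LacunaryToeplitz.facA lnf)) (laurentCoeff (LacunaryToeplitz.facB lnf)))
    (edgeTH (laurentCoeff (LacunaryToeplitz.facA' lnf))
      (laurentCoeff (LacunaryToeplitz.facB' lnf)))
    (edgeTK (laurentCoeff (LacunaryToeplitz.facB lnf))
      (laurentCoeff (LacunaryToeplitz.facB' lnf))) where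
  sq := rfl
  ph p q := by
    have h1 := shiftLim_sub (h.facA'.mul (holCircle_zpow (-q)))
      (h.facA.mul (holCircle_zpow (-p))).continuousOn
    convert! h1.congr (fun z hz s hs => ?_) using 1
    · funext η; norm_num
    · simp only [laurentCoeff_mul_zpow, edgePH]
      rw [Int.cast_one, neg_one_mul]
      refine congrArg Neg.neg (tsum_congr fun m => ?_)
      rw [mul_comm]; congr 2 <;> ring
    · simp only [alphaRatio, alphaSign, zpow_one, if_pos one_pos, h.alphaPlus_eq hz,
        h.alphaPlus_eq hs, LacunaryToeplitz.facA', LacunaryToeplitz.facA, Complex.exp_neg,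
        neg_one_mul]
      rw [div_inv_eq_mul]; ring
  pk p k := by
    have h1 := shiftLim_add (h.facB.mul (holCircle_zpow (k - 1)))
      (h.facA.mul (holCircle_zpow (-p))).continuousOn
    convert! h1.congr (fun z hz s hs => ?_) using 1
    · funext η; norm_num
    · simp only [laurentCoeff_mul_zpow, edgePK]
      rw [Int.cast_one, one_mul]
      refine tsum_congr fun m => ?_
      rw [mul_comm]; congr 2 <;> ring
    · simp only [alphaRatio, alphaSign, zpow_one, if_pos one_pos, h.alphaMinus_eq hz,
        h.alphaPlus_eq hs, LacunaryToeplitz.facA', LacunaryToeplitz.facA, Complex.exp_neg,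
        neg_one_mul, one_mul, if_neg (by decide : ¬ (0 : ℤ) < -1)]
      rw [div_inv_eq_mul]; ring
  th t q := by
    have h1 := shiftLim_sub (h.facA'.mul (holCircle_zpow (-q)))
      (h.facB'.mul (holCircle_zpow (t - 1))).continuousOn
    convert! h1.congr (fun z hz s hs => ?_) using 1
    · funext η; norm_num
    · simp only [laurentCoeff_mul_zpow, edgeTH]
      rw [Int.cast_one, one_mul]
      refine congrArg Neg.neg (tsum_congr fun m => ?_)
      rw [mul_comm]; congr 2 <;> ring
    · simp only [alphaRatio, alphaSign, zpow_one, if_pos one_pos, h.alphaPlus_eq hz,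
        h.alphaMinus_eq hs, LacunaryToeplitz.facB', LacunaryToeplitz.facB, Complex.exp_neg,
        neg_one_mul, one_mul, if_neg (by decide : ¬ (0 : ℤ) < -1)]
      rw [div_eq_mul_inv]; ring
  tk t k := by
    have h1 := shiftLim_sub (h.facB.mul (holCircle_zpow (k - 1)))
      (h.facB'.mul (holCircle_zpow (t - 1))).continuousOn
    convert! h1.congr (fun z hz s hs => ?_) using 1
    · funext η; norm_num
    · simp only [laurentCoeff_mul_zpow, edgeTK]
      rw [Int.cast_one, neg_one_mul]
      refine congrArg Neg.neg (tsum_congr fun m => ?_)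
      rw [mul_comm]; congr 2 <;> ring
    · simp only [alphaRatio, alphaSign, zpow_one, h.alphaMinus_eq hz,
        h.alphaMinus_eq hs, LacunaryToeplitz.facB', LacunaryToeplitz.facB, Complex.exp_neg,
        one_mul, if_neg (by decide : ¬ (0 : ℤ) < -1)]
      rw [div_eq_mul_inv]; ring

/-- For `ε = -1` the directions in which the pole is moved are exchanged, which produces the
reflected sequences. The shifts by `1` compensate the data `p - 1`, `h - 1`, `k - 1`, `t - 1` of the
left edge. -/
lemma HolCircle.edgeLimits_neg_one : EdgeLimits lnf (-1)
    (fun p q => edgePH (fun n => laurentCoeff (LacunaryToeplitz.facB lnf) (-n))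
      (fun n => laurentCoeff (LacunaryToeplitz.facB' lnf) (-n)) (p + 1) (q + 1))
    (fun p k => edgePK (fun n => laurentCoeff (LacunaryToeplitz.facB lnf) (-n))
      (fun n => laurentCoeff (LacunaryToeplitz.facA lnf) (-n)) (p + 1) (k + 1))
    (fun t q => edgeTH (fun n => laurentCoeff (LacunaryToeplitz.facB' lnf) (-n))
      (fun n => laurentCoeff (LacunaryToeplitz.facA' lnf) (-n)) (t + 1) (q + 1))
    (fun t k => edgeTK (fun n => laurentCoeff (LacunaryToeplitz.facA lnf) (-n))
      (fun n => laurentCoeff (LacunaryToeplitz.facA' lnf) (-n)) (t + 1) (k + 1)) where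
  sq := rfl
  ph p q := by
    have h1 := shiftLim_add (h.facB'.mul (holCircle_zpow q))
      (h.facB.mul (holCircle_zpow p)).continuousOn
    convert! h1.congr (fun z hz s hs => ?_) using 1
    · funext η; norm_num
    · simp only [laurentCoeff_mul_zpow, edgePH]
      rw [Int.cast_neg, Int.cast_one, neg_neg, one_mul]
      refine tsum_congr fun m => ?_
      rw [mul_comm]; congr 2 <;> ring
    · simp only [alphaRatio, alphaSign, zpow_neg_one, h.alphaMinus_eq hz,
        h.alphaMinus_eq hs, LacunaryToeplitz.facB', LacunaryToeplitz.facB, Complex.exp_neg,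
        neg_neg, one_mul, if_neg (by decide : ¬ (0 : ℤ) < -1), inv_div]
      rw [div_eq_mul_inv]; ring
  pk p k := by
    have h1 := shiftLim_sub (h.facA.mul (holCircle_zpow (-k - 1)))
      (h.facB.mul (holCircle_zpow p)).continuousOn
    convert! h1.congr (fun z hz s hs => ?_) using 1
    · funext η; norm_num
      ring
    · simp only [laurentCoeff_mul_zpow, edgePK]
      rw [Int.cast_neg, Int.cast_one, neg_one_mul]
      refine congrArg Neg.neg (tsum_congr fun m => ?_)
      rw [mul_comm]; congr 2 <;> ring
    · simp only [alphaRatio, alphaSign, zpow_neg_one, h.alphaPlus_eq hz,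
        h.alphaMinus_eq hs, LacunaryToeplitz.facA', LacunaryToeplitz.facA, Complex.exp_neg,
        neg_neg, one_mul, neg_one_mul, if_neg (by decide : ¬ (0 : ℤ) < -1), if_pos one_pos, inv_div]
      rw [div_inv_eq_mul]; ring
  th t q := by
    have h1 := shiftLim_add (h.facB'.mul (holCircle_zpow q))
      (h.facA'.mul (holCircle_zpow (-t - 1))).continuousOn
    convert! h1.congr (fun z hz s hs => ?_) using 1
    · funext η; norm_num
    · simp only [laurentCoeff_mul_zpow, edgeTH]
      rw [Int.cast_neg, Int.cast_one, neg_mul_neg, one_mul]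
      refine tsum_congr fun m => ?_
      rw [mul_comm]; congr 2 <;> ring
    · simp only [alphaRatio, alphaSign, zpow_neg_one, h.alphaMinus_eq hz,
        h.alphaPlus_eq hs, LacunaryToeplitz.facB', LacunaryToeplitz.facB, Complex.exp_neg,
        neg_neg, one_mul, neg_one_mul, if_neg (by decide : ¬ (0 : ℤ) < -1), if_pos one_pos, inv_div]
      rw [div_eq_mul_inv]; ring
  tk t k := by
    have h1 := shiftLim_add (h.facA.mul (holCircle_zpow (-k - 1)))
      (h.facA'.mul (holCircle_zpow (-t - 1))).continuousOn
    convert! h1.congr (fun z hz s hs => ?_) using 1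
    · funext η; norm_num
    · simp only [laurentCoeff_mul_zpow, edgeTK]
      rw [Int.cast_neg, Int.cast_one, neg_neg, one_mul]
      refine tsum_congr fun m => ?_
      rw [mul_comm]; congr 2 <;> ring
    · simp only [alphaRatio, alphaSign, zpow_neg_one, h.alphaPlus_eq hz,
        h.alphaPlus_eq hs, LacunaryToeplitz.facA', LacunaryToeplitz.facA, Complex.exp_neg,
        neg_neg, neg_one_mul, if_pos one_pos, inv_div]
      rw [div_inv_eq_mul]; ring

end

/-! ### The main theorem -/

lemma det_ne_zero_of_rank_eq_card {ν : Type*} [Fintype ν] [DecidableEq ν] {A : Matrix ν ν ℂ}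
    (h : A.rank = Fintype.card ν) : A.det ≠ 0 := by
  rw [Matrix.rank, ← Module.finrank_fintype_fun_eq_card (R := ℂ)] at h
  have hs : Function.Surjective A.mulVecLin :=
    LinearMap.range_eq_top.1 (Submodule.eq_top_of_finrank_eq h)
  have : IsUnit A := Matrix.mulVec_surjective_iff_isUnit.1 hs
  exact ((Matrix.isUnit_iff_isUnit_det A).1 this).ne_zero

end LacunaryToeplitz

end

open LacunaryToeplitz in
theorem mainTheorem2
    (f lnf : ℂ → ℂ) (U : Set ℂ) (hUopen : IsOpen U) (hU : Metric.sphere (0 : ℂ) 1 ⊆ U)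
    (hf : DifferentiableOn ℂ f U) (hlnf : DifferentiableOn ℂ lnf U)
    (hexp : ∀ z ∈ U, Complex.exp (lnf z) = f z)
    (nm np rm rp : ℕ)
    (pm hm : Fin nm → ℤ) (pp hp : Fin np → ℤ)
    (km tm : Fin rm → ℤ) (kp tp : Fin rp → ℤ)
    (pm_pos : ∀ a, 1 ≤ pm a) (hm_pos : ∀ a, 1 ≤ hm a)
    (pp_pos : ∀ a, 1 ≤ pp a) (hp_pos : ∀ a, 1 ≤ hp a)
    (km_pos : ∀ a, 1 ≤ km a) (tm_pos : ∀ a, 1 ≤ tm a)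
    (kp_pos : ∀ a, 1 ≤ kp a) (tp_pos : ∀ a, 1 ≤ tp a)
    (pm_inj : Function.Injective pm) (hm_inj : Function.Injective hm)
    (pp_inj : Function.Injective pp) (hp_inj : Function.Injective hp)
    (km_inj : Function.Injective km) (tm_inj : Function.Injective tm)
    (kp_inj : Function.Injective kp) (tp_inj : Function.Injective tp)
    (cp cm : ℕ) (hcp : WellOrdered hp tp cp) (hcm : WellOrdered hm tm cm)
    (Jp : LacData np rp) (hJp : Jp = ⟨pp, hp, kp, tp⟩)
    (Jm : LacData nm rm)
    (hJm : Jm = ⟨fun a => pm a - 1, fun a => hm a - 1, fun a => km a - 1, fun a => tm a - 1⟩)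
    (hrankp : (matN lnf 1 Jp cp).rank = np + rp)
    (hrankm : (matN lnf (-1) Jm cm).rank = nm + rm)
    (l m : ℕ → ℤ → ℤ)
    (hl : ∀ N : ℕ, l N =
      lacSeq (Sum.elim hm fun a => (N : ℤ) + 1 - hp a) (Sum.elim (fun a => 1 - pm a) fun a => pp a + N))
    (hms : ∀ N : ℕ, m N =
      lacSeq (Sum.elim tm fun a => (N : ℤ) + 1 - tp a) (Sum.elim (fun a => 1 - km a) fun a => kp a + N)) :
    -- the boundary values and the regularised integrals in the matrix entries do exist
    (∀ z ∈ Metric.sphere (0 : ℂ) 1,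
      Tendsto (alpha lnf) (𝓝[Metric.ball 0 1] z) (𝓝 (alphaPlus lnf z)) ∧
      Tendsto (alpha lnf) (𝓝[(Metric.closedBall 0 1)ᶜ] z) (𝓝 (alphaMinus lnf z))) ∧
    Tendsto (fun η : ℝ => matNReg lnf 1 Jp cp η) (𝓝[>] 0) (𝓝 (matN lnf 1 Jp cp)) ∧
    Tendsto (fun η : ℝ => matNReg lnf (-1) Jm cm η) (𝓝[>] 0) (𝓝 (matN lnf (-1) Jm cm)) ∧
    -- the asymptotics
    (∀ᶠ N : ℕ in atTop, (toeplitzMatrix f N id id).det ≠ 0) ∧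
    ∃ u : ℕ → ℂ, IsBigONegInfty u ∧
      ∀ᶠ N : ℕ in atTop,
        (toeplitzMatrix f N (l N) (m N)).det * ((toeplitzMatrix f N id id).det)⁻¹ =
          (matN lnf 1 Jp cp).det * (matN lnf (-1) Jm cm).det * (1 + u N) := by
  have hfc : HolCircle f := ⟨U, hUopen, hU, hf⟩
  have hlc : HolCircle lnf := ⟨U, hUopen, hU, hlnf⟩
  obtain ⟨ρ, C, W⟩ := hlc.exists_wienerHopf hfc fun z hz => hexp z (hU hz)
  subst hJp hJm
  have hwp : WellOrdered hp tp cp := hcp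
  have hwm : WellOrdered (fun a => hm a - 1) (fun a => tm a - 1) cm :=
    ⟨hcm.1, fun a b hab ha => by simp only [hcm.2.1 a b hab ha],
      fun a b ha hb e => hcm.2.2 a b ha hb (by linarith)⟩
  have hLp := hlc.edgeLimits_one
  have hLm := hlc.edgeLimits_neg_one
  -- The determinant no longer depends on the overlap, so it can be compared with the edge matrix,
  -- which knows nothing of `c`.
  have hdetp : (matN lnf 1 ⟨pp, hp, kp, tp⟩ cp).det = (edgeMatrix (laurentCoeff (facA lnf))
      (laurentCoeff (facA' lnf)) (laurentCoeff (facB lnf)) (laurentCoeff (facB' lnf))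
      pp hp kp tp).det := by
    rw [hLp.matN_eq hwp, det_overlapMatrix (hwp.1.trans (min_le_right _ _))
      (hwp.1.trans (min_le_left _ _))]
    rfl
  have hdetm : (matN lnf (-1) ⟨fun a => pm a - 1, fun a => hm a - 1, fun a => km a - 1,
      fun a => tm a - 1⟩ cm).det = (edgeMatrix (fun n => laurentCoeff (facB lnf) (-n))
      (fun n => laurentCoeff (facB' lnf) (-n)) (fun n => laurentCoeff (facA lnf) (-n))
      (fun n => laurentCoeff (facA' lnf) (-n)) pm hm km tm).det := by
    rw [hLm.matN_eq hwm, det_overlapMatrix (hwm.1.trans (min_le_right _ _))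
      (hwm.1.trans (min_le_left _ _))]
    simp only [baseMatrix, edgeMatrix, sub_add_cancel]
  have ht : ∀ N, toeplitzMatrix f N id id = toep (laurentCoeff f) N := fun N => by
    ext i j
    simp only [toeplitzMatrix, toep, Matrix.of_apply, id, add_sub_add_right_eq_sub]
  refine ⟨fun z hz => ?_, ?_, ?_, ?_, ?_⟩
  · rw [hlc.alphaPlus_eq hz, hlc.alphaMinus_eq hz]
    exact ⟨hlc.tendsto_alpha_inside hz, hlc.tendsto_alpha_outside hz⟩
  · rw [hLp.matN_eq hwp]
    exact hLp.tendsto_matNReg hwp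
  · rw [hLm.matN_eq hwm]
    exact hLm.tendsto_matNReg hwm
  · simp only [ht]
    exact W.eventually_isUnit_det_toep.mono fun N hN => hN.1.ne_zero
  · have hDp := det_ne_zero_of_rank_eq_card (hrankp.trans (by simp))
    have hDm := det_ne_zero_of_rank_eq_card (hrankm.trans (by simp))
    set D := (matN lnf 1 ⟨pp, hp, kp, tp⟩ cp).det * (matN lnf (-1) ⟨fun a => pm a - 1,
      fun a => hm a - 1, fun a => km a - 1, fun a => tm a - 1⟩ cm).det with hD
    have hD0 : D ≠ 0 := mul_ne_zero hDp hDm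
    have key := W.det_ratio_asymptotics pm hm pp hp km tm kp tp pm_pos hm_pos pp_pos hp_pos
      km_pos tm_pos kp_pos tp_pos hm_inj hp_inj tm_inj tp_inj
    rw [← hdetp, ← hdetm, mul_comm (matN lnf (-1) _ _).det, ← hD] at key
    refine ⟨_, key.const_mul D⁻¹, Eventually.of_forall fun N => ?_⟩
    -- Since `D ≠ 0` by maximal rank, the additive error `X - D` becomes the relative error `D⁻¹ *
    -- (X - D)`, which is the witness for `u`.
    have hX : ∀ X : ℂ, X = D * (1 + D⁻¹ * (X - D)) := fun X => by
      rw [mul_add, mul_inv_cancel_left₀ hD0]; ring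
    rw [ht, hl, hms]
    exact hX _
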